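/- All matroids are finite. For a subset $X$ of the ground set $E$ of a matroid $M$ let $\lambda_M(X)=r(X)+r(E-X)-r(M)$. A $t$-separation of $M$ is a partition $(A,B)$ of $E$ (parts may be empty) with $\lambda_M(A)<t$. Write $\mathrm{cl}_M$ for the closure operator of $M$ and $\mathrm{cl}^*_M$ for that of the dual $M^*$. A $GF(q)$-representation of $M$ is a matrix over $GF(q)$, with finitely many rows and with columns labelled by $E$, such that a subset of $E$ is independent in $M$ exactly when the corresponding columns are linearly independent. Two representations are equivalent if one can be obtained from the other by elementary row operations (adding one row to another, scaling a row by a nonzero scalar, adjoining or deleting a row of zeroes) and scaling columns by nonzero scalars. An excluded minor for $GF(q)$-representability is a matroid that is not $GF(q)$-representable but all of whose proper minors are. **Theorem.** Let $q$ be a prime power and let $\mathcal C$ be a class of matroids such that the following hold. (i) For every nonempty matroid $M$ in $\mathcal C$ there exists $e\in E(M)$ such that $M\backslash e$ or $M/e$ is in $\mathcal C$. (ii) There exists an integer $t$ such that, for all $M\in\mathcal C$ and $e\in E(M)$: (a) if $M/e\notin\mathcal C$, then there is a $t$-separation $(A,B)$ of $M$ with $e\in \mathrm{cl}_M(A-\{e\})\cap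 \mathrm{cl}_M(B-\{e\})$; (b) if $M\backslash e\notin\mathcal C$, then there is a $t$-separation $(A,B)$ of $M$ with $e\in \mathrm{cl}^*_M(A-\{e\})\cap \mathrm{cl}^*_M(B-\{e\})$. (iii) There exists an integer $s$ such that each matroid in $\mathcal C$ has at most $s$ inequivalent $GF(q)$-representations. (iv) Each excluded minor for $GF(q)$-representability belongs to $\mathcal C$. Then proving that an $n$-element matroid is not $GF(q)$-representable requires at most $O(n^2)$ rank evaluations. That is, there is a constant $c$ (depending only on $q$ and $\mathcal C$) such that for every matroid $M$ on a ground set $E$ of $n$ elements that is not $GF(q)$-representable there is a collection $\mathcal S$ of at most $cn^2$ subsets of $E$ such that no matroid $N$ on $E$ with $r_N(X)=r_M(X)$ for all $X\in\mathcal S$ is $GF(q)$-representable. -/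

import Mathlib

universe u v

namespace MatroidCert

/-! ### Representations over a field and their equivalence -/

section Representations

variable {E : Type u} {F : Type v} [Field F]

/-- Matrices over `F` with columns labelled by `E` and any finite number of rows. -/
abbrev LabelledMatrix (E : Type u) (F : Type v) : Type (max u v) :=
  Σ m : ℕ, Matrix (Fin m) E F

/-- One elementary operation: adding one row to another, scaling a row by a nonzero scalar,
adjoining a row of zeroes (at any position), or scaling the columns by nonzero scalars.
Deleting a row of zeroes is the reverse of adjoining one. -/
inductive ElementaryStep : LabelledMatrix E F → LabelledMatrix E F → Prop
  | addRow (m : ℕ) (A : Matrix (Fin m) E F) (i j : Fin m) (hij : i ≠ j) :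
      ElementaryStep ⟨m, A⟩ ⟨m, A.updateRow j (A.row j + A.row i)⟩
  | scaleRow (m : ℕ) (A : Matrix (Fin m) E F) (i : Fin m) (c : F) (hc : c ≠ 0) :
      ElementaryStep ⟨m, A⟩ ⟨m, A.updateRow i (c • A.row i)⟩
  | adjoinZeroRow (m : ℕ) (A : Matrix (Fin m) E F) (k : Fin (m + 1)) :
      ElementaryStep ⟨m, A⟩ ⟨m + 1, Matrix.of (k.insertNth (0 : E → F) A.row)⟩
  | scaleCols (m : ℕ) (A : Matrix (Fin m) E F) (d : E → F) (hd : ∀ x, d x ≠ 0) :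
      ElementaryStep ⟨m, A⟩ ⟨m, Matrix.of fun i x => d x * A i x⟩

/-- Two labelled matrices are equivalent if one can be obtained from the other by a finite
sequence of elementary row operations (including adjoining or deleting zero rows) and column
scalings. -/
def Equivalent (A B : LabelledMatrix E F) : Prop :=
  Relation.EqvGen ElementaryStep A B

end Representations

section Matroids

variable {α : Type u} (F : Type v) [Field F]

/-- The matrix `A`, with columns labelled by the ground set of `M`, represents `M`: a set of
elements is independent in `M` exactly when the corresponding family of columns is linearly
independent. -/
def Represents (M : Matroid α) (A : LabelledMatrix M.E F) : Prop :=
  ∀ I : Set M.E, M.Indep (Subtype.val '' I) ↔ LinearIndepOn F A.2.col I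

/-- `M` is representable over `F`. -/
def Representable (M : Matroid α) : Prop :=
  ∃ A : LabelledMatrix M.E F, Represents F M A

/-- `M` has at most `s` inequivalent representations over `F`: every set of pairwise
inequivalent representations has at most `s` members. -/
def HasAtMostInequivReps (M : Matroid α) (s : ℕ) : Prop :=
  ∀ R : Set (LabelledMatrix M.E F), (∀ A ∈ R, Represents F M A) →
    (R.Pairwise fun A B => ¬ Equivalent A B) → R.encard ≤ s

/-- `M` is an excluded minor for representability over `F`: it is a finite matroid that is not
representable, while all its proper minors are. -/
def IsExcludedMinor (M : Matroid α) : Prop :=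
  M.Finite ∧ ¬ Representable F M ∧ ∀ N : Matroid α, N <m M → Representable F N

/-- The rank of a set in a (finite) matroid, as a natural number. -/
noncomputable def rk (M : Matroid α) (X : Set α) : ℕ := (M.eRk X).toNat

/-- The connectivity function `λ(X) = r(X) + r(E - X) - r(M)`. -/
noncomputable def conn (M : Matroid α) (X : Set α) : ℤ :=
  (rk M X : ℤ) + rk M (M.E \ X) - rk M M.E

/-- `(A, B)` is a `k`-separation of `M`: a partition of the ground set (with possibly empty
parts) such that `λ(A) < k`. -/
def IsSeparation (M : Matroid α) (k : ℤ) (A B : Set α) : Prop :=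
  A ∪ B = M.E ∧ Disjoint A B ∧ conn M A < k

/-- `e` is in the guts of some `t`-separation `(A, B)` of `M`, in the sense that
`e ∈ cl(A - e) ∩ cl(B - e)`. -/
def InGuts (M : Matroid α) (t : ℤ) (e : α) : Prop :=
  ∃ A B : Set α, IsSeparation M t A B ∧ e ∈ M.closure (A \ {e}) ∩ M.closure (B \ {e})

/-- `e` is in the coguts of some `t`-separation `(A, B)` of `M`, in the sense that
`e ∈ cl*(A - e) ∩ cl*(B - e)`, where `cl*` is the closure operator of the dual. -/
def InCoguts (M : Matroid α) (t : ℤ) (e : α) : Prop :=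
  ∃ A B : Set α, IsSeparation M t A B ∧ e ∈ M✶.closure (A \ {e}) ∩ M✶.closure (B \ {e})

/-- The values of the rank function of `M` on the sets in `S` prove that `M` is not
representable over `F`: no matroid on the same ground set having the same rank as `M` on each
member of `S` is representable over `F`. -/
def CertifiesNonrep (M : Matroid α) (S : Finset (Set α)) : Prop :=
  (∀ X ∈ S, X ⊆ M.E) ∧
    ∀ N : Matroid α, N.E = M.E → (∀ X ∈ S, rk N X = rk M X) → ¬ Representable F N

end Matroids

end MatroidCert

open MatroidCert
open scoped Matroid

/-! A nonrepresentable matroid has an excluded minor `M ／ X ＼ Y`, which lies in the class. It is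
enough to pin down that minor among representable matroids by few rank values, since adding `X` to
every query and querying `X` itself transfers the certificate to `M`. The stronger property
`HasCertificate` is proved for every member of the class, representable or not, by removing one
element `e` at a time. Each removal costs O(n) queries, whence O(n²) in total.

If `M ＼ {e}` is in the class, any representable competitor of `M` consists, up to linear maps and
scaling, of one of at most `s` representations of `M ＼ {e}` and a vector `v` for `e`. At most n
queries force `v` into `U`, the intersection of the spans of all sets whose closure in `M` contains
`e`. If `U` has bounded dimension, finiteness of the field leaves boundedly many `v`, each handled
by one query. If `U` is covered by a few spans of sets `X`, none containing `U`, then no such `X`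
has `e` in its closure, and asking for the ranks of the sets `X + e` leaves no `v` at all.

If `M ／ {e}` is in the class and `E - e` splits into `A`, `B` of bounded connectivity with `e` in
neither closure, a competitor is a coextension of one of `s` representations. It is determined by a
functional on the bounded-dimensional space `span A ∩ span B`, so again boundedly many candidates
remain.

These cases suffice. If `M ＼ {e}` leaves the class, hypothesis (b) supplies `A` and `B`. If it stays
and `U` is large, hypothesis (a) puts `M ／ {e}` in the class, because `U` lies in the guts of any
separation having `e` in its guts. Then either some cut of order at most q² has `U` in neither span,
which serves for contraction, or `coveredBySpans_of_finrank` covers `U`.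

That covering theorem is the core. Given a spanning circuit `C` modulo a set `K` such that `U` has
rank at least q modulo `K`, two of any q+1 elements of `C` can be eliminated from each vector of `U`
by subtracting one multiple of the circuit (`coveredBySpans_of_circuit`). The circuit is grown one
element at a time across a nested sequence of minimum cuts towards `U`, using a linking theorem
(`exists_link`) and a version that also preserves a circuit through a prescribed direction
(`earLinked`). -/

namespace MatroidCert
open Module Submodule

/-! ### Submodularity and Tutte's linking theorem for vector configurations -/

section LinearAlgebra

variable {F : Type*} {V : Type*} {α : Type*} [Field F] [AddCommGroup V] [Module F V]

/-- The span of the vectors indexed by a finset. -/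
def sp (F : Type*) {V : Type*} {α : Type*} [Field F] [AddCommGroup V] [Module F V]
    (a : α → V) (A : Finset α) : Submodule F V := span F (a '' (A : Set α))

theorem sp_empty (a : α → V) : sp F a ∅ = ⊥ := by simp [sp]

theorem sp_mono {a : α → V} {A B : Finset α} (h : A ⊆ B) : sp F a A ≤ sp F a B :=
  span_mono (Set.image_mono (Finset.coe_subset.2 h))

theorem sp_singleton (a : α → V) (e : α) : sp F a {e} = span F {a e} := by simp [sp]

theorem mem_sp (a : α → V) {A : Finset α} {e : α} (h : e ∈ A) : a e ∈ sp F a A :=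
  subset_span ⟨e, h, rfl⟩

theorem sp_le {a : α → V} {A : Finset α} {W : Submodule F V} : sp F a A ≤ W ↔ ∀ e ∈ A, a e ∈ W := by
  simp [sp, span_le, Set.subset_def]

theorem mem_sup_span_singleton (W : Submodule F V) (x : V) : x ∈ W ⊔ span F {x} :=
  le_sup_right (a := W) (mem_span_singleton_self x)

variable [DecidableEq α]

theorem sp_insert (a : α → V) (e : α) (A : Finset α) :
    sp F a (insert e A) = span F {a e} ⊔ sp F a A := by
  simp [sp, Set.image_insert_eq, span_insert]

theorem sp_union (a : α → V) (A B : Finset α) : sp F a (A ∪ B) = sp F a A ⊔ sp F a B := by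
  simp [sp, Set.image_union, span_union]

variable [FiniteDimensional F V]

theorem finrank_sup_span_singleton {W : Submodule F V} {x : V} (hx : x ∉ W) :
    finrank F (W ⊔ span F {x} : Submodule F V) = finrank F W + 1 := by
  have h0 : x ≠ 0 := fun h => hx (h ▸ W.zero_mem)
  have h1 := finrank_sup_add_finrank_inf_eq W (span F {x})
  have h2 : W ⊓ span F {x} = ⊥ := by
    rw [eq_bot_iff]
    rintro y ⟨hy, hy'⟩
    obtain ⟨c, rfl⟩ := mem_span_singleton.1 hy'
    by_cases hc : c = 0
    · simp [hc]
    · exact absurd ((W.smul_mem_iff hc).1 hy) hx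
  rw [h2, finrank_bot, finrank_span_singleton h0] at h1
  simpa using h1

theorem finrank_sup_span_singleton_le (W : Submodule F V) (x : V) :
    finrank F (W ⊔ span F {x} : Submodule F V) ≤ finrank F W + 1 := by
  by_cases hx : x ∈ W
  · rw [sup_eq_left.2 ((span_singleton_le_iff_mem x W).2 hx)]; omega
  · rw [finrank_sup_span_singleton hx]

theorem finrank_sup_sp_le (W : Submodule F V) (a : α → V) (A : Finset α) :
    finrank F (W ⊔ sp F a A : Submodule F V) ≤ finrank F W + A.card := by
  induction A using Finset.induction with
  | empty => rw [sp_empty, sup_bot_eq, Finset.card_empty]; rfl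
  | insert e A he ih =>
    rw [sp_insert, Finset.card_insert_of_notMem he, sup_comm (span F _), ← sup_assoc]
    have := finrank_sup_span_singleton_le (W ⊔ sp F a A) (a e)
    omega

theorem finrank_sp_le (a : α → V) (A : Finset α) : finrank F (sp F a A) ≤ A.card := by
  have := finrank_sup_sp_le (⊥ : Submodule F V) a A
  rwa [bot_sup_eq, finrank_bot, zero_add] at this

theorem finrank_lt_of_mem {W W' : Submodule F V} (h : W ≤ W') {x : V} (hx : x ∈ W') (hx' : x ∉ W) :
    finrank F W + 1 ≤ finrank F W' :=
  finrank_lt_finrank_of_lt (lt_of_le_of_ne h (fun h => hx' (h ▸ hx)))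

/-- Dimension formula for the four intersections: the sums on the left contain `Z`, those on the
right lie in `Z`, while `S₁ ⊓ S₂` and `T₁ ⊓ T₂` contain `s` and `t`. -/
theorem finrank_uncross {s t S₁ S₂ T₁ T₂ Z : Submodule F V} (hs₁ : s ≤ S₁) (hs₂ : s ≤ S₂)
    (ht₁ : t ≤ T₁) (ht₂ : t ≤ T₂) (h₁ : S₁ ⊔ T₁ ≤ Z) (h₂ : S₂ ⊔ T₂ ≤ Z)
    (h₃ : Z ≤ s ⊔ (T₁ ⊔ T₂)) (h₄ : Z ≤ (S₁ ⊔ S₂) ⊔ t) :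
    finrank F (s ⊓ (T₁ ⊔ T₂) : Submodule F V) + finrank F ((S₁ ⊔ S₂) ⊓ t : Submodule F V) ≤
      finrank F (S₁ ⊓ T₁ : Submodule F V) + finrank F (S₂ ⊓ T₂ : Submodule F V) := by
  have e₁ := finrank_sup_add_finrank_inf_eq s (T₁ ⊔ T₂)
  have e₂ := finrank_sup_add_finrank_inf_eq (S₁ ⊔ S₂) t
  have e₃ := finrank_sup_add_finrank_inf_eq S₁ T₁
  have e₄ := finrank_sup_add_finrank_inf_eq S₂ T₂
  have e₅ := finrank_sup_add_finrank_inf_eq S₁ S₂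
  have e₆ := finrank_sup_add_finrank_inf_eq T₁ T₂
  have i₁ := finrank_mono h₁
  have i₂ := finrank_mono h₂
  have i₃ := finrank_mono h₃
  have i₄ := finrank_mono h₄
  have i₅ := finrank_mono (le_inf hs₁ hs₂)
  have i₆ := finrank_mono (le_inf ht₁ ht₂)
  omega

/-- The dimension of the intersection of the spans of the two sides of a partition of `R`, where
`P` is joined to the first side and `Γ` to the second. -/
noncomputable def linkDim (a : α → V) (P Γ : Submodule F V) (R A : Finset α) : ℕ :=
  finrank F ((P ⊔ sp F a A) ⊓ (Γ ⊔ sp F a (R \ A)) : Submodule F V)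

/-- Uncrosses a cut of the deletion of `e` with a cut of the contraction of `e`, so a loss of
connectivity cannot occur in both. Contraction is modelled by joining `e` to both `P` and `Γ`; the
vector `e` itself then lies in the intersection, which is why contracted dimensions are expected to
be one larger. -/
theorem linkDim_uncross (a : α → V) (P Γ : Submodule F V) {R A₁ A₂ : Finset α} {e : α}
    (he : e ∉ R) (h₁ : A₁ ⊆ R) (h₂ : A₂ ⊆ R) :
    linkDim a P Γ (insert e R) (A₁ ∩ A₂) + linkDim a P Γ (insert e R) (insert e (A₁ ∪ A₂)) ≤
      linkDim a P Γ R A₁ + linkDim a (P ⊔ span F {a e}) (Γ ⊔ span F {a e}) R A₂ := by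
  have c₁ : insert e R \ (A₁ ∩ A₂) = insert e ((R \ A₁) ∪ (R \ A₂)) := by
    ext x; by_cases hx : x = e
    · subst hx; have : x ∉ A₁ := fun h => he (h₁ h); simp [this]
    · simp [hx]; tauto
  have c₂ : insert e R \ (insert e (A₁ ∪ A₂)) = (R \ A₁) ∩ (R \ A₂) := by
    ext x; by_cases hx : x = e
    · subst hx; simp [he]
    · simp [hx]; tauto
  have d₁ : sp F a A₁ ⊔ sp F a (R \ A₁) = sp F a R := by
    rw [← sp_union, Finset.union_sdiff_of_subset h₁]
  have d₂ : sp F a A₂ ⊔ sp F a (R \ A₂) = sp F a R := by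
    rw [← sp_union, Finset.union_sdiff_of_subset h₂]
  have key := finrank_uncross (s := P ⊔ sp F a (A₁ ∩ A₂)) (t := Γ ⊔ sp F a ((R \ A₁) ∩ (R \ A₂)))
    (S₁ := P ⊔ sp F a A₁) (S₂ := P ⊔ span F {a e} ⊔ sp F a A₂)
    (T₁ := Γ ⊔ sp F a (R \ A₁)) (T₂ := Γ ⊔ span F {a e} ⊔ sp F a (R \ A₂))
    (Z := P ⊔ Γ ⊔ span F {a e} ⊔ sp F a R)
    (sup_le_sup_left (sp_mono Finset.inter_subset_left) _)
    (sup_le_sup le_sup_left (sp_mono Finset.inter_subset_right))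
    (sup_le_sup_left (sp_mono Finset.inter_subset_left) _)
    (sup_le_sup le_sup_left (sp_mono Finset.inter_subset_right))
    (by
      have : sp F a A₁ ≤ sp F a R := sp_mono h₁
      have : sp F a (R \ A₁) ≤ sp F a R := sp_mono Finset.sdiff_subset
      order)
    (by
      have : sp F a A₂ ≤ sp F a R := sp_mono h₂
      have : sp F a (R \ A₂) ≤ sp F a R := sp_mono Finset.sdiff_subset
      order)
    (by
      have : sp F a R ≤ sp F a (A₁ ∩ A₂) ⊔ (sp F a (R \ A₁) ⊔ sp F a (R \ A₂)) := by
        rw [← sp_union, ← sp_union]; apply sp_mono; intro x; simp; tauto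
      order)
    (by
      have : sp F a R ≤ (sp F a A₁ ⊔ sp F a A₂) ⊔ sp F a ((R \ A₁) ∩ (R \ A₂)) := by
        rw [← sp_union, ← sp_union]; apply sp_mono; intro x; simp; tauto
      order)
  unfold linkDim
  have w₁ : Γ ⊔ sp F a (insert e ((R \ A₁) ∪ (R \ A₂))) =
      (Γ ⊔ sp F a (R \ A₁)) ⊔ (Γ ⊔ span F {a e} ⊔ sp F a (R \ A₂)) := by
    rw [sp_insert, sp_union]; order
  have w₂ : P ⊔ sp F a (insert e (A₁ ∪ A₂)) =
      (P ⊔ sp F a A₁) ⊔ (P ⊔ span F {a e} ⊔ sp F a A₂) := by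
    rw [sp_insert, sp_union]; order
  rw [c₁, c₂, w₁, w₂]
  exact key

theorem linkDim_insert_of_mem {a : α → V} {P Γ : Submodule F V} {R A : Finset α} {e : α}
    (he : e ∉ R) (h : a e ∈ P) :
    linkDim a P Γ (insert e R) (insert e A) = linkDim a P Γ R A := by
  unfold linkDim
  have : insert e R \ insert e A = R \ A := by
    ext x; by_cases hx : x = e
    · subst hx; simp [he]
    · simp [hx]
  rw [this, sp_insert, ← sup_assoc, sup_eq_left.2 ((span_singleton_le_iff_mem _ _).2 h)]

/-- Tutte's linking theorem: contracting a suitable basis `K` of `R` modulo `P` and deleting the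
rest keeps connectivity `κ` between `P` and `Γ`; the summand `K.card` accounts for the contracted
vectors. By induction, each element is deleted if no cut drops below `κ`, and otherwise contracted
by `linkDim_uncross`. -/
theorem exists_link (a : α → V) (R : Finset α) (P Γ : Submodule F V) (κ : ℕ)
    (h : ∀ A ⊆ R, κ ≤ linkDim a P Γ R A) :
    ∃ K ⊆ R, finrank F (P ⊔ sp F a K : Submodule F V) = finrank F P + K.card ∧
      P ⊔ sp F a K = P ⊔ sp F a R ∧
      κ + K.card ≤ finrank F ((P ⊔ sp F a R) ⊓ (Γ ⊔ sp F a K) : Submodule F V) := by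
  induction R using Finset.induction generalizing P Γ κ with
  | empty => exact ⟨∅, subset_rfl, by rw [sp_empty, sup_bot_eq, Finset.card_empty]; rfl, rfl,
      h ∅ subset_rfl⟩
  | insert e R he ih =>
    by_cases hd : ∀ A ⊆ R, κ ≤ linkDim a P Γ R A
    · obtain ⟨K, hK, h₁, h₂, h₃⟩ := ih P Γ κ hd
      by_cases hm : a e ∈ P ⊔ sp F a K
      · have h₄ : P ⊔ sp F a (insert e R) = P ⊔ sp F a R := by
          have : span F {a e} ≤ P ⊔ sp F a R := (span_singleton_le_iff_mem _ _).2 (h₂ ▸ hm)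
          rw [sp_insert]; order
        exact ⟨K, hK.trans (Finset.subset_insert _ _), h₁, by rw [h₄, h₂], by rw [h₄]; exact h₃⟩
      -- Here `e` is a coloop over `P` and `R`; it must join `K` to keep a basis, and it raises the
      -- intersection by one.
      · have heK : e ∉ K := fun h => he (hK h)
        refine ⟨insert e K, Finset.insert_subset_insert _ hK, ?_, ?_, ?_⟩
        · rw [sp_insert, sup_comm (span F _), ← sup_assoc, finrank_sup_span_singleton hm, h₁,
            Finset.card_insert_of_notMem heK, add_assoc]
        · rw [sp_insert, sp_insert, sup_left_comm, h₂, sup_left_comm]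
        · rw [Finset.card_insert_of_notMem heK, ← add_assoc]
          refine (Nat.add_le_add_right h₃ 1).trans (finrank_lt_of_mem (x := a e) ?_ ?_ ?_)
          · rw [sp_insert, sp_insert]
            exact inf_le_inf (by order) (by order)
          · rw [sp_insert, sp_insert]
            exact ⟨le_sup_right (a := P) (le_sup_left (b := sp F a R) (mem_span_singleton_self _)),
              le_sup_right (a := Γ) (le_sup_left (b := sp F a K) (mem_span_singleton_self _))⟩
          · intro h; exact hm (h₂ ▸ h.1)
    · push Not at hd
      obtain ⟨A₁, hA₁, hlt⟩ := hd
      have heP : a e ∉ P := by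
        intro hP
        have := h (insert e A₁) (Finset.insert_subset_insert _ hA₁)
        rw [linkDim_insert_of_mem he hP] at this
        omega
      obtain ⟨K, hK, h₁, h₂, h₃⟩ := ih (P ⊔ span F {a e}) (Γ ⊔ span F {a e}) (κ + 1) (by
        intro A₂ hA₂
        have := linkDim_uncross a P Γ he hA₁ hA₂
        have i₁ := h (A₁ ∩ A₂)
          ((Finset.inter_subset_left.trans hA₁).trans (Finset.subset_insert _ _))
        have i₂ := h (insert e (A₁ ∪ A₂))
          (Finset.insert_subset_insert _ (Finset.union_subset hA₁ hA₂))
        omega)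
      have heK : e ∉ K := fun h => he (hK h)
      rw [finrank_sup_span_singleton heP] at h₁
      refine ⟨insert e K, Finset.insert_subset_insert _ hK, ?_, ?_, ?_⟩
      · rw [sp_insert, ← sup_assoc, h₁, Finset.card_insert_of_notMem heK]; omega
      · rw [sp_insert, ← sup_assoc, h₂, sp_insert, sup_assoc]
      · rw [sp_insert, sp_insert, ← sup_assoc, ← sup_assoc, Finset.card_insert_of_notMem heK]
        omega

end LinearAlgebra
end MatroidCert

namespace MatroidCert
open Module Submodule

set_option linter.unusedSectionVars false
-- Linking that preserves a circuit through a prescribed direction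
section Ears

variable {F : Type*} {V : Type*} {α : Type*} [Field F] [AddCommGroup V] [Module F V]
  [DecidableEq α] [FiniteDimensional F V]

theorem mem_of_mem_sup_of_inf_eq_bot {X Y W : Submodule F V} (h : X ≤ W) (hd : W ⊓ Y = ⊥) {b : V}
    (hb : b ∈ W) (hb' : b ∈ X ⊔ Y) : b ∈ X := by
  obtain ⟨x, hx, y, hy, rfl⟩ := mem_sup.1 hb'
  have : y ∈ W ⊓ Y := ⟨by simpa using W.sub_mem hb (h hx), hy⟩
  rw [hd, mem_bot] at this
  simpa [this] using hx

theorem inf_eq_bot_of_finrank {W Y : Submodule F V} {n : ℕ} (hY : finrank F Y ≤ n)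
    (h : finrank F W + n ≤ finrank F (W ⊔ Y : Submodule F V)) : W ⊓ Y = ⊥ := by
  have := finrank_sup_add_finrank_inf_eq W Y
  rw [← finrank_eq_zero (R := F) (M := V)]
  omega

theorem inf_span_singleton_eq_bot {W : Submodule F V} {x : V} (hx : x ∉ W) :
    W ⊓ span F {x} = ⊥ :=
  inf_eq_bot_of_finrank (n := 1) (by
    have := finrank_sup_span_singleton_le (⊥ : Submodule F V) x
    rwa [bot_sup_eq, finrank_bot] at this)
    (finrank_sup_span_singleton hx).ge

theorem sup_span_singleton_eq_of_finrank {L₀ L : Submodule F V} (h : L₀ ≤ L)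
    (hd : finrank F L = finrank F L₀ + 1) {x : V} (hx : x ∈ L) (hx' : x ∉ L₀) :
    L₀ ⊔ span F {x} = L :=
  eq_of_le_of_finrank_le (sup_le h ((span_singleton_le_iff_mem _ _).2 hx))
    (by rw [finrank_sup_span_singleton hx', hd])

/-- The outcome of linking `R` to `Γ` across `L` while keeping a circuit through the quotient of
`L` by `L₀`: the set `K` is linked, and `p`, `b` are parallel modulo `K` and `L` but distinct
modulo `K` and `L₀`. -/
def EarLinked (a : α → V) (L L₀ Γ : Submodule F V) (κ : ℕ) (R : Finset α) : Prop :=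
  ∃ K ⊆ R, ∃ p ∈ R, ∃ b ∈ R,
    finrank F (L ⊔ sp F a (insert p K) : Submodule F V) = finrank F L + K.card + 1 ∧
    L ⊔ sp F a (insert p K) = L ⊔ sp F a R ∧
    κ + 1 + K.card ≤ finrank F ((L ⊔ sp F a R) ⊓ (Γ ⊔ sp F a K) : Submodule F V) ∧
    a b ∉ L ⊔ sp F a K ∧ a b ∉ L₀ ⊔ sp F a (insert p K)

theorem notMem_of_pair {L L₀ : Submodule F V} (hd : finrank F L = finrank F L₀ + 1)
    {x y : V} (hear : L ≤ L₀ ⊔ (span F {x} ⊔ span F {y})) (hx : x ∈ L → x ∈ L₀)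
    (hy : y ∈ L → y ∈ L₀) : y ∉ L := by
  intro h
  have h₁ : L ≤ L₀ ⊔ span F {x} := by
    have := (span_singleton_le_iff_mem y L₀).2 (hy h)
    order
  have h₂ := finrank_sup_span_singleton_le L₀ x
  have h₃ : L = L₀ ⊔ span F {x} := eq_of_le_of_finrank_le h₁ (by omega)
  have h₄ : x ∈ L₀ := hx (h₃ ▸ mem_sup_span_singleton L₀ x)
  rw [sup_eq_left.2 ((span_singleton_le_iff_mem _ _).2 h₄)] at h₃
  rw [h₃] at hd
  omega

theorem mem_sup_of_pair {L L₀ : Submodule F V} (hd : finrank F L = finrank F L₀ + 1)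
    {x y : V} (hear : L ≤ L₀ ⊔ (span F {x} ⊔ span F {y})) (hy : y ∉ L) :
    x ∈ L ⊔ span F {y} := by
  have h₁ := finrank_sup_span_singleton hy
  have h₂ := finrank_sup_span_singleton_le L₀ x
  have h₃ := finrank_sup_span_singleton_le (L₀ ⊔ span F {x}) y
  have h₄ : L ⊔ span F {y} = L₀ ⊔ span F {x} ⊔ span F {y} :=
    eq_of_le_of_finrank_le (by order) (by omega)
  rw [h₄]
  exact (le_sup_left : L₀ ⊔ span F {x} ≤ _) (mem_sup_span_singleton L₀ x)

/-- Over `L` the elements `e` and `y` are parallel, while together they generate `L` over `L₀`. So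
`y` and `e` serve as `p` and `b`, and ordinary linking modulo `y` supplies `K`. -/
theorem earLinked_of_pair (a : α → V) {L L₀ Γ : Submodule F V} {κ : ℕ} {R : Finset α}
    (hd : finrank F L = finrank F L₀ + 1)
    {e y : α}
    (h : ∀ A ⊆ R, κ + 1 ≤ linkDim a L Γ (insert e (insert y R)) (insert e (insert y A)))
    (hear : L ≤ L₀ ⊔ sp F a {e, y}) (he₀ : a e ∈ L → a e ∈ L₀) (hy₀ : a y ∈ L → a y ∈ L₀) :
    EarLinked a L L₀ Γ κ (insert e (insert y R)) := by
  have hear' : L ≤ L₀ ⊔ (span F {a e} ⊔ span F {a y}) := by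
    rwa [sp_insert, sp_singleton] at hear
  have hyL := notMem_of_pair hd hear' he₀ hy₀
  have hey := mem_sup_of_pair hd hear' hyL
  rw [sup_comm (span F _)] at hear'
  have heL := notMem_of_pair hd hear' hy₀ he₀
  have hye := mem_sup_of_pair hd hear' heL
  have hR : L ⊔ sp F a (insert e (insert y R)) = L ⊔ span F {a y} ⊔ sp F a R := by
    have := (span_singleton_le_iff_mem _ _).2 hey
    rw [sp_insert, sp_insert]; order
  obtain ⟨K, hK, h₁, h₂, h₃⟩ := exists_link a R (L ⊔ span F {a y}) Γ (κ + 1) (by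
    intro A hA
    refine (h A hA).trans (finrank_mono (inf_le_inf ?_ (sup_le_sup_left (sp_mono ?_) _)))
    · have := (span_singleton_le_iff_mem _ _).2 hey
      rw [sp_insert, sp_insert]; order
    · intro x; simp; tauto)
  rw [finrank_sup_span_singleton hyL] at h₁
  have hpK : L ⊔ sp F a (insert y K) = L ⊔ span F {a y} ⊔ sp F a K := by
    rw [sp_insert, sup_assoc]
  refine ⟨K, fun x hx => by simp [hK hx], y, by simp, e, by simp, ?_, ?_, ?_, ?_, ?_⟩
  · rw [hpK, h₁]; omega
  · rw [hpK, hR, h₂]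
  · rw [hR]; exact h₃
  · intro hm
    have h₅ : L ⊔ span F {a y} ⊔ sp F a K ≤ L ⊔ sp F a K := by
      have := (span_singleton_le_iff_mem _ _).2 hm
      have := (span_singleton_le_iff_mem _ _).2 hye
      order
    have := finrank_mono h₅
    have := finrank_sup_sp_le L a K
    omega
  · intro hm
    rw [sp_insert, ← sup_assoc] at hm
    have h₅ : L ⊔ span F {a y} ⊔ sp F a K ≤ L₀ ⊔ span F {a y} ⊔ sp F a K := by
      have := (span_singleton_le_iff_mem _ _).2 hm
      order
    have := finrank_mono h₅
    have := finrank_sup_sp_le (L₀ ⊔ span F {a y}) a K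
    have := finrank_sup_span_singleton_le L₀ (a y)
    omega

theorem earLinked_of_contract {a : α → V} {L L₀ Γ : Submodule F V} {κ : ℕ} {R : Finset α} {e : α}
    (he : e ∉ R) (heL : a e ∉ L)
    (h : EarLinked a (L ⊔ span F {a e}) (L₀ ⊔ span F {a e}) (Γ ⊔ span F {a e}) (κ + 1) R) :
    EarLinked a L L₀ Γ κ (insert e R) := by
  obtain ⟨K, hK, p, hp, b, hb, h₁, h₂, h₃, h₄, h₅⟩ := h
  have heK : e ∉ K := fun h => he (hK h)
  have hs : ∀ (W : Submodule F V) A, W ⊔ sp F a (insert e A) = W ⊔ span F {a e} ⊔ sp F a A := by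
    intro W A; rw [sp_insert, sup_assoc]
  refine ⟨insert e K, Finset.insert_subset_insert _ hK, p, Finset.mem_insert_of_mem hp, b,
    Finset.mem_insert_of_mem hb, ?_, ?_, ?_, ?_, ?_⟩
  · rw [Finset.insert_comm, hs, h₁, finrank_sup_span_singleton heL,
      Finset.card_insert_of_notMem heK]; omega
  · rw [Finset.insert_comm, hs, h₂, hs]
  · rw [hs, hs, Finset.card_insert_of_notMem heK]; omega
  · rwa [hs]
  · rwa [Finset.insert_comm, hs]

theorem earLinked_of_delete {a : α → V} {L L₀ Γ : Submodule F V} {κ : ℕ} {R : Finset α} {e : α}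
    (hL : L₀ ≤ L) (he : e ∉ R) (h : EarLinked a L L₀ Γ κ R) :
    EarLinked a L L₀ Γ κ (insert e R) := by
  obtain ⟨K, hK, p, hp, b, hb, h₁, h₂, h₃, h₄, h₅⟩ := h
  have hs : ∀ (W : Submodule F V) A, W ⊔ sp F a (insert e A) = W ⊔ sp F a A ⊔ span F {a e} := by
    intro W A; rw [sp_insert, sup_comm (span F _), sup_assoc]
  by_cases hm : a e ∈ L ⊔ sp F a R
  · have hR : L ⊔ sp F a (insert e R) = L ⊔ sp F a R := by
      rw [hs, sup_eq_left.2 ((span_singleton_le_iff_mem _ _).2 hm)]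
    refine ⟨K, hK.trans (Finset.subset_insert _ _), p, Finset.mem_insert_of_mem hp, b,
      Finset.mem_insert_of_mem hb, h₁, ?_, ?_, h₄, h₅⟩
    · rw [hR, h₂]
    · rwa [hR]
  · have heK : e ∉ K := fun h => he (hK h)
    have hbR : a b ∈ L ⊔ sp F a R := le_sup_right (a := L) (mem_sp a hb)
    have hd := inf_span_singleton_eq_bot hm
    have hpK : sp F a (insert p K) ≤ sp F a R := sp_mono (Finset.insert_subset hp hK)
    refine ⟨insert e K, Finset.insert_subset_insert _ hK, p, Finset.mem_insert_of_mem hp, b,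
      Finset.mem_insert_of_mem hb, ?_, ?_, ?_, ?_, ?_⟩
    · rw [Finset.insert_comm, hs, finrank_sup_span_singleton (h₂ ▸ hm), h₁,
        Finset.card_insert_of_notMem heK]; omega
    · rw [Finset.insert_comm, hs, h₂, hs]
    · rw [hs, hs, Finset.card_insert_of_notMem heK]
      refine (Nat.add_le_add_right h₃ 1).trans (finrank_lt_of_mem (x := a e)
        (inf_le_inf le_sup_left le_sup_left)
        ⟨mem_sup_span_singleton _ _, mem_sup_span_singleton _ _⟩ fun h => hm h.1)
    · rw [hs]
      exact fun h => h₄ (mem_of_mem_sup_of_inf_eq_bot (sup_le_sup_left (sp_mono hK) _) hd hbR h)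
    · rw [Finset.insert_comm, hs]
      exact fun h => h₅ (mem_of_mem_sup_of_inf_eq_bot (sup_le_sup hL hpK) hd hbR h)

/-- Modular law: inside `A₁`, everything beyond may be replaced by the guts of the cut at `A₁`. -/
theorem linkDim_restrict (a : α → V) (L Γ : Submodule F V) {R A₁ A : Finset α} (hA : A ⊆ A₁)
    (hA₁ : A₁ ⊆ R) :
    linkDim a L ((L ⊔ sp F a A₁) ⊓ (Γ ⊔ sp F a (R \ A₁))) A₁ A = linkDim a L Γ R A := by
  unfold linkDim
  have h₁ : sp F a (A₁ \ A) ≤ L ⊔ sp F a A₁ := (sp_mono Finset.sdiff_subset).trans le_sup_right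
  have h₂ : sp F a (R \ A) = sp F a (R \ A₁) ⊔ sp F a (A₁ \ A) := by
    rw [← sp_union]; congr 1; ext x; simp only [Finset.mem_sdiff, Finset.mem_union]
    have := @hA x; have := @hA₁ x; tauto
  have h₃ : (L ⊔ sp F a A₁) ⊓ (Γ ⊔ sp F a (R \ A₁)) ⊔ sp F a (A₁ \ A) =
      (L ⊔ sp F a A₁) ⊓ (Γ ⊔ sp F a (R \ A)) := by
    rw [inf_sup_assoc_of_le _ h₁, h₂, sup_assoc]
  have h₄ : L ⊔ sp F a A ≤ L ⊔ sp F a A₁ := sup_le_sup_left (sp_mono hA) _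
  rw [h₃, ← inf_assoc, inf_eq_left.2 h₄]

/-- At a tight cut the two halves can be linked separately: `K₁` links `L` to the guts inside `A₁`,
then `K₂` links the guts to `Γ`. Tightness makes the guts independent of `K₁`, so contracting `K₁`
costs nothing in the second half. -/
theorem earLinked_of_ear {a : α → V} {L L₀ Γ : Submodule F V} {κ : ℕ} {R A₁ : Finset α}
    (hL : L₀ ≤ L) (hA₁ : A₁ ⊆ R) (h : ∀ A ⊆ R, A₁ ⊆ A → κ + 1 ≤ linkDim a L Γ R A)
    (hle : linkDim a L Γ R A₁ ≤ κ + 1)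
    (hlink : EarLinked a L L₀ ((L ⊔ sp F a A₁) ⊓ (Γ ⊔ sp F a (R \ A₁))) κ A₁) :
    EarLinked a L L₀ Γ κ R := by
  obtain ⟨K₁, hK₁, p, hp, b, hb, h₁, h₂, h₃, h₄, h₅⟩ := hlink
  set Γ₁ := (L ⊔ sp F a A₁) ⊓ (Γ ⊔ sp F a (R \ A₁)) with hΓ₁
  have hK₁A : sp F a K₁ ≤ L ⊔ sp F a A₁ := (sp_mono hK₁).trans le_sup_right
  have hc := finrank_sp_le a K₁ (F := F)
  have hle' : finrank F Γ₁ ≤ κ + 1 := hle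
  have h₃' : κ + 1 + K₁.card ≤ finrank F (Γ₁ ⊔ sp F a K₁ : Submodule F V) :=
    h₃.trans (finrank_mono inf_le_right)
  have hbot : Γ₁ ⊓ sp F a K₁ = ⊥ := inf_eq_bot_of_finrank hc (by omega)
  have hcard : finrank F (sp F a K₁) = K₁.card := by
    have := finrank_sup_add_finrank_inf_eq Γ₁ (sp F a K₁); omega
  obtain ⟨K₂, hK₂, g₁, g₂, g₃⟩ := exists_link a (R \ A₁) (L ⊔ sp F a A₁) (Γ ⊔ sp F a K₁)
    (κ + 1 + K₁.card) (by
      intro A hA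
      have hA' := Finset.subset_sdiff.1 hA
      have i₁ := h (A₁ ∪ A) (Finset.union_subset hA₁ hA'.1) Finset.subset_union_left
      unfold linkDim at i₁ ⊢
      rw [sp_union, ← sup_assoc, ← Finset.sup_eq_union, ← sdiff_sdiff_left] at i₁
      have e₁ : (L ⊔ sp F a A₁ ⊔ sp F a A) ⊓ (Γ ⊔ sp F a K₁ ⊔ sp F a ((R \ A₁) \ A)) =
          (L ⊔ sp F a A₁ ⊔ sp F a A) ⊓ (Γ ⊔ sp F a ((R \ A₁) \ A)) ⊔ sp F a K₁ := by
        rw [inf_sup_assoc_of_le _ (hK₁A.trans le_sup_left)]; congr 1; order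
      have e₂ : (L ⊔ sp F a A₁ ⊔ sp F a A) ⊓ (Γ ⊔ sp F a ((R \ A₁) \ A)) ⊓ sp F a K₁ = ⊥ := by
        rw [eq_bot_iff, ← hbot, hΓ₁]
        have : sp F a ((R \ A₁) \ A) ≤ sp F a (R \ A₁) := sp_mono Finset.sdiff_subset
        refine le_inf (le_inf (inf_le_right.trans hK₁A) ?_) inf_le_right
        exact (inf_le_left.trans inf_le_right).trans (sup_le_sup_left this _)
      have := finrank_sup_add_finrank_inf_eq
        ((L ⊔ sp F a A₁ ⊔ sp F a A) ⊓ (Γ ⊔ sp F a ((R \ A₁) \ A))) (sp F a K₁)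
      rw [e₂, finrank_bot] at this
      rw [e₁]
      omega)
  have hR : L ⊔ sp F a A₁ ⊔ sp F a (R \ A₁) = L ⊔ sp F a R := by
    rw [sup_assoc, ← sp_union, Finset.union_sdiff_of_subset hA₁]
  have hs : ∀ (W : Submodule F V) A, W ⊔ sp F a (A ∪ K₂) = W ⊔ sp F a A ⊔ sp F a K₂ := by
    intro W A; rw [sp_union, sup_assoc]
  have hbA : a b ∈ L ⊔ sp F a A₁ := le_sup_right (a := L) (mem_sp a hb)
  have hpK : sp F a (insert p K₁) ≤ sp F a A₁ := sp_mono (Finset.insert_subset hp hK₁)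
  have hbot₂ : (L ⊔ sp F a A₁) ⊓ sp F a K₂ = ⊥ := inf_eq_bot_of_finrank (finrank_sp_le a K₂) g₁.ge
  have hdisj : (K₁ ∪ K₂).card = K₁.card + K₂.card :=
    Finset.card_union_of_disjoint (Finset.disjoint_of_subset_left hK₁
      (Finset.disjoint_of_subset_right hK₂ Finset.disjoint_sdiff))
  refine ⟨K₁ ∪ K₂, Finset.union_subset (hK₁.trans hA₁) (hK₂.trans Finset.sdiff_subset),
    p, hA₁ hp, b, hA₁ hb, ?_, ?_, ?_, ?_, ?_⟩
  · rw [← Finset.insert_union, hs, h₂, g₁, ← h₂, h₁, hdisj]; omega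
  · rw [← Finset.insert_union, hs, h₂, g₂, hR]
  · rw [hs, ← hR, hdisj]; omega
  · rw [hs]
    exact fun h => h₄ (mem_of_mem_sup_of_inf_eq_bot (sup_le_sup_left (sp_mono hK₁) _) hbot₂ hbA h)
  · rw [← Finset.insert_union, hs]
    exact fun h => h₅ (mem_of_mem_sup_of_inf_eq_bot (sup_le_sup hL hpK) hbot₂ hbA h)

/-- A set `A` with `L ≤ L₀ ⊔ sp F a A` carries a circuit through the direction `L / L₀`, called an
ear. The induction deletes or contracts elements, keeping an ear and the extra unit of connectivity
demanded of cuts that contain one, until the ear is a pair. -/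
theorem earLinked (a : α → V) (R : Finset α) (L L₀ Γ : Submodule F V) (κ : ℕ)
    (hL : L₀ ≤ L) (hd : finrank F L = finrank F L₀ + 1)
    (h₁ : ∀ A ⊆ R, κ ≤ linkDim a L Γ R A)
    (h₂ : ∀ A ⊆ R, L ≤ L₀ ⊔ sp F a A → κ + 1 ≤ linkDim a L Γ R A)
    (h₃ : L ≤ L₀ ⊔ sp F a R) (h₄ : ∀ e ∈ R, a e ∈ L → a e ∈ L₀) :
    EarLinked a L L₀ Γ κ R := by
  induction hn : R.card using Nat.strong_induction_on generalizing R L L₀ Γ κ with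
  | _ n ih =>
  subst hn
  by_cases hpair : ∃ e ∈ R, ∃ y ∈ R, e ≠ y ∧ L ≤ L₀ ⊔ sp F a {e, y}
  · obtain ⟨e, he, y, hy, hne, hear⟩ := hpair
    have hR : R = insert e (insert y ((R.erase e).erase y)) := by
      rw [Finset.insert_erase (Finset.mem_erase.2 ⟨hne.symm, hy⟩), Finset.insert_erase he]
    rw [hR]
    refine earLinked_of_pair a hd ?_ hear (h₄ e he) (h₄ y hy)
    rw [← hR]
    intro A hA
    refine h₂ _ ?_ (hear.trans (sup_le_sup_left (sp_mono ?_) _))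
    · intro x; simp only [Finset.mem_insert]
      rintro (rfl | rfl | hx)
      exacts [he, hy, Finset.mem_of_mem_erase (Finset.mem_of_mem_erase (hA hx))]
    · intro x; simp; tauto
  push Not at hpair
  -- If contraction of `e` brought `f` into `L` but not `L₀`, then `e` and `f` would already form an
  -- ear.
  have hcon4 : ∀ e ∈ R, a e ∉ L → ∀ f ∈ R.erase e, a f ∈ L ⊔ span F {a e} →
      a f ∈ L₀ ⊔ span F {a e} := by
    intro e he heL f hf hfm
    by_contra hfm'
    refine hpair e he f (Finset.mem_of_mem_erase hf) (Finset.ne_of_mem_erase hf).symm ?_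
    have heL₀ : a e ∉ L₀ := fun h => heL (hL h)
    rw [sp_insert, sp_singleton, ← sup_assoc]
    rw [sup_span_singleton_eq_of_finrank (sup_le_sup_right hL _) (by
      rw [finrank_sup_span_singleton heL, finrank_sup_span_singleton heL₀, hd]) hfm hfm']
    exact le_sup_left
  have hcontract : ∀ e ∈ R, a e ∉ L →
      (∀ A ⊆ R.erase e, κ + 1 ≤
        linkDim a (L ⊔ span F {a e}) (Γ ⊔ span F {a e}) (R.erase e) A) →
      (∀ A ⊆ R.erase e, L ≤ L₀ ⊔ sp F a (insert e A) → κ + 2 ≤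
        linkDim a (L ⊔ span F {a e}) (Γ ⊔ span F {a e}) (R.erase e) A) →
      EarLinked a L L₀ Γ κ R := by
    intro e he heL g₁ g₂
    have heL₀ : a e ∉ L₀ := fun h => heL (hL h)
    rw [← Finset.insert_erase he]
    refine earLinked_of_contract (Finset.notMem_erase e R) heL
      (ih _ (Finset.card_erase_lt_of_mem he) _ _ _ _ _ (sup_le_sup_right hL _) (by
      rw [finrank_sup_span_singleton heL, finrank_sup_span_singleton heL₀, hd]) g₁ ?_ ?_
      (hcon4 e he heL) rfl)
    · intro A hA hAe
      refine g₂ A hA (le_sup_left.trans (hAe.trans_eq ?_))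
      rw [sp_insert, sup_assoc]
    · rw [sup_assoc, ← sp_insert, Finset.insert_erase he]
      refine sup_le h₃ (((span_singleton_le_iff_mem _ _).2 (mem_sp a he)).trans le_sup_right)
  by_cases hdel : ∃ e ∈ R, L ≤ L₀ ⊔ sp F a (R.erase e)
  · obtain ⟨e, he, hear⟩ := hdel
    have heR := Finset.notMem_erase e R
    have hRe := Finset.insert_erase he
    by_cases hb₁ : ∀ A ⊆ R.erase e, κ ≤ linkDim a L Γ (R.erase e) A
    · by_cases hb₂ : ∀ A ⊆ R.erase e, L ≤ L₀ ⊔ sp F a A → κ + 1 ≤ linkDim a L Γ (R.erase e) A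
      · rw [← hRe]
        exact earLinked_of_delete hL heR (ih _ (Finset.card_erase_lt_of_mem he) _ _ _ _ _ hL hd
          hb₁ hb₂ hear (fun f hf => h₄ f (Finset.mem_of_mem_erase hf)) rfl)
      -- Deletion breaks the bound only at a cut containing an ear; that cut is tight in `R`, so the
      -- problem splits there.
      · push Not at hb₂
        obtain ⟨A₁, hA₁, hA₁e, hlt⟩ := hb₂
        have hA₁R : A₁ ⊆ R := hA₁.trans (Finset.erase_subset _ _)
        refine earLinked_of_ear hL hA₁R
          (fun A hA hAA => h₂ A hA (hA₁e.trans (sup_le_sup_left (sp_mono hAA) _))) ?_ ?_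
        · have hs : R \ A₁ = insert e (R.erase e \ A₁) := by
            ext x; by_cases hx : x = e
            · subst hx; have : x ∉ A₁ := fun h => heR (hA₁ h); simp [this, he]
            · simp [hx]
          have hle : finrank F ((L ⊔ sp F a A₁) ⊓ (Γ ⊔ sp F a (R.erase e \ A₁) ⊔ span F {a e}) :
              Submodule F V) ≤ finrank F ((L ⊔ sp F a A₁) ⊓ (Γ ⊔ sp F a (R.erase e \ A₁)) :
              Submodule F V) + 1 := by
            have i₁ := finrank_sup_add_finrank_inf_eq (L ⊔ sp F a A₁)
              (Γ ⊔ sp F a (R.erase e \ A₁) ⊔ span F {a e})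
            have i₂ := finrank_sup_add_finrank_inf_eq (L ⊔ sp F a A₁) (Γ ⊔ sp F a (R.erase e \ A₁))
            have i₃ := finrank_sup_span_singleton_le (Γ ⊔ sp F a (R.erase e \ A₁)) (a e)
            have i₄ : finrank F (L ⊔ sp F a A₁ ⊔ (Γ ⊔ sp F a (R.erase e \ A₁)) : Submodule F V) ≤
              finrank F (L ⊔ sp F a A₁ ⊔ (Γ ⊔ sp F a (R.erase e \ A₁) ⊔ span F {a e}) :
                Submodule F V) := finrank_mono (by order)
            omega
          unfold linkDim at hlt ⊢
          rw [hs, sp_insert, sup_comm (span F {a e}), ← sup_assoc]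
          omega
        · refine ih _ ?_ _ _ _ _ _ hL hd ?_ ?_ hA₁e (fun f hf => h₄ f (hA₁R hf)) rfl
          · exact (Finset.card_le_card hA₁).trans_lt (Finset.card_erase_lt_of_mem he)
          · intro A hA
            rw [linkDim_restrict a L Γ hA hA₁R]; exact h₁ A (hA.trans hA₁R)
          · intro A hA hAe
            rw [linkDim_restrict a L Γ hA hA₁R]; exact h₂ A (hA.trans hA₁R) hAe
    -- The deletion has a cut below `κ`, so uncrossing shows that contraction preserves both bounds.
    · push Not at hb₁
      obtain ⟨A₁, hA₁, hlt⟩ := hb₁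
      have hA₁R : A₁ ⊆ R := hA₁.trans (Finset.erase_subset _ _)
      have heL : a e ∉ L := by
        intro heL
        have := h₁ (insert e A₁) (Finset.insert_subset he hA₁R)
        rw [← hRe, linkDim_insert_of_mem heR heL] at this
        omega
      refine hcontract e he heL ?_ ?_
      · intro A₂ hA₂
        have i := linkDim_uncross a L Γ heR hA₁ hA₂
        rw [hRe] at i
        have i₁ := h₁ (A₁ ∩ A₂) (Finset.inter_subset_left.trans hA₁R)
        have i₂ := h₁ (insert e (A₁ ∪ A₂)) (Finset.insert_subset he
          (Finset.union_subset hA₁R (hA₂.trans (Finset.erase_subset _ _))))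
        omega
      · intro A₂ hA₂ hA₂e
        have i := linkDim_uncross a L Γ heR hA₁ hA₂
        rw [hRe] at i
        have i₁ := h₁ (A₁ ∩ A₂) (Finset.inter_subset_left.trans hA₁R)
        have i₂ := h₂ (insert e (A₁ ∪ A₂)) (Finset.insert_subset he
          (Finset.union_subset hA₁R (hA₂.trans (Finset.erase_subset _ _))))
          (hA₂e.trans (sup_le_sup_left
            (sp_mono (Finset.insert_subset_insert _ Finset.subset_union_right)) _))
        omega
  -- Now `R` is a minimal ear: its proper subsets are independent over `L`, and only the full set
  -- has to meet the stronger bound.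
  · push Not at hdel
    have hfull : ∀ A ⊆ R, L ≤ L₀ ⊔ sp F a A → A = R := by
      intro A hA hAe
      by_contra hne
      obtain ⟨z, hz, hzA⟩ := Finset.exists_of_ssubset (lt_of_le_of_ne hA hne)
      exact hdel z hz (hAe.trans (sup_le_sup_left (sp_mono (fun x hx => Finset.mem_erase.2
        ⟨by rintro rfl; exact hzA hx, hA hx⟩)) _))
    have hindep : ∀ A y, y ∉ A → insert y A ⊆ R → insert y A ≠ R → a y ∉ L ⊔ sp F a A := by
      intro A y hyA hAR hne hm
      have hyR : y ∈ R := hAR (Finset.mem_insert_self _ _)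
      have hAe : A ⊆ R.erase y := fun x hx => Finset.mem_erase.2
        ⟨fun h => hyA (h ▸ hx), hAR (Finset.mem_insert_of_mem hx)⟩
      by_cases hm' : a y ∈ L₀ ⊔ sp F a A
      · apply hdel y hyR
        have i₁ : sp F a R = span F {a y} ⊔ sp F a (R.erase y) := by
          rw [← sp_insert, Finset.insert_erase hyR]
        have i₂ := (span_singleton_le_iff_mem _ _).2 hm'
        have i₃ : sp F a A ≤ sp F a (R.erase y) := sp_mono hAe
        rw [i₁] at h₃
        order
      · apply hne
        apply hfull _ hAR
        have i₁ := finrank_sup_span_singleton hm'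
        have i₂ := (span_singleton_le_iff_mem _ _).2 hm
        have i₃ : L₀ ⊔ sp F a A ⊔ span F {a y} ≤ L ⊔ sp F a A := by order
        have i₄ : finrank F (L ⊔ sp F a A : Submodule F V) ≤
            finrank F (L₀ ⊔ sp F a A : Submodule F V) + 1 := by
          have j₁ := finrank_sup_add_finrank_inf_eq L (sp F a A)
          have j₂ := finrank_sup_add_finrank_inf_eq L₀ (sp F a A)
          have j₃ : finrank F (L₀ ⊓ sp F a A : Submodule F V) ≤
            finrank F (L ⊓ sp F a A : Submodule F V) := finrank_mono (inf_le_inf_right _ hL)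
          omega
        have i₅ := eq_of_le_of_finrank_le i₃ (by omega)
        rw [sp_insert, sup_comm (span F _), ← sup_assoc, i₅]
        exact le_sup_left
    have hcard : 3 ≤ R.card := by
      by_contra! hlt
      have hcases : R.card = 0 ∨ R.card = 1 ∨ R.card = 2 := by omega
      rcases hcases with hc | hc | hc
      · rw [Finset.card_eq_zero.1 hc, sp_empty, sup_bot_eq] at h₃
        have := finrank_mono h₃; omega
      · obtain ⟨e, rfl⟩ := Finset.card_eq_one.1 hc
        rw [sp_singleton] at h₃
        have i₁ := finrank_sup_span_singleton_le L₀ (a e)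
        have i₂ := eq_of_le_of_finrank_le h₃ (by omega)
        have i₃ := h₄ e (Finset.mem_singleton_self e) (i₂ ▸ mem_sup_span_singleton L₀ (a e))
        rw [sup_eq_left.2 ((span_singleton_le_iff_mem _ _).2 i₃)] at i₂
        rw [i₂] at hd; omega
      · obtain ⟨e, y, hne, rfl⟩ := Finset.card_eq_two.1 hc
        exact hpair e (by simp) y (by simp) hne h₃
    have hLR : κ + 1 ≤ finrank F ((L ⊔ sp F a R) ⊓ Γ : Submodule F V) := by
      have := h₂ R subset_rfl h₃
      unfold linkDim at this
      rwa [sdiff_self, Finset.bot_eq_empty, sp_empty, sup_bot_eq] at this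
    have hmemR : ∀ y ∈ R, a y ∈ L ⊔ sp F a R := fun y hy => le_sup_right (a := L) (mem_sp a hy)
    -- Any such `y` can be contracted. If none existed, `Γ` would contain all of `R`, and two
    -- elements independent over `L` would lift the dimension from `κ` at the empty cut to `κ + 2`.
    have hex : ∃ y ∈ R, a y ∉ Γ ∨ κ + 2 ≤ finrank F ((L ⊔ sp F a R) ⊓ Γ : Submodule F V) := by
      by_contra! hall
      obtain ⟨y₁, hy₁, y₂, hy₂, hne⟩ := Finset.one_lt_card.1 (show 1 < R.card by omega)
      have i₁ : a y₁ ∉ L := by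
        have := hindep ∅ y₁ (by simp) (by simpa using hy₁) (fun h => by
          rw [← h] at hcard; simp at hcard)
        rwa [sp_empty, sup_bot_eq] at this
      have i₂ : a y₂ ∉ L ⊔ span F {a y₁} := by
        have := hindep {y₁} y₂ (by simpa using hne.symm)
          (Finset.insert_subset hy₂ (by simpa using hy₁)) (fun h => by
          rw [← h] at hcard; have := Finset.card_le_two (a := y₂) (b := y₁); omega)
        rwa [sp_singleton] at this
      have hRΓ : sp F a R ≤ Γ := sp_le.2 (fun e he => (hall e he).1)
      have i₃ : κ ≤ finrank F (L ⊓ Γ : Submodule F V) := by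
        have := h₁ ∅ (Finset.empty_subset _)
        unfold linkDim at this
        rwa [sp_empty, sup_bot_eq, Finset.sdiff_empty, sup_eq_left.2 hRΓ] at this
      have i₄ := finrank_sup_span_singleton (W := L ⊓ Γ) (x := a y₁) (fun h => i₁ h.1)
      have i₅ := finrank_sup_span_singleton (W := L ⊓ Γ ⊔ span F {a y₁}) (x := a y₂)
        (fun h => i₂ (sup_le_sup_right (a := L ⊓ Γ) (b := L) inf_le_left _ h))
      have i₆ : L ⊓ Γ ⊔ span F {a y₁} ⊔ span F {a y₂} ≤ (L ⊔ sp F a R) ⊓ Γ := by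
        refine sup_le (sup_le (inf_le_inf_right _ le_sup_left) ?_) ?_
        · exact (span_singleton_le_iff_mem _ _).2 ⟨hmemR _ hy₁, (hall _ hy₁).1⟩
        · exact (span_singleton_le_iff_mem _ _).2 ⟨hmemR _ hy₂, (hall _ hy₂).1⟩
      have := finrank_mono i₆
      have := (hall y₁ hy₁).2
      omega
    obtain ⟨y, hy, hyΓ⟩ := hex
    have hRy := Finset.insert_erase hy
    have hyL : a y ∉ L := by
      have := hindep ∅ y (by simp) (by simpa using hy) (fun h => by
        rw [← h] at hcard; simp at hcard)
      rwa [sp_empty, sup_bot_eq] at this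
    have hLy : L ⊔ span F {a y} ⊔ sp F a (R.erase y) = L ⊔ sp F a R := by
      rw [sup_assoc, ← sp_insert, hRy]
    have hlast : linkDim a (L ⊔ span F {a y}) (Γ ⊔ span F {a y}) (R.erase y) (R.erase y) =
        finrank F ((L ⊔ sp F a R) ⊓ (Γ ⊔ span F {a y}) : Submodule F V) := by
      unfold linkDim
      rw [sdiff_self, Finset.bot_eq_empty, sp_empty, sup_bot_eq, hLy]
    have hmono : finrank F ((L ⊔ sp F a R) ⊓ Γ : Submodule F V) ≤
        finrank F ((L ⊔ sp F a R) ⊓ (Γ ⊔ span F {a y}) : Submodule F V) :=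
      finrank_mono (inf_le_inf_left _ le_sup_left)
    refine hcontract y hy hyL ?_ ?_
    · intro A hA
      have hyA : y ∉ A := fun h => Finset.notMem_erase y R (hA h)
      have hAR : A ⊆ R := hA.trans (Finset.erase_subset _ _)
      by_cases hAe : insert y A = R
      · have : A = R.erase y := by rw [← hAe, Finset.erase_insert hyA]
        rw [this, hlast]; omega
      · have i₁ := hindep A y hyA (Finset.insert_subset hy hAR) hAe
        refine (Nat.add_le_add_right (h₁ A hAR) 1).trans (finrank_lt_of_mem (x := a y) ?_ ?_ ?_)
        · have : R \ A = insert y (R.erase y \ A) := by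
            ext x; by_cases hx : x = y
            · subst hx; simp [hyA, hy]
            · simp [hx]
          rw [this, sp_insert]
          exact inf_le_inf (by order) (by order)
        · exact ⟨le_sup_left (b := sp F a A) (mem_sup_span_singleton L (a y)),
            le_sup_left (b := sp F a _) (mem_sup_span_singleton Γ (a y))⟩
        · exact fun h => i₁ h.1
    · intro A hA hAe
      have hyA : y ∉ A := fun h => Finset.notMem_erase y R (hA h)
      have : A = R.erase y := by
        rw [← hfull _ (Finset.insert_subset hy (hA.trans (Finset.erase_subset _ _))) hAe,
          Finset.erase_insert hyA]
      rw [this, hlast]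
      rcases hyΓ with hyΓ | hyΓ
      · refine (Nat.add_le_add_right hLR 1).trans (finrank_lt_of_mem (x := a y)
          (inf_le_inf_left _ le_sup_left) ⟨hmemR y hy, mem_sup_span_singleton _ _⟩
          (fun h => hyΓ h.2))
      · omega

end Ears
end MatroidCert

namespace MatroidCert
open Module Submodule

/-! ### Covering a subspace by spans: the circuit argument and the final state -/

section Covers
set_option linter.unusedSectionVars false

variable {F : Type*} {V : Type*} {α : Type*} [Field F] [AddCommGroup V] [Module F V]
  [DecidableEq α]

theorem mem_sp_iff {a : α → V} {A : Finset α} {v : V} :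
    v ∈ sp F a A ↔ ∃ f : α → F, ∑ x ∈ A, f x • a x = v :=
  mem_span_image_finset_iff_exists_fun' F

theorem sum_mem_sp (a : α → V) (f : α → F) (A : Finset α) : ∑ x ∈ A, f x • a x ∈ sp F a A :=
  mem_sp_iff.2 ⟨f, rfl⟩

/-- `U` is covered by the spans of at most `N` subsets of `E`, none of which contains `U`. -/
def CoveredBySpans (a : α → V) (E : Finset α) (U : Submodule F V) (N : ℕ) : Prop :=
  ∃ 𝓧 : Finset (Finset α), 𝓧.card ≤ N ∧ (∀ X ∈ 𝓧, X ⊆ E ∧ ¬ U ≤ sp F a X) ∧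
    ∀ v ∈ U, ∃ X ∈ 𝓧, v ∈ sp F a X

variable [FiniteDimensional F V]

/-- Modulo `K`, the set `C` is a circuit and dropping two of its elements leaves a hyperplane. Among
q+1 elements, two have the same ratio of coefficients in `v` and in the circuit, so subtracting that
multiple of the circuit removes both. Choosing those elements outside a set `C₀` that completes `U`
and `K` to everything ensures that no hyperplane contains `U`. -/
theorem coveredBySpans_of_circuit [Fintype F] {a : α → V} {E K C : Finset α} {U : Submodule F V}
    {c : α → F} (hK : K ⊆ E) (hC : C ⊆ E) (hc : ∀ y ∈ C, c y ≠ 0)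
    (hrel : ∑ y ∈ C, c y • a y ∈ sp F a K)
    (hd : finrank F (sp F a K ⊔ sp F a C : Submodule F V) + 1 = finrank F (sp F a K) + C.card)
    (hE : sp F a E ≤ sp F a K ⊔ sp F a C) (hU : U ≤ sp F a E)
    (hUK : finrank F (sp F a K) + Fintype.card F ≤ finrank F (U ⊔ sp F a K : Submodule F V)) :
    CoveredBySpans a E U ((Fintype.card F + 1) * (Fintype.card F + 1)) := by
  classical
  obtain ⟨C₀, hC₀, h₁, h₂, -⟩ := exists_link a C (U ⊔ sp F a K) ⊥ 0 (fun _ _ => Nat.zero_le _)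
  have hle : C₀.card + (Fintype.card F + 1) ≤ C.card := by
    have : U ⊔ sp F a K ⊔ sp F a C₀ ≤ sp F a K ⊔ sp F a C := by rw [h₂]; order
    have := finrank_mono this
    omega
  obtain ⟨C₁, hC₁, hcard⟩ := Finset.exists_subset_card_eq (s := C \ C₀) (n := Fintype.card F + 1)
    (by rw [Finset.card_sdiff_of_subset hC₀]; omega)
  have hC₁C : C₁ ⊆ C := hC₁.trans Finset.sdiff_subset
  refine ⟨C₁.offDiag.image (fun y => K ∪ (C.erase y.1).erase y.2), ?_, ?_, ?_⟩
  · refine Finset.card_image_le.trans ?_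
    rw [Finset.offDiag_card, hcard]; omega
  · intro X hX
    obtain ⟨⟨y, z⟩, hyz, rfl⟩ := Finset.mem_image.1 hX
    obtain ⟨hy, hz, hne⟩ := Finset.mem_offDiag.1 hyz
    dsimp only at hy hz hne ⊢
    refine ⟨Finset.union_subset hK (((Finset.erase_subset _ _).trans
      (Finset.erase_subset _ _)).trans hC), fun hUX => ?_⟩
    have hC₀X : C₀ ⊆ (C.erase y).erase z := fun x hx => Finset.mem_erase.2
      ⟨by rintro rfl; exact (Finset.mem_sdiff.1 (hC₁ hz)).2 hx, Finset.mem_erase.2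
        ⟨by rintro rfl; exact (Finset.mem_sdiff.1 (hC₁ hy)).2 hx, hC₀ hx⟩⟩
    rw [sp_union] at hUX
    have i₁ : sp F a C₀ ≤ sp F a ((C.erase y).erase z) := sp_mono hC₀X
    have i₂ : sp F a K ⊔ sp F a C ≤ sp F a K ⊔ sp F a ((C.erase y).erase z) := by
      have : sp F a C ≤ U ⊔ sp F a K ⊔ sp F a C₀ := h₂ ▸ le_sup_right
      order
    have i₃ := finrank_mono i₂
    have i₄ := finrank_sup_sp_le (sp F a K) a ((C.erase y).erase z)
    have i₅ := Finset.card_erase_add_one (hC₁C hy)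
    have i₆ := Finset.card_erase_add_one (Finset.mem_erase.2 ⟨hne.symm, hC₁C hz⟩)
    omega
  · intro v hv
    obtain ⟨k, hk, s, hs, rfl⟩ := mem_sup.1 (hE (hU hv))
    obtain ⟨f, rfl⟩ := mem_sp_iff.1 hs
    obtain ⟨y, hy, z, hz, hne, hyz⟩ := Finset.exists_ne_map_eq_of_card_lt_of_maps_to
      (s := C₁) (t := (Finset.univ : Finset F)) (f := fun y => f y / c y)
      (by rw [hcard, Finset.card_univ]; omega) (fun _ _ => Finset.mem_coe.2 (Finset.mem_univ _))
    refine ⟨K ∪ (C.erase y).erase z, Finset.mem_image.2 ⟨(y, z),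
      Finset.mem_offDiag.2 ⟨hy, hz, hne⟩, rfl⟩, ?_⟩
    rw [sp_union]
    set r := f y / c y with hr
    have hy0 : f y - r * c y = 0 := by rw [hr]; field_simp [hc y (hC₁C hy)]; ring
    have hz0 : f z - r * c z = 0 := by
      have : r = f z / c z := hyz
      rw [this]; field_simp [hc z (hC₁C hz)]; ring
    have hsum : ∑ x ∈ C, f x • a x = r • (∑ x ∈ C, c x • a x) +
        ∑ x ∈ (C.erase y).erase z, (f x - r * c x) • a x := by
      have e₁ := Finset.add_sum_erase C (fun x => (f x - r * c x) • a x) (hC₁C hy)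
      have e₂ := Finset.add_sum_erase (C.erase y) (fun x => (f x - r * c x) • a x)
        (Finset.mem_erase.2 ⟨hne.symm, hC₁C hz⟩)
      rw [hy0, zero_smul, zero_add] at e₁
      rw [hz0, zero_smul, zero_add] at e₂
      rw [e₂, e₁, Finset.smul_sum, ← Finset.sum_add_distrib]
      refine Finset.sum_congr rfl fun x _ => ?_
      rw [smul_smul, ← add_smul]; congr 1; ring
    rw [hsum, ← add_assoc]
    exact mem_sup.2 ⟨_, add_mem hk (smul_mem _ r hrel), _, sum_mem_sp _ _ _, rfl⟩

theorem finrank_inf_sup_of_le {S T K : Submodule F V} (h : K ≤ S) :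
    finrank F (S ⊓ (T ⊔ K) : Submodule F V) + finrank F (T ⊓ K : Submodule F V) =
      finrank F (S ⊓ T : Submodule F V) + finrank F K := by
  have e₁ := finrank_sup_add_finrank_inf_eq (S ⊓ T) K
  rw [inf_sup_assoc_of_le _ h, inf_assoc, inf_eq_right.2 (inf_le_right.trans h : T ⊓ K ≤ S)] at e₁
  exact e₁

theorem inf_eq_bot_and_finrank_of_card {W : Submodule F V} {a : α → V} {K : Finset α}
    (h : finrank F W + K.card ≤ finrank F (W ⊔ sp F a K : Submodule F V)) :
    W ⊓ sp F a K = ⊥ ∧ finrank F (sp F a K) = K.card := by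
  have h₁ := finrank_sp_le a K (F := F)
  have h₂ := inf_eq_bot_of_finrank h₁ h
  have h₃ := finrank_sup_add_finrank_inf_eq W (sp F a K)
  rw [h₂, finrank_bot] at h₃
  exact ⟨h₂, by omega⟩

/-- The dimension of the intersection of the span of `E \ Y` with the span of `Y` and `U`. -/
noncomputable def cutDim (a : α → V) (E : Finset α) (U : Submodule F V) (Y : Finset α) : ℕ :=
  finrank F (sp F a (E \ Y) ⊓ (sp F a Y ⊔ U) : Submodule F V)

theorem sp_sdiff_sdiff (a : α → V) {E Y A : Finset α} (hY : Y ⊆ E) (hA : A ⊆ Y) :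
    sp F a (E \ (Y \ A)) = sp F a (E \ Y) ⊔ sp F a A := by
  rw [← sp_union]; congr 1; ext x
  have := @hY x; have := @hA x
  simp only [Finset.mem_sdiff, Finset.mem_union]; tauto

theorem exists_cutDim_min (a : α → V) (E : Finset α) (U : Submodule F V) (R : Finset α) :
    ∃ Y ⊆ R, (∀ Y' ⊆ R, cutDim a E U Y ≤ cutDim a E U Y') ∧
      ∀ Y' ⊂ Y, cutDim a E U Y + 1 ≤ cutDim a E U Y' := by
  -- Lexicographic minimisation breaks ties by size, so that every proper subset has a strictly
  -- larger cut.
  obtain ⟨Y, hY, hmin⟩ := Finset.exists_min_image R.powerset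
    (fun Y => toLex (cutDim a E U Y, Y.card)) ⟨∅, by simp⟩
  rw [Finset.mem_powerset] at hY
  refine ⟨Y, hY, fun Y' hY' => ?_, fun Y' hY' => ?_⟩
  · have := hmin Y' (Finset.mem_powerset.2 hY')
    rw [Prod.Lex.toLex_le_toLex] at this
    dsimp only at this; omega
  · have := hmin Y' (Finset.mem_powerset.2 (hY'.1.trans hY))
    rw [Prod.Lex.toLex_le_toLex] at this
    have := Finset.card_lt_card hY'
    dsimp only at *; omega

/-- A lower bound for the link from the complement of `Y` to the guts of the cut at `Y'`. -/
theorem cutDim_add_le (a : α → V) {E Y Y' A : Finset α} {U K : Submodule F V} (hY : Y ⊆ E)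
    (hY' : Y' ⊆ Y) (hA : A ⊆ Y \ Y') (hU : U ≤ sp F a Y') (hK : K ≤ sp F a (E \ Y)) :
    cutDim a E U (Y \ A) + finrank F K ≤ finrank F ((sp F a (E \ Y) ⊔ sp F a A) ⊓
      (sp F a (E \ Y') ⊓ sp F a Y' ⊔ K ⊔ sp F a ((Y \ Y') \ A)) : Submodule F V) +
      finrank F (sp F a (E \ Y) ⊓ sp F a Y ⊓ K : Submodule F V) := by
  have hAY : A ⊆ Y := hA.trans Finset.sdiff_subset
  have hB : sp F a ((Y \ Y') \ A) ≤ sp F a (E \ Y') := sp_mono fun x => by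
    have := @hY x; simp only [Finset.mem_sdiff]; tauto
  have hT : sp F a (E \ Y') ⊓ sp F a Y' ⊔ sp F a ((Y \ Y') \ A) =
      sp F a (E \ Y') ⊓ sp F a (Y \ A) := by
    rw [inf_sup_assoc_of_le _ hB, ← sp_union]
    congr 2; ext x
    have := @hY' x; have := @hA x
    simp only [Finset.mem_sdiff, Finset.mem_union] at *; tauto
  have hS : sp F a (E \ Y) ⊔ sp F a A ≤ sp F a (E \ Y') := by
    rw [← sp_union]; apply sp_mono; intro x
    have := @hY' x; have := @hA x; have := @hY x
    simp only [Finset.mem_sdiff, Finset.mem_union] at *; tauto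
  have hUA : U ≤ sp F a (Y \ A) := hU.trans (sp_mono fun x hx => Finset.mem_sdiff.2
    ⟨hY' hx, fun h => (Finset.mem_sdiff.1 (hA h)).2 hx⟩)
  have e := finrank_inf_sup_of_le (S := sp F a (E \ Y) ⊔ sp F a A)
    (T := sp F a (E \ Y') ⊓ sp F a (Y \ A)) (K := K) (hK.trans le_sup_left)
  have e₁ : (sp F a (E \ Y) ⊔ sp F a A) ⊓ (sp F a (E \ Y') ⊓ sp F a (Y \ A)) =
      sp F a (E \ (Y \ A)) ⊓ (sp F a (Y \ A) ⊔ U) := by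
    rw [sup_eq_left.2 hUA, ← inf_assoc, inf_eq_left.2 hS, sp_sdiff_sdiff a hY hAY]
  have e₂ : sp F a (E \ Y') ⊓ sp F a Y' ⊔ K ⊔ sp F a ((Y \ Y') \ A) =
      sp F a (E \ Y') ⊓ sp F a (Y \ A) ⊔ K := by
    rw [← hT]; order
  have e₃ : finrank F (sp F a (E \ Y') ⊓ sp F a (Y \ A) ⊓ K : Submodule F V) ≤
      finrank F (sp F a (E \ Y) ⊓ sp F a Y ⊓ K : Submodule F V) :=
    finrank_mono (le_inf (le_inf (inf_le_right.trans hK)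
      ((inf_le_left.trans inf_le_right).trans (sp_mono Finset.sdiff_subset))) inf_le_right)
  rw [e₁] at e
  rw [e₂]
  unfold cutDim
  omega

/-- A cut of `E`, one of whose sides spans `U`, together with a set `K` of the other side linked
to the guts of the cut, such that modulo `K` the other side has many spanning circuits. -/
structure CoverState (a : α → V) (E : Finset α) (U : Submodule F V) (q l : ℕ)
    (Y K : Finset α) (L₀ : Submodule F V) : Prop where
  subset : Y ⊆ E
  le_sp : U ≤ sp F a Y
  strict : ∀ Y' ⊂ Y, cutDim a E U Y + 1 ≤ cutDim a E U Y'
  subset_sdiff : K ⊆ E \ Y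
  finrank_side : finrank F (sp F a (E \ Y)) = K.card + l
  finrank_sp : finrank F (sp F a K) = K.card
  linked : sp F a (E \ Y) ≤ sp F a (E \ Y) ⊓ sp F a Y ⊔ sp F a K
  sp_le : sp F a K ≤ L₀
  le_side : L₀ ≤ sp F a (E \ Y)
  finrank_side_eq : finrank F (sp F a (E \ Y)) = finrank F L₀ + 1
  exists_circuit : ∀ w ∈ sp F a (E \ Y), w ∉ L₀ → ∃ Z ⊆ E \ Y, Z.card = l ∧
    sp F a (E \ Y) ≤ sp F a K ⊔ sp F a Z ∧ ∃ c : α → F, (∀ z ∈ Z, c z ≠ 0) ∧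
      w - ∑ z ∈ Z, c z • a z ∈ sp F a K
  -- The bound 1 + (l - 1)(q - 1), free of the truncated `l - 1`.
  cutDim_le : cutDim a E U Y + (q - 1) ≤ 1 + l * (q - 1)

namespace CoverState

variable {a : α → V} {E Y K : Finset α} {U L₀ : Submodule F V} {q l : ℕ}

theorem cutDim_eq (h : CoverState a E U q l Y K L₀) :
    cutDim a E U Y = finrank F (sp F a (E \ Y) ⊓ sp F a Y : Submodule F V) := by
  rw [cutDim, sup_eq_left.2 h.le_sp]

/-- Guts and `K` together span the side, which has rank `K.card + l`; so `K` absorbs all but `l`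
dimensions of the guts. -/
theorem finrank_guts_inf (h : CoverState a E U q l Y K L₀) :
    finrank F (sp F a (E \ Y) ⊓ sp F a Y ⊓ sp F a K : Submodule F V) + l = cutDim a E U Y := by
  have e₁ := finrank_sup_add_finrank_inf_eq (sp F a (E \ Y) ⊓ sp F a Y) (sp F a K)
  have e₂ : sp F a (E \ Y) ⊓ sp F a Y ⊔ sp F a K = sp F a (E \ Y) :=
    le_antisymm (sup_le inf_le_left (sp_mono h.subset_sdiff)) h.linked
  have := h.finrank_side
  have := h.finrank_sp
  rw [e₂] at e₁
  rw [h.cutDim_eq]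
  omega

theorem le_cutDim (h : CoverState a E U q l Y K L₀) {Y' : Finset α} (hY' : Y' ⊆ Y) :
    cutDim a E U Y ≤ cutDim a E U Y' := by
  rcases hY'.eq_or_ssubset with rfl | h'
  · exact le_rfl
  · exact (Nat.le_succ _).trans (h.strict _ h')

theorem notMem_side (h : CoverState a E U q l Y K L₀) {y : α} (hy : y ∈ Y) :
    a y ∉ sp F a (E \ Y) := by
  intro hm
  have h₁ := h.strict _ (Finset.erase_ssubset hy)
  have h₂ : sp F a (E \ Y.erase y) = sp F a (E \ Y) := by
    rw [← Finset.sdiff_singleton_eq_erase, sp_sdiff_sdiff a h.subset (by simpa using hy),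
      sp_singleton, sup_eq_left.2 ((span_singleton_le_iff_mem _ _).2 hm)]
  have h₃ : cutDim a E U (Y.erase y) ≤ cutDim a E U Y := by
    unfold cutDim
    rw [h₂]
    exact finrank_mono (inf_le_inf_left _ (sup_le_sup_right (sp_mono (Finset.erase_subset _ _)) _))
  omega

/-- With `l = q`, an element `z₀` outside `L₀` and its set `Z` form a circuit modulo `K` that spans
the side. Linking across `Y` extends `K` to `K ∪ K'`, over which the circuit spans everything and
`U` has rank at least q. -/
theorem covered [Fintype F] (h : CoverState a E U (Fintype.card F) (Fintype.card F) Y K L₀) :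
    CoveredBySpans a E U ((Fintype.card F + 1) * (Fintype.card F + 1)) := by
  have hq : 2 ≤ Fintype.card F := Fintype.one_lt_card
  have hKX : sp F a K ≤ sp F a (E \ Y) := sp_mono h.subset_sdiff
  obtain ⟨z₀, hz₀, hz₀L⟩ : ∃ z ∈ E \ Y, a z ∉ L₀ := by
    by_contra! hall
    have := finrank_mono (MatroidCert.sp_le.2 hall)
    have := h.finrank_side_eq
    omega
  obtain ⟨Z, hZ, hZcard, hZsp, c, hc, hrel⟩ := h.exists_circuit _ (mem_sp a hz₀) hz₀L
  have hside := h.finrank_side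
  have hKd := h.finrank_sp
  -- Otherwise some other element of `Z` would depend on the rest modulo `K`, contradicting the rank
  -- of the side.
  have hz₀Z : z₀ ∉ Z := by
    intro hm
    obtain ⟨z, hz, hne⟩ := Finset.exists_mem_ne (by omega : 1 < Z.card) z₀
    have e₁ := Finset.add_sum_erase Z (fun x => c x • a x) hz
    have e₂ : a z ∈ sp F a K ⊔ sp F a (Z.erase z) := by
      rw [← (sp F a K ⊔ sp F a (Z.erase z)).smul_mem_iff (hc z hz)]
      have e₃ : c z • a z = -(a z₀ - ∑ x ∈ Z, c x • a x) + (a z₀ - ∑ x ∈ Z.erase z, c x • a x) := by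
        rw [← e₁]; abel
      rw [e₃]
      exact mem_sup.2 ⟨_, neg_mem hrel, _,
        sub_mem (mem_sp a (Finset.mem_erase.2 ⟨hne.symm, hm⟩)) (sum_mem_sp _ _ _), rfl⟩
    have e₄ : sp F a K ⊔ sp F a Z ≤ sp F a K ⊔ sp F a (Z.erase z) := by
      rw [← Finset.insert_erase hz, sp_insert]
      have := (span_singleton_le_iff_mem _ _).2 e₂
      rw [Finset.erase_insert (Finset.notMem_erase _ _)]
      order
    have i₁ := finrank_mono (hZsp.trans e₄)
    have i₂ := finrank_sup_sp_le (sp F a K) a (Z.erase z)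
    have i₃ := Finset.card_erase_add_one hz
    omega
  obtain ⟨K', hK', g₁, g₂, g₃⟩ := exists_link a Y (sp F a (E \ Y)) (U ⊔ sp F a K)
    (K.card + Fintype.card F) (by
      intro A hA
      have e := finrank_inf_sup_of_le (S := sp F a (E \ Y) ⊔ sp F a A) (T := sp F a (Y \ A) ⊔ U)
        (K := sp F a K) (hKX.trans le_sup_left)
      have i₁ := h.le_cutDim (Y' := Y \ A) Finset.sdiff_subset
      have i₂ := h.finrank_guts_inf
      have i₃ : finrank F ((sp F a (Y \ A) ⊔ U) ⊓ sp F a K : Submodule F V) ≤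
          finrank F (sp F a (E \ Y) ⊓ sp F a Y ⊓ sp F a K : Submodule F V) :=
        finrank_mono (le_inf (le_inf (inf_le_right.trans hKX)
          (inf_le_left.trans (sup_le (sp_mono Finset.sdiff_subset) h.le_sp))) inf_le_right)
      rw [← sp_sdiff_sdiff a h.subset hA] at e
      unfold linkDim
      rw [← sp_sdiff_sdiff a h.subset hA, show U ⊔ sp F a K ⊔ sp F a (Y \ A) =
        sp F a (Y \ A) ⊔ U ⊔ sp F a K by order]
      rw [cutDim] at i₁ i₂
      rw [cutDim] at i₁
      omega)
  have hE : sp F a (E \ Y) ⊔ sp F a Y = sp F a E := by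
    rw [← sp_union, Finset.sdiff_union_of_subset h.subset]
  obtain ⟨hbot, hK'd⟩ := inf_eq_bot_and_finrank_of_card g₁.ge
  have hKK' : finrank F (sp F a (K ∪ K')) = K.card + K'.card := by
    have e := finrank_sup_add_finrank_inf_eq (sp F a K) (sp F a K')
    have : sp F a K ⊓ sp F a K' = ⊥ := by
      rw [eq_bot_iff, ← hbot]; exact inf_le_inf_right _ hKX
    rw [this, finrank_bot] at e
    rw [sp_union]; omega
  have hspan : sp F a (K ∪ K') ⊔ sp F a (insert z₀ Z) = sp F a E := by
    apply le_antisymm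
    · rw [← sp_union]
      apply sp_mono
      refine Finset.union_subset (Finset.union_subset (h.subset_sdiff.trans Finset.sdiff_subset)
        (hK'.trans h.subset)) ((Finset.insert_subset hz₀ hZ).trans Finset.sdiff_subset)
    · rw [← hE, ← g₂, sp_union, sp_insert]; order
  have hEd : finrank F (sp F a E) = K.card + Fintype.card F + K'.card := by
    rw [← hE, ← g₂, g₁, hside]
  refine coveredBySpans_of_circuit (K := K ∪ K') (C := insert z₀ Z)
    (c := fun x => if x = z₀ then -1 else c x)
    (Finset.union_subset (h.subset_sdiff.trans Finset.sdiff_subset) (hK'.trans h.subset))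
    ((Finset.insert_subset hz₀ hZ).trans Finset.sdiff_subset) ?_ ?_ ?_ hspan.ge
    (h.le_sp.trans (sp_mono h.subset)) ?_
  · intro y hy
    by_cases hyz : y = z₀
    · simp [hyz]
    · simp only [hyz, if_false]; exact hc y (Finset.mem_of_mem_insert_of_ne hy hyz)
  · rw [Finset.sum_insert hz₀Z]
    have : ∑ x ∈ Z, (if x = z₀ then -1 else c x) • a x = ∑ x ∈ Z, c x • a x :=
      Finset.sum_congr rfl fun x hx => by rw [if_neg]; rintro rfl; exact hz₀Z hx
    rw [this, if_pos rfl, neg_one_smul, ← neg_mem_iff, neg_add, neg_neg, ← sub_eq_add_neg]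
    exact sp_mono Finset.subset_union_left hrel
  · rw [hspan, hEd, hKK', Finset.card_insert_of_notMem hz₀Z, hZcard]; omega
  · have : (sp F a (E \ Y) ⊔ sp F a Y) ⊓ (U ⊔ sp F a K ⊔ sp F a K') ≤ U ⊔ sp F a (K ∪ K') := by
      rw [sp_union, ← sup_assoc]; exact inf_le_right
    have := finrank_mono this
    omega

end CoverState

end Covers
end MatroidCert

namespace MatroidCert
open Module Submodule

/-! ### Growing the circuit and the covering theorem -/

section Cover
set_option linter.unusedSectionVars false

variable {F : Type*} {V : Type*} {α : Type*} [Field F] [AddCommGroup V] [Module F V]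
  [DecidableEq α] [FiniteDimensional F V]

/-- A minimal set in `Y` supporting a vector of `X` outside `L₀`. -/
theorem exists_minimal_support (a : α → V) {Y : Finset α} {X L₀ : Submodule F V}
    (h : ¬ X ⊓ sp F a Y ≤ L₀) :
    ∃ C ⊆ Y, ∃ c : α → F, (∀ y ∈ C, c y ≠ 0) ∧ ∑ y ∈ C, c y • a y ∈ X ∧
      ∑ y ∈ C, c y • a y ∉ L₀ ∧
      finrank F (X ⊔ sp F a C : Submodule F V) + 1 = finrank F X + C.card := by
  classical
  have hne : (Y.powerset.filter fun C => ¬ X ⊓ sp F a C ≤ L₀).Nonempty := ⟨Y, by simp [h]⟩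
  obtain ⟨C, hC, hmin⟩ := Finset.exists_min_image _ Finset.card hne
  rw [Finset.mem_filter, Finset.mem_powerset] at hC
  obtain ⟨hCY, hCL⟩ := hC
  have hless : ∀ D ⊂ C, X ⊓ sp F a D ≤ L₀ := by
    intro D hD
    by_contra hDL
    have := hmin D (Finset.mem_filter.2 ⟨Finset.mem_powerset.2 (hD.1.trans hCY), hDL⟩)
    exact absurd (Finset.card_lt_card hD) (by omega)
  obtain ⟨w, ⟨hwX, hw⟩, hwL⟩ := SetLike.not_le_iff_exists.1 hCL
  obtain ⟨c, rfl⟩ := mem_sp_iff.1 hw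
  have hc : ∀ y ∈ C, c y ≠ 0 := by
    intro y hy h0
    have e := Finset.add_sum_erase C (fun x => c x • a x) hy
    rw [h0, zero_smul, zero_add] at e
    rw [← e] at hwX hwL
    exact hwL (hless _ (Finset.erase_ssubset hy) ⟨hwX, sum_mem_sp _ _ _⟩)
  refine ⟨C, hCY, c, hc, hwX, hwL, ?_⟩
  obtain ⟨C₀, hC₀, h₁, h₂, -⟩ := exists_link a C X ⊥ 0 (fun _ _ => Nat.zero_le _)
  have hCne : C.Nonempty := by
    rw [Finset.nonempty_iff_ne_empty]; rintro rfl; exact hwL (by simp)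
  have hlt : C₀.card < C.card := by
    obtain ⟨y, hy⟩ := hCne
    have e := Finset.add_sum_erase C (fun x => c x • a x) hy
    have hm : a y ∈ X ⊔ sp F a (C.erase y) := by
      rw [← (X ⊔ sp F a (C.erase y)).smul_mem_iff (hc y hy)]
      have : c y • a y = ∑ x ∈ C, c x • a x + -∑ x ∈ C.erase y, c x • a x := by rw [← e]; abel
      rw [this]
      exact mem_sup.2 ⟨_, hwX, _, neg_mem (sum_mem_sp _ _ _), rfl⟩
    have hle : X ⊔ sp F a C ≤ X ⊔ sp F a (C.erase y) := by
      have := (span_singleton_le_iff_mem _ _).2 hm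
      rw [← Finset.insert_erase hy, sp_insert, Finset.erase_insert (Finset.notMem_erase _ _)]
      order
    have i₁ := finrank_mono hle
    have i₂ := finrank_sup_sp_le X a (C.erase y)
    have i₃ := Finset.card_erase_add_one hy
    rw [← h₂] at i₁
    omega
  by_contra hcard
  rw [← h₂] at hcard
  -- With two redundant elements, `z` has a dependency avoiding `z'`, lying in `L₀` by minimality;
  -- eliminating `z` with it would put the whole vector in `L₀`.
  obtain ⟨z, hz, z', hz', hne⟩ := Finset.one_lt_card.1
    (show 1 < (C \ C₀).card by rw [Finset.card_sdiff_of_subset hC₀]; omega)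
  rw [Finset.mem_sdiff] at hz hz'
  have hzm : a z ∈ X ⊔ sp F a C₀ := by
    rw [h₂]; exact le_sup_right (a := X) (mem_sp a hz.1)
  obtain ⟨x, hx, s, hs, hxs⟩ := mem_sup.1 hzm
  have hxC : x ∈ L₀ := by
    refine hless (insert z C₀) ⟨Finset.insert_subset hz.1 hC₀, fun hle => ?_⟩ ⟨hx, ?_⟩
    · rcases Finset.mem_insert.1 (hle hz'.1) with rfl | h'
      exacts [hne rfl, hz'.2 h']
    · have : x = a z - s := by rw [← hxs]; abel
      rw [this]
      exact sub_mem (mem_sp a (Finset.mem_insert_self _ _))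
        (sp_mono (Finset.subset_insert _ _) hs)
  have hw' : ∑ y ∈ C, c y • a y - c z • x ∈ L₀ := by
    refine hless (C.erase z) (Finset.erase_ssubset hz.1)
      ⟨sub_mem hwX (smul_mem _ _ hx), ?_⟩
    have e := Finset.add_sum_erase C (fun x => c x • a x) hz.1
    have : ∑ y ∈ C, c y • a y - c z • x = ∑ y ∈ C.erase z, c y • a y + c z • s := by
      rw [← e, ← hxs, smul_add]; abel
    rw [this]
    refine add_mem (sum_mem_sp _ _ _) (smul_mem _ _ (sp_mono (fun y hy => ?_) hs))
    exact Finset.mem_erase.2 ⟨by rintro rfl; exact hz.2 hy, hC₀ hy⟩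
  exact hwL ((L₀.sub_mem_iff_left (smul_mem _ _ hxC)).1 hw')

namespace CoverState

variable {a : α → V} {E Y K : Finset α} {U L₀ : Submodule F V} {q l : ℕ}

/-- The guts contain a vector outside `L₀`, with a minimal support `C` in `Y`. Compare with the
minimum cut `Y'` avoiding `C`. If it is larger by at least q, then `C` is a circuit over the old
side from which `U` is well enough linked to give a cover. Otherwise `C` is an ear between the two
cuts, and `earLinked` lengthens the circuits by one. -/
theorem step [Fintype F] (h : CoverState a E U (Fintype.card F) l Y K L₀)
    (hl : l + 1 ≤ Fintype.card F) (hUd : Fintype.card F ^ 2 < finrank F U)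
    (hNS : ∀ Y ⊆ E, finrank F (sp F a (E \ Y) ⊓ sp F a Y : Submodule F V) ≤ Fintype.card F ^ 2 →
      U ≤ sp F a (E \ Y) ∨ U ≤ sp F a Y) :
    CoveredBySpans a E U ((Fintype.card F + 1) * (Fintype.card F + 1)) ∨
      ∃ Y K L₀, CoverState a E U (Fintype.card F) (l + 1) Y K L₀ := by
  have hside := h.finrank_side
  have hKd := h.finrank_sp
  have hKX : sp F a K ≤ sp F a (E \ Y) := sp_mono h.subset_sdiff
  have hguts : ¬ sp F a (E \ Y) ⊓ sp F a Y ≤ L₀ := by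
    intro hle
    have := finrank_mono (h.linked.trans (sup_le hle h.sp_le))
    have := h.finrank_side_eq
    omega
  obtain ⟨C, hC, c, hc, hwX, hwL, hCd⟩ := exists_minimal_support a hguts
  obtain ⟨Y', hY', hmin, hstrict⟩ := exists_cutDim_min a E U (Y \ C)
  have hYE := h.subset
  have hCE : C ⊆ E := hC.trans hYE
  have hY'Y : Y' ⊆ Y := hY'.trans Finset.sdiff_subset
  have hEsplit : sp F a (E \ Y) ⊔ sp F a C ⊔ sp F a (Y \ C) = sp F a E := by
    rw [sup_assoc, ← sp_union, ← sp_union, Finset.union_sdiff_of_subset hC,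
      Finset.sdiff_union_of_subset hYE]
  by_cases hbig : cutDim a E U Y + Fintype.card F ≤ cutDim a E U Y'
  · left
    obtain ⟨K', hK', g₁, g₂, g₃⟩ := exists_link a (Y \ C) (sp F a (E \ Y) ⊔ sp F a C) U
      (cutDim a E U Y + Fintype.card F) (by
        intro A hA
        refine (hbig.trans (hmin _ (Finset.sdiff_subset (t := A)))).trans_eq ?_
        have : (Y \ C) \ A = Y \ (C ∪ A) := by rw [← Finset.sup_eq_union, sdiff_sdiff_left]
        unfold linkDim cutDim
        rw [this, sp_sdiff_sdiff a hYE (Finset.union_subset hC (hA.trans Finset.sdiff_subset)),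
          sp_union, ← sup_assoc, sup_comm U])
    rw [hEsplit] at g₂ g₃
    have hK'Y : K' ⊆ Y := hK'.trans Finset.sdiff_subset
    obtain ⟨hbot, hK'd⟩ := inf_eq_bot_and_finrank_of_card g₁.ge
    have hXK' : finrank F (sp F a (E \ Y) ⊔ sp F a K' : Submodule F V) =
        finrank F (sp F a (E \ Y)) + K'.card := by
      have e := finrank_sup_add_finrank_inf_eq (sp F a (E \ Y)) (sp F a K')
      have : sp F a (E \ Y) ⊓ sp F a K' = ⊥ := by
        rw [eq_bot_iff, ← hbot]; exact inf_le_inf_right _ le_sup_left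
      rw [this, finrank_bot] at e
      omega
    have hspan : sp F a (E \ Y ∪ K') ⊔ sp F a C = sp F a E := by
      rw [← g₂, sp_union]; order
    refine coveredBySpans_of_circuit (K := E \ Y ∪ K') (C := C) (c := c)
      (Finset.union_subset Finset.sdiff_subset (hK'Y.trans hYE)) hCE hc
      (sp_mono Finset.subset_union_left hwX) ?_ hspan.ge (h.le_sp.trans (sp_mono hYE)) ?_
    · rw [hspan, ← g₂, g₁, sp_union, hXK']; omega
    · have e := finrank_sup_add_finrank_inf_eq (sp F a (E \ Y)) (U ⊔ sp F a K')
      have i₁ : finrank F (sp F a (E \ Y) ⊓ (U ⊔ sp F a K') : Submodule F V) ≤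
          finrank F (sp F a (E \ Y) ⊓ sp F a Y : Submodule F V) :=
        finrank_mono (inf_le_inf_left _ (sup_le h.le_sp (sp_mono hK'Y)))
      have i₂ : finrank F (sp F a E ⊓ (U ⊔ sp F a K') : Submodule F V) ≤
        finrank F (U ⊔ sp F a K' : Submodule F V) := finrank_mono inf_le_right
      have e₂ : U ⊔ sp F a (E \ Y ∪ K') = sp F a (E \ Y) ⊔ (U ⊔ sp F a K') := by
        rw [sp_union]; order
      rw [e₂, sp_union, hXK']
      rw [← h.cutDim_eq] at i₁
      omega
  · right
    have hq : 2 ≤ Fintype.card F := Fintype.one_lt_card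
    have hcut := h.cutDim_le
    have hcut' : cutDim a E U Y' + (Fintype.card F - 1) ≤ 1 + (l + 1) * (Fintype.card F - 1) := by
      rw [Nat.add_mul]; omega
    have hT : cutDim a E U Y' ≤ Fintype.card F ^ 2 := by
      obtain ⟨r, hr⟩ : ∃ r, Fintype.card F = r + 1 := ⟨Fintype.card F - 1, by omega⟩
      rw [hr] at hcut' hl ⊢
      rw [Nat.add_sub_cancel] at hcut'
      nlinarith
    have hUY' : U ≤ sp F a Y' := by
      refine (hNS Y' (hY'Y.trans hYE) ((finrank_mono ?_).trans hT)).resolve_left fun hU => ?_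
      · exact inf_le_inf_left _ le_sup_left
      · have : finrank F U ≤ cutDim a E U Y' := finrank_mono (le_inf hU le_sup_right)
        omega
    have hspR : sp F a (E \ Y) ⊔ sp F a (Y \ Y') = sp F a (E \ Y') := by
      rw [← sp_union]; congr 1; ext x
      have := @hY'Y x; have := @hYE x
      simp only [Finset.mem_union, Finset.mem_sdiff]; tauto
    -- Nonempty `A` gains at least one by strict minimality of `Y`; this is the extra unit that
    -- `earLinked` requires of ears.
    have hlow : ∀ A ⊆ Y \ Y', K.card + l + (cutDim a E U (Y \ A) - cutDim a E U Y) ≤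
        linkDim a (sp F a (E \ Y)) (sp F a (E \ Y') ⊓ sp F a Y' ⊔ sp F a K) (Y \ Y') A := by
      intro A hA
      have i₁ := cutDim_add_le a hYE hY'Y hA hUY' hKX
      have i₂ := h.finrank_guts_inf
      have i₃ := h.le_cutDim (Y' := Y \ A) Finset.sdiff_subset
      unfold linkDim
      omega
    obtain ⟨K', hK', p, hp, b, hb, g₁, g₂, g₃, g₄, g₅⟩ := earLinked a (Y \ Y')
      (sp F a (E \ Y)) L₀ (sp F a (E \ Y') ⊓ sp F a Y' ⊔ sp F a K) (K.card + l) h.le_side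
      h.finrank_side_eq (fun A hA => (Nat.le_add_right _ _).trans (hlow A hA)) (by
        intro A hA hAe
        have hA0 : A.Nonempty := by
          rw [Finset.nonempty_iff_ne_empty]; rintro rfl
          rw [sp_empty, sup_bot_eq] at hAe
          have := finrank_mono hAe
          have := h.finrank_side_eq
          omega
        have i₁ := hlow A hA
        have i₂ := h.strict (Y \ A) (Finset.sdiff_ssubset (hA.trans Finset.sdiff_subset) hA0)
        omega) (by
        rw [← sup_span_singleton_eq_of_finrank h.le_side h.finrank_side_eq hwX hwL]
        refine sup_le_sup_left ((span_singleton_le_iff_mem _ _).2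
          (sp_mono (fun x hx => ?_) (sum_mem_sp a c C))) _
        exact Finset.mem_sdiff.2 ⟨hC hx, fun h' => (Finset.mem_sdiff.1 (hY' h')).2 hx⟩)
      (fun e he heX => absurd heX (h.notMem_side (Finset.mem_sdiff.1 he).1))
    rw [hspR] at g₂ g₃
    rw [g₂] at g₁
    have hY'E := hY'Y.trans hYE
    have hXX' : E \ Y ⊆ E \ Y' := Finset.sdiff_subset_sdiff subset_rfl hY'Y
    have hRX' : Y \ Y' ⊆ E \ Y' := Finset.sdiff_subset_sdiff hYE subset_rfl
    have hpX : a p ∈ sp F a (E \ Y') := mem_sp a (hRX' hp)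
    have hbX : a b ∈ sp F a (E \ Y') := mem_sp a (hRX' hb)
    have hLK' : finrank F (sp F a (E \ Y)) + K'.card ≤
        finrank F (sp F a (E \ Y) ⊔ sp F a K' : Submodule F V) := by
      have := finrank_sup_span_singleton_le (sp F a (E \ Y) ⊔ sp F a K') (a p)
      rw [sup_assoc, sup_comm (sp F a K'), ← sp_insert, g₂, g₁] at this
      omega
    obtain ⟨hbot, hK'd⟩ := inf_eq_bot_and_finrank_of_card hLK'
    have hLK'd : finrank F (sp F a (E \ Y) ⊔ sp F a K' : Submodule F V) =
        finrank F (sp F a (E \ Y)) + K'.card :=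
      le_antisymm (finrank_sup_sp_le _ _ _) hLK'
    have hKK'card : (K ∪ K').card = K.card + K'.card := by
      refine Finset.card_union_of_disjoint (Finset.disjoint_left.2 fun x hx hx' => ?_)
      exact (Finset.mem_sdiff.1 (h.subset_sdiff hx)).2 (Finset.mem_sdiff.1 (hK' hx')).1
    have hside' : sp F a (E \ Y) ⊔ sp F a K' ⊔ span F {a p} = sp F a (E \ Y') := by
      rw [← g₂, sp_insert]; order
    have hpK' : ∀ w ∈ sp F a (E \ Y'), ∃ x ∈ sp F a (E \ Y), ∃ k ∈ sp F a K', ∃ r : F,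
        x + k + r • a p = w := by
      intro w hw
      rw [← hside'] at hw
      obtain ⟨s, hs, t, ht, rfl⟩ := mem_sup.1 hw
      obtain ⟨x, hx, k, hk, rfl⟩ := mem_sup.1 hs
      obtain ⟨r, rfl⟩ := mem_span_singleton.1 ht
      exact ⟨x, hx, k, hk, r, rfl⟩
    obtain ⟨xb, hxb, kb, hkb, rb, hbe⟩ := hpK' _ hbX
    have hrb : rb ≠ 0 := by
      rintro rfl
      exact g₄ (mem_sup.2 ⟨xb, hxb, kb, hkb, by rw [← hbe, zero_smul, add_zero]⟩)
    have hxbL : xb ∉ L₀ := by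
      intro hm
      apply g₅
      rw [← hbe, sp_insert, add_assoc]
      exact mem_sup.2 ⟨xb, hm, _, mem_sup.2 ⟨_, smul_mem _ rb (mem_span_singleton_self _), kb,
        hkb, add_comm _ _⟩, rfl⟩
    have hKsup : sp F a (K ∪ K') = sp F a K ⊔ sp F a K' := sp_union _ _ _
    refine ⟨Y', K ∪ K', sp F a (E \ Y) ⊔ sp F a K', hY'E, hUY', hstrict, ?_, ?_, ?_, ?_, ?_, ?_,
      ?_, ?_, hcut'⟩
    · exact Finset.union_subset (h.subset_sdiff.trans hXX') (hK'.trans hRX')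
    · rw [g₁, hKK'card]; omega
    · have e := finrank_sup_add_finrank_inf_eq (sp F a K) (sp F a K')
      have : sp F a K ⊓ sp F a K' = ⊥ := by
        rw [eq_bot_iff, ← hbot]; exact inf_le_inf_right _ hKX
      rw [this, finrank_bot] at e
      rw [hKsup, hKK'card]; omega
    · have e : sp F a (E \ Y') ⊓ (sp F a (E \ Y') ⊓ sp F a Y' ⊔ sp F a K ⊔ sp F a K') =
          sp F a (E \ Y') := eq_of_le_of_finrank_le inf_le_left (by omega)
      rw [hKsup, ← sup_assoc]
      exact inf_eq_left.1 e
    · rw [hKsup]; exact sup_le_sup_right hKX _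
    · rw [← hside']; exact le_sup_left
    · rw [g₁, hLK'd]
    · intro w hw hwL'
      obtain ⟨x, hx, k, hk, r, rfl⟩ := hpK' w hw
      have hr : r ≠ 0 := by
        rintro rfl
        exact hwL' (mem_sup.2 ⟨x, hx, k, hk, by rw [zero_smul, add_zero]⟩)
      -- Circuits are extended by `p` if `x ∉ L₀`. Otherwise `p` is rewritten through `b`, whose
      -- component `xb` lies outside `L₀`, moving the remaining vector off `L₀` so that the old
      -- circuits apply.
      by_cases hxL : x ∈ L₀
      · have hx' : x - (r / rb) • xb ∉ L₀ := fun hm => hxbL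
          ((L₀.smul_mem_iff (div_ne_zero hr hrb)).1 ((L₀.sub_mem_iff_right hxL).1 hm))
        obtain ⟨Z, hZ, hZc, hZsp, d, hd, hrel⟩ := h.exists_circuit _
          (sub_mem hx (smul_mem _ _ hxb)) hx'
        have hbZ : b ∉ Z := fun hm =>
          (Finset.mem_sdiff.1 (hZ hm)).2 (Finset.mem_sdiff.1 hb).1
        refine ⟨insert b Z, Finset.insert_subset (hRX' hb) (hZ.trans hXX'),
          by rw [Finset.card_insert_of_notMem hbZ, hZc], ?_,
          fun z => if z = b then r / rb else d z, ?_, ?_⟩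
        · have hpm : span F {a p} ≤ sp F a (E \ Y) ⊔ sp F a K' ⊔ span F {a b} := by
            rw [span_singleton_le_iff_mem, ← smul_mem_iff _ hrb]
            have : rb • a p = -xb + -kb + a b := by rw [← hbe]; abel
            rw [this]
            exact mem_sup.2 ⟨_, mem_sup.2 ⟨_, neg_mem hxb, _, neg_mem hkb, rfl⟩, _,
              mem_span_singleton_self _, rfl⟩
          rw [← hside', hKsup, sp_insert]
          order
        · intro z hz
          by_cases hzb : z = b
          · simp only [hzb, if_true]; exact div_ne_zero hr hrb
          · simp only [hzb, if_false]; exact hd z (Finset.mem_of_mem_insert_of_ne hz hzb)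
        · have e : ∑ z ∈ Z, (if z = b then r / rb else d z) • a z = ∑ z ∈ Z, d z • a z :=
            Finset.sum_congr rfl fun z hz => by rw [if_neg]; rintro rfl; exact hbZ hz
          beta_reduce
          rw [Finset.sum_insert hbZ, if_pos rfl, e, hKsup]
          refine mem_sup.2 ⟨_, hrel, k - (r / rb) • kb, sub_mem hk (smul_mem _ _ hkb), ?_⟩
          rw [← hbe, smul_add, smul_add, smul_smul, div_mul_cancel₀ _ hrb]
          abel
      · obtain ⟨Z, hZ, hZc, hZsp, d, hd, hrel⟩ := h.exists_circuit _ hx hxL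
        have hpZ : p ∉ Z := fun hm =>
          (Finset.mem_sdiff.1 (hZ hm)).2 (Finset.mem_sdiff.1 hp).1
        refine ⟨insert p Z, Finset.insert_subset (hRX' hp) (hZ.trans hXX'),
          by rw [Finset.card_insert_of_notMem hpZ, hZc], ?_,
          fun z => if z = p then r else d z, ?_, ?_⟩
        · rw [← hside', hKsup, sp_insert]
          order
        · intro z hz
          by_cases hzp : z = p
          · simp only [hzp, if_true]; exact hr
          · simp only [hzp, if_false]; exact hd z (Finset.mem_of_mem_insert_of_ne hz hzp)
        · have e : ∑ z ∈ Z, (if z = p then r else d z) • a z = ∑ z ∈ Z, d z • a z :=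
            Finset.sum_congr rfl fun z hz => by rw [if_neg]; rintro rfl; exact hpZ hz
          beta_reduce
          rw [Finset.sum_insert hpZ, if_pos rfl, e, hKsup]
          refine mem_sup.2 ⟨_, hrel, k, hk, ?_⟩
          abel

/-- Take a minimal `Y₀` with zero cut and any `e` in it. The minimum cut avoiding `e` has order
exactly one, and after linking the side has rank one modulo `K`, generated by `e`; so `{e}` is the
set required by `exists_circuit`. -/
theorem init (a : α → V) {E : Finset α} {U : Submodule F V} {T : ℕ} (hT : 1 ≤ T)
    (hUd : T < finrank F U)
    (hNS : ∀ Y ⊆ E, finrank F (sp F a (E \ Y) ⊓ sp F a Y : Submodule F V) ≤ T →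
      U ≤ sp F a (E \ Y) ∨ U ≤ sp F a Y) (q : ℕ) :
    ∃ Y K L₀, CoverState a E U q 1 Y K L₀ := by
  have hUY : ∀ Y ⊆ E, cutDim a E U Y ≤ T → U ≤ sp F a Y := by
    intro Y hY hle
    refine (hNS Y hY ((finrank_mono ?_).trans hle)).resolve_left fun hU => ?_
    · exact inf_le_inf_left _ le_sup_left
    · have : finrank F U ≤ cutDim a E U Y := finrank_mono (le_inf hU le_sup_right)
      omega
  obtain ⟨Y₀, hY₀, hmin₀, hstrict₀⟩ := exists_cutDim_min a E U E
  have hzero : cutDim a E U Y₀ = 0 := by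
    have := hmin₀ E subset_rfl
    have h0 : cutDim a E U E = 0 := by
      unfold cutDim
      rw [sdiff_self, Finset.bot_eq_empty, sp_empty, bot_inf_eq, finrank_bot]
    omega
  have hUY₀ := hUY Y₀ hY₀ (by omega)
  have hne : Y₀.Nonempty := by
    rw [Finset.nonempty_iff_ne_empty]; rintro rfl
    have := finrank_mono hUY₀
    rw [sp_empty, finrank_bot] at this
    omega
  obtain ⟨e, he⟩ := hne
  have hers : Y₀.erase e = Y₀ \ {e} := Finset.erase_eq _ _
  have hXe : sp F a (E \ Y₀.erase e) = sp F a (E \ Y₀) ⊔ span F {a e} := by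
    rw [hers, sp_sdiff_sdiff a hY₀ (by simpa using he), sp_singleton]
  have hcut_e := hstrict₀ _ (Finset.erase_ssubset he)
  have heX : a e ∉ sp F a (E \ Y₀) := by
    intro hm
    rw [sup_eq_left.2 ((span_singleton_le_iff_mem _ _).2 hm)] at hXe
    have : cutDim a E U (Y₀.erase e) ≤ cutDim a E U Y₀ := by
      unfold cutDim
      rw [hXe]
      exact finrank_mono (inf_le_inf_left _ (sup_le_sup_right (sp_mono (Finset.erase_subset _ _)) _))
    omega
  obtain ⟨Y, hY, hmin, hstrict⟩ := exists_cutDim_min a E U (Y₀.erase e)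
  have hYY₀ : Y ⊆ Y₀ := hY.trans (Finset.erase_subset _ _)
  have heY : e ∉ Y := fun h => Finset.notMem_erase e Y₀ (hY h)
  have hYne : Y ⊂ Y₀ := ⟨hYY₀, fun h => heY (h he)⟩
  have hone : cutDim a E U Y = 1 := by
    have h₁ := hstrict₀ Y hYne
    have h₂ := hmin _ subset_rfl
    have h₃ : cutDim a E U (Y₀.erase e) ≤ cutDim a E U Y₀ + 1 := by
      unfold cutDim
      rw [hXe]
      have i₁ := finrank_sup_add_finrank_inf_eq (sp F a (E \ Y₀) ⊔ span F {a e})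
        (sp F a (Y₀.erase e) ⊔ U)
      have i₂ := finrank_sup_add_finrank_inf_eq (sp F a (E \ Y₀)) (sp F a (Y₀.erase e) ⊔ U)
      have i₃ := finrank_sup_span_singleton_le (sp F a (E \ Y₀)) (a e)
      have i₄ : finrank F (sp F a (E \ Y₀) ⊔ (sp F a (Y₀.erase e) ⊔ U) : Submodule F V) ≤
          finrank F (sp F a (E \ Y₀) ⊔ span F {a e} ⊔ (sp F a (Y₀.erase e) ⊔ U) :
            Submodule F V) := finrank_mono (by order)
      have i₅ : finrank F (sp F a (E \ Y₀) ⊓ (sp F a (Y₀.erase e) ⊔ U) : Submodule F V) ≤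
          finrank F (sp F a (E \ Y₀) ⊓ (sp F a Y₀ ⊔ U) : Submodule F V) :=
        finrank_mono (inf_le_inf_left _
          (sup_le_sup_right (sp_mono (Finset.erase_subset _ _)) _))
      omega
    omega
  have hYE := hYY₀.trans hY₀
  have hUYs := hUY Y hYE (by omega)
  obtain ⟨K, hK, k₁, k₂, -⟩ := exists_link a (E \ Y₀) (⊥ : Submodule F V) ⊥ 0 (fun _ _ => Nat.zero_le _)
  rw [bot_sup_eq, finrank_bot, zero_add] at k₁
  rw [bot_sup_eq, bot_sup_eq] at k₂
  have hspR : sp F a (E \ Y₀) ⊔ span F {a e} ⊔ sp F a ((Y₀ \ Y).erase e) = sp F a (E \ Y) := by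
    rw [← sp_singleton, ← sp_union, ← sp_union]; congr 1; ext x
    have := @hYY₀ x; have := @hY₀ x
    by_cases hx : x = e
    · subst hx; simp [heY, hY₀ he]
    · simp [hx]; tauto
  obtain ⟨K', hK', g₁, g₂, g₃⟩ := exists_link a ((Y₀ \ Y).erase e)
    (sp F a (E \ Y₀) ⊔ span F {a e}) (sp F a (E \ Y) ⊓ sp F a Y ⊔ sp F a K) (K.card + 1) (by
      intro A hA
      have hA' : insert e A ⊆ Y₀ \ Y := Finset.insert_subset (Finset.mem_sdiff.2 ⟨he, heY⟩)
        (hA.trans (Finset.erase_subset _ _))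
      have i₁ := cutDim_add_le a hY₀ hYY₀ hA' hUYs (K := sp F a K) k₂.le
      have i₂ := hstrict₀ (Y₀ \ insert e A) (Finset.sdiff_ssubset
        (hA'.trans Finset.sdiff_subset) (Finset.insert_nonempty _ _))
      have i₃ : finrank F (sp F a (E \ Y₀) ⊓ sp F a Y₀ ⊓ sp F a K : Submodule F V) ≤
          cutDim a E U Y₀ := finrank_mono (inf_le_left.trans (inf_le_inf_left _ le_sup_left))
      have e₁ : (Y₀ \ Y) \ insert e A = (Y₀ \ Y).erase e \ A := by
        ext x; simp only [Finset.mem_sdiff, Finset.mem_insert, Finset.mem_erase]; tauto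
      rw [e₁, sp_insert, ← sup_assoc] at i₁
      unfold linkDim
      omega)
  rw [finrank_sup_span_singleton heX, ← k₂, k₁] at g₁
  rw [hspR] at g₂ g₃
  rw [← k₂] at g₂ hspR
  have hKK'card : (K ∪ K').card = K.card + K'.card := by
    refine Finset.card_union_of_disjoint (Finset.disjoint_left.2 fun x hx hx' => ?_)
    exact (Finset.mem_sdiff.1 (hK hx)).2
      (Finset.mem_sdiff.1 (Finset.mem_of_mem_erase (hK' hx'))).1
  have hsidesp : sp F a (K ∪ K') ⊔ span F {a e} = sp F a (E \ Y) := by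
    rw [← g₂, sp_union]; order
  have hside : finrank F (sp F a (E \ Y)) = K.card + 1 + K'.card := by rw [← g₂, g₁]
  have hKK'd : finrank F (sp F a (K ∪ K')) = K.card + K'.card := by
    have i₁ := finrank_sup_span_singleton_le (sp F a (K ∪ K')) (a e)
    rw [hsidesp] at i₁
    have i₂ := finrank_sp_le a (K ∪ K') (F := F)
    omega
  refine ⟨Y, K ∪ K', sp F a (K ∪ K'), hYE, hUYs, hstrict, ?_, ?_, ?_, ?_, le_rfl, ?_, ?_, ?_, ?_⟩
  · refine Finset.union_subset (hK.trans (Finset.sdiff_subset_sdiff subset_rfl hYY₀)) ?_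
    exact (hK'.trans (Finset.erase_subset _ _)).trans (Finset.sdiff_subset_sdiff hY₀ subset_rfl)
  · omega
  · omega
  · have e₁ : sp F a (E \ Y) ⊓ (sp F a (E \ Y) ⊓ sp F a Y ⊔ sp F a K ⊔ sp F a K') =
        sp F a (E \ Y) := eq_of_le_of_finrank_le inf_le_left (by omega)
    rw [sp_union, ← sup_assoc]
    exact inf_eq_left.1 e₁
  · rw [← hsidesp]; exact le_sup_left
  · omega
  · intro w hw hwL
    rw [← hsidesp] at hw
    obtain ⟨k, hk, s, hs, rfl⟩ := mem_sup.1 hw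
    obtain ⟨r, rfl⟩ := mem_span_singleton.1 hs
    refine ⟨{e}, by simp [heY, hY₀ he], by simp, by rw [sp_singleton, hsidesp], fun _ => r, ?_, ?_⟩
    · rintro - - rfl; simp [hk] at hwL
    · simpa using hk
  · omega

end CoverState

/-- If a large subspace `U` lies on one side of every thin cut of `E`, then `U` is covered by few
spans of subsets of `E`, none of which contains `U`. -/
theorem coveredBySpans_of_finrank [Fintype F] (a : α → V) {E : Finset α} {U : Submodule F V}
    (hUd : Fintype.card F ^ 2 < finrank F U)
    (hNS : ∀ Y ⊆ E, finrank F (sp F a (E \ Y) ⊓ sp F a Y : Submodule F V) ≤ Fintype.card F ^ 2 →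
      U ≤ sp F a (E \ Y) ∨ U ≤ sp F a Y) :
    CoveredBySpans a E U ((Fintype.card F + 1) * (Fintype.card F + 1)) := by
  have hq : 2 ≤ Fintype.card F := Fintype.one_lt_card
  by_contra hcov
  have key : ∀ l, l + 1 ≤ Fintype.card F →
      ∃ Y K L₀, CoverState a E U (Fintype.card F) (l + 1) Y K L₀ := by
    intro l
    induction l with
    | zero => exact fun _ => CoverState.init a (Nat.one_le_pow _ _ (by omega)) hUd hNS _
    | succ l ih =>
      intro hl
      obtain ⟨Y, K, L₀, h⟩ := ih (by omega)
      exact (h.step hl hUd hNS).resolve_left hcov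
  obtain ⟨Y, K, L₀, h⟩ := key (Fintype.card F - 1) (by omega)
  rw [Nat.sub_add_cancel (by omega)] at h
  exact hcov h.covered

end Cover
end MatroidCert

namespace MatroidCert
open Module Submodule
open scoped Matroid
set_option linter.unusedSectionVars false

/-! ### Rank calculus for finite matroids -/

section Rank

variable {α : Type*} {M N : Matroid α}

theorem cast_rk (M : Matroid α) [M.RankFinite] (X : Set α) : (rk M X : ℕ∞) = M.eRk X :=
  ENat.natCast_toNat (by rw [Matroid.eRk_ne_top_iff]; exact M.isRkFinite_set X)

theorem rk_empty (M : Matroid α) : rk M ∅ = 0 := by simp [rk]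

theorem rk_eq_ncard_of_isBasis [M.RankFinite] {I X : Set α} (h : M.IsBasis I X) :
    rk M X = I.ncard := by
  rw [rk, ← h.encard_eq_eRk]; rfl

theorem rk_mono (M : Matroid α) [M.RankFinite] {X Y : Set α} (h : X ⊆ Y) : rk M X ≤ rk M Y := by
  have := M.eRk_mono h
  rw [← cast_rk, ← cast_rk] at this
  exact_mod_cast this

theorem rk_insert_of_mem_closure {e : α} {X : Set α} (h : e ∈ M.closure X) :
    rk M (insert e X) = rk M X := by
  rw [rk, rk, ← M.eRk_closure_eq (insert e X), Matroid.closure_insert_eq_of_mem_closure h,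
    M.eRk_closure_eq]

theorem rk_insert_of_notMem_closure [M.RankFinite] {e : α} {X : Set α} (he : e ∈ M.E)
    (h : e ∉ M.closure X) : rk M (insert e X) = rk M X + 1 := by
  have := Matroid.eRk_insert_eq_add_one (M := M) (X := X) ⟨he, h⟩
  rw [← cast_rk, ← cast_rk] at this
  exact_mod_cast this

theorem mem_closure_iff_rk_insert [M.RankFinite] {e : α} {X : Set α} (he : e ∈ M.E) :
    e ∈ M.closure X ↔ rk M (insert e X) = rk M X := by
  refine ⟨rk_insert_of_mem_closure, fun h => ?_⟩
  by_contra hn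
  have := rk_insert_of_notMem_closure he hn
  omega

theorem rk_delete {X D : Set α} (h : X ⊆ M.E \ D) : rk (M ＼ D) X = rk M X := by
  rw [rk, rk, M.delete_eq_restrict, M.restrict_eRk_eq h]

theorem rk_contract_add [M.RankFinite] {X C : Set α} (hX : X ⊆ M.E) (hC : C ⊆ M.E)
    (hd : Disjoint X C) : rk (M ／ C) X + rk M C = rk M (X ∪ C) := by
  obtain ⟨J, hJ⟩ := M.exists_isBasis C
  obtain ⟨I, hI, hJI⟩ := hJ.indep.subset_isBasis_of_subset (hJ.subset.trans Set.subset_union_right)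
    (Set.union_subset hX hC)
  have hIC : I ∩ C = J := (hJ.eq_of_subset_indep (hI.indep.inter_right C)
    (Set.subset_inter hJI hJ.subset) Set.inter_subset_right).symm
  have hb := hI.contract_isBasis_of_isBasis' hJ.isBasis' (hI.indep.subset
    (Set.union_subset Set.sdiff_subset hJI))
  rw [Set.union_sdiff_right, hd.sdiff_eq_left] at hb
  rw [rk_eq_ncard_of_isBasis hb, rk_eq_ncard_of_isBasis hJ, rk_eq_ncard_of_isBasis hI, ← hIC,
    add_comm]
  exact Set.ncard_inter_add_ncard_sdiff_eq_ncard I C hI.indep.finite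

theorem indep_iff_rk [M.RankFinite] {I : Set α} (hI : I.Finite) :
    M.Indep I ↔ rk M I = I.ncard := by
  rw [Matroid.indep_iff_eRk_eq_encard, ← cast_rk, ← hI.cast_ncard_eq]
  exact Nat.cast_inj

theorem ext_rk [M.Finite] [N.Finite] (hE : N.E = M.E) (h : ∀ X ⊆ M.E, rk N X = rk M X) :
    N = M := by
  refine Matroid.ext_indep hE fun I hI => ?_
  have hI' : I ⊆ M.E := hE ▸ hI
  rw [indep_iff_rk (M.ground_finite.subset hI'), indep_iff_rk (M.ground_finite.subset hI'), h I hI']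

/-- Otherwise a circuit and a cocircuit would meet in `e` alone. -/
theorem notMem_closure_of_mem_dual_closure {e : α} {Z : Set α} (h : e ∈ M✶.closure Z)
    (he : e ∉ Z) : e ∉ M.closure ((M.E \ Z) \ {e}) := by
  intro h'
  obtain ⟨K, hK, hKc, heK⟩ := Matroid.exists_isCircuit_of_mem_closure h he
  obtain ⟨C, hC, hCc, heC⟩ := Matroid.exists_isCircuit_of_mem_closure h' (by simp)
  refine hCc.inter_isCocircuit_ne_singleton (e := e) (Matroid.isCocircuit_def.2 hKc) ?_
  refine Set.Subset.antisymm (fun x ⟨hxC, hxK⟩ => ?_) (by simp [heC, heK])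
  by_contra hx
  have h₁ := (hC hxC).resolve_left hx
  have h₂ := (hK hxK).resolve_left hx
  exact h₁.1.2 h₂

end Rank

/-! ### Representations as vector families with the same rank function -/

section Representation

variable {α : Type*} {F : Type*} [Field F] {W W' : Type*} [AddCommGroup W] [Module F W]
  [FiniteDimensional F W] [AddCommGroup W'] [Module F W'] [FiniteDimensional F W']

/-- The rank function of `M` is the rank function of the vectors `a`. -/
def RankRep (F : Type*) [Field F] {W : Type*} [AddCommGroup W] [Module F W]
    (M : Matroid α) (a : α → W) : Prop :=
  ∀ X ⊆ M.E, rk M X = finrank F (span F (a '' X))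

theorem linearIndepOn_iff_finrank {ι : Type*} {a : ι → W} {I : Set ι} (hI : I.Finite) :
    LinearIndepOn F a I ↔ finrank F (span F (a '' I)) = I.ncard := by
  have := hI.fintype
  rw [LinearIndepOn, linearIndependent_iff_card_eq_finrank_span, Set.finrank, ← Set.image_eq_range,
    Set.ncard_eq_toFinset_card', Set.toFinset_card]
  exact eq_comm

theorem rankRep_iff {M : Matroid α} [M.Finite] {a : α → W} :
    RankRep F M a ↔ ∀ I ⊆ M.E, M.Indep I ↔ LinearIndepOn F a I := by
  constructor
  · intro h I hI
    have hf := M.ground_finite.subset hI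
    rw [indep_iff_rk hf, linearIndepOn_iff_finrank hf, h I hI]
  · intro h X hX
    obtain ⟨I, hI⟩ := M.exists_isBasis X
    have hIE := hI.indep.subset_ground
    have hli := (h I hIE).1 hI.indep
    rw [rk_eq_ncard_of_isBasis hI, ← (linearIndepOn_iff_finrank hI.indep.finite).1 hli]
    suffices hs : span F (a '' I) = span F (a '' X) by rw [hs]
    refine le_antisymm (span_mono (Set.image_mono hI.subset)) (span_le.2 ?_)
    rintro _ ⟨x, hx, rfl⟩
    by_cases hxI : x ∈ I
    · exact subset_span ⟨x, hxI, rfl⟩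
    · by_contra hn
      have := (h (insert x I) (Set.insert_subset (hX hx) hIE)).2 (hli.insert hn)
      exact hxI (hI.mem_of_insert_indep hx this)

variable {M : Matroid α} {a : α → W}

theorem RankRep.mem_closure_iff [M.Finite] (h : RankRep F M a) {e : α} {X : Set α} (he : e ∈ M.E)
    (hX : X ⊆ M.E) : e ∈ M.closure X ↔ a e ∈ span F (a '' X) := by
  rw [mem_closure_iff_rk_insert he, h X hX, h _ (Set.insert_subset he hX), Set.image_insert_eq,
    span_insert, sup_comm]
  constructor
  · intro h'
    by_contra hn
    have := finrank_sup_span_singleton hn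
    omega
  · intro h'
    rw [sup_eq_left.2 ((span_singleton_le_iff_mem _ _).2 h')]

theorem finrank_map_of_inj {P : W →ₗ[F] W'} {S : Submodule F W} (h : ∀ w ∈ S, P w = 0 → w = 0) :
    finrank F (S.map P) = finrank F S := by
  have h₁ := LinearMap.finrank_range_add_finrank_ker (P.domRestrict S)
  have h₂ : LinearMap.ker (P.domRestrict S) = ⊥ := by
    rw [eq_bot_iff]
    rintro ⟨w, hw⟩ hk
    have := h w hw hk
    simpa using this
  rw [h₂, finrank_bot, add_zero, LinearMap.range_domRestrict] at h₁
  exact h₁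

theorem inj_of_finrank_map {P : W →ₗ[F] W'} {S : Submodule F W}
    (h : finrank F S ≤ finrank F (S.map P)) : ∀ w ∈ S, P w = 0 → w = 0 := by
  have h₁ := LinearMap.finrank_range_add_finrank_ker (P.domRestrict S)
  rw [LinearMap.range_domRestrict] at h₁
  have h₂ : LinearMap.ker (P.domRestrict S) = ⊥ := by
    rw [← finrank_eq_zero (R := F)]; omega
  intro w hw hP
  have : (⟨w, hw⟩ : S) ∈ LinearMap.ker (P.domRestrict S) := hP
  rw [h₂, mem_bot] at this
  exact congrArg Subtype.val this

theorem span_image_of_smul {b c : α → W} {d : α → F} {X : Set α} (hd : ∀ x ∈ X, d x ≠ 0)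
    (h : ∀ x ∈ X, b x = d x • c x) : span F (b '' X) = span F (c '' X) := by
  apply le_antisymm <;> rw [span_le] <;> rintro _ ⟨x, hx, rfl⟩
  · rw [h x hx]; exact smul_mem _ _ (subset_span ⟨x, hx, rfl⟩)
  · refine ((span F (b '' X)).smul_mem_iff (hd x hx)).1 ?_
    rw [← h x hx]; exact subset_span ⟨x, hx, rfl⟩

theorem map_span_image_of_smul {P : W →ₗ[F] W'} {c : α → W'} {d : α → F} {X : Set α}
    (hd : ∀ x ∈ X, d x ≠ 0) (h : ∀ x ∈ X, P (a x) = d x • c x) :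
    (span F (a '' X)).map P = span F (c '' X) := by
  rw [map_span, ← Set.image_comp]
  exact span_image_of_smul hd h

theorem RankRep.of_map (h : RankRep F M a) {P : W →ₗ[F] W'} {c : α → W'} {d : α → F}
    (hd : ∀ x ∈ M.E, d x ≠ 0) (hP : ∀ x ∈ M.E, P (a x) = d x • c x)
    (hinj : ∀ w ∈ span F (a '' M.E), P w = 0 → w = 0) : RankRep F M c := by
  intro X hX
  rw [h X hX, ← map_span_image_of_smul (fun x hx => hd x (hX hx)) (fun x hx => hP x (hX hx))]
  exact (finrank_map_of_inj fun w hw => hinj w (span_mono (Set.image_mono hX) hw)).symm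

/-- Both families span spaces of dimension the rank of `M`, and `P` maps one span onto the other. -/
theorem RankRep.inj_of_map (h : RankRep F M a) {P : W →ₗ[F] W'} {c : α → W'} {d : α → F}
    (hc : RankRep F M c) (hd : ∀ x ∈ M.E, d x ≠ 0) (hP : ∀ x ∈ M.E, P (a x) = d x • c x) :
    ∀ w ∈ span F (a '' M.E), P w = 0 → w = 0 := by
  apply inj_of_finrank_map
  rw [map_span_image_of_smul hd hP, ← h _ subset_rfl, ← hc _ subset_rfl]

theorem RankRep.delete (h : RankRep F M a) (D : Set α) : RankRep F (M ＼ D) a := by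
  intro X hX
  rw [rk_delete hX, h X (hX.trans Set.sdiff_subset)]

theorem RankRep.contract [M.Finite] (h : RankRep F M a) {C : Set α} (hC : C ⊆ M.E) :
    RankRep F (M ／ C) (fun x => (span F (a '' C)).mkQ (a x)) := by
  intro X hX
  have hXE : X ⊆ M.E := hX.trans Set.sdiff_subset
  have h₁ := rk_contract_add hXE hC (Set.disjoint_left.2 fun x hx => (hX hx).2)
  rw [h C hC, h _ (Set.union_subset hXE hC)] at h₁
  set Q := span F (a '' C)
  have h₂ : span F ((fun x => Q.mkQ (a x)) '' X) = (span F (a '' (X ∪ C))).map Q.mkQ := by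
    rw [Set.image_union, span_union, Submodule.map_sup, mkQ_map_self Q, sup_bot_eq, map_span,
      ← Set.image_comp]
    rfl
  have h₃ := LinearMap.finrank_range_add_finrank_ker (Q.mkQ.domRestrict (span F (a '' (X ∪ C))))
  rw [LinearMap.range_domRestrict, LinearMap.ker_domRestrict, ker_mkQ] at h₃
  have hQ : Q ≤ span F (a '' (X ∪ C)) := span_mono (Set.image_mono Set.subset_union_right)
  have h₄ := (Submodule.comapSubtypeEquivOfLe hQ).finrank_eq
  have h₅ : Q.submoduleOf (span F (a '' (X ∪ C))) =
    Q.comap (span F (a '' (X ∪ C))).subtype := rfl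
  rw [h₂]
  omega

end Representation
end MatroidCert

namespace MatroidCert
open Module Submodule
open scoped Matroid
set_option linter.unusedSectionVars false

/-! ### Matrices, equivalence and finite lists of representations -/

section Columns

variable {α : Type u} {F : Type v} [Field F] {W : Type*} [AddCommGroup W] [Module F W]
  [FiniteDimensional F W] {M : Matroid α}

open Classical in
/-- The columns of a matrix labelled by `E`, extended by zero. -/
noncomputable def columns {E : Set α} (A : LabelledMatrix E F) (x : α) : Fin A.1 → F :=
  if h : x ∈ E then A.2.col ⟨x, h⟩ else 0

theorem columns_of_mem {E : Set α} (A : LabelledMatrix E F) {x : α} (h : x ∈ E) :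
    columns A x = A.2.col ⟨x, h⟩ := dif_pos h

theorem represents_iff_rankRep [M.Finite] (A : LabelledMatrix M.E F) :
    Represents F M A ↔ RankRep F M (columns A) := by
  have key : ∀ I : Set M.E, LinearIndepOn F A.2.col I ↔
      LinearIndepOn F (columns A) (Subtype.val '' I) := by
    intro I
    have hf : (Subtype.val '' I).Finite := M.ground_finite.subset (by simp)
    have e : columns A '' (Subtype.val '' I) = A.2.col '' I := by
      rw [← Set.image_comp]
      exact Set.image_congr fun x _ => columns_of_mem A x.2
    rw [linearIndepOn_iff_finrank hf,
      linearIndepOn_iff_finrank (Set.Finite.of_finite_image hf Subtype.val_injective.injOn), e,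
      Set.ncard_image_of_injective _ Subtype.val_injective]
  rw [rankRep_iff]
  constructor
  · intro h I hI
    obtain ⟨J, rfl⟩ := Set.subset_range_iff_exists_image_eq.1
      (show I ⊆ Set.range (Subtype.val : M.E → α) by simpa using hI)
    rw [h J, key]
  · intro h I
    rw [h _ (by simp), key]

/-- The matrix of a family of vectors in a basis of the space. -/
noncomputable def toMatrix (F : Type v) [Field F] {W : Type*} [AddCommGroup W] [Module F W]
    [FiniteDimensional F W] (E : Set α) (a : α → W) : LabelledMatrix E F :=
  ⟨finrank F W, Matrix.of fun i x => (finBasis F W).equivFun (a x) i⟩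

theorem columns_toMatrix {E : Set α} (a : α → W) {x : α} (h : x ∈ E) :
    columns (toMatrix F E a) x = (finBasis F W).equivFun (a x) :=
  columns_of_mem _ h

theorem RankRep.represents_toMatrix [M.Finite] {a : α → W} (h : RankRep F M a) :
    Represents F M (toMatrix F M.E a) := by
  rw [represents_iff_rankRep]
  refine h.of_map (P := (finBasis F W).equivFun.toLinearMap) (d := fun _ => 1) (by simp) ?_ ?_
  · intro x hx
    rw [columns_toMatrix a hx, one_smul]; rfl
  · intro w _ hw
    exact (finBasis F W).equivFun.map_eq_zero_iff.1 hw

theorem RankRep.representable [M.Finite] {a : α → W} (h : RankRep F M a) : Representable F M :=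
  ⟨_, h.represents_toMatrix⟩

theorem Representable.exists_rankRep [M.Finite] (h : Representable F M) :
    ∃ (m : ℕ) (a : α → Fin m → F), RankRep F M a := by
  obtain ⟨A, hA⟩ := h
  exact ⟨_, _, (represents_iff_rankRep A).1 hA⟩

theorem Representable.minor [M.Finite] (h : Representable F M) {C D : Set α} (hC : C ⊆ M.E) :
    Representable F (M ／ C ＼ D) := by
  obtain ⟨m, a, ha⟩ := h.exists_rankRep
  exact ((ha.contract hC).delete D).representable

/-- The columns of `B` are, up to nonzero scalars, the image of those of `A` by a linear map. -/
def ColumnMap {E : Type u} (A B : LabelledMatrix E F) : Prop :=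
  ∃ (P : (Fin A.1 → F) →ₗ[F] (Fin B.1 → F)) (d : E → F),
    ∀ x, d x ≠ 0 ∧ P (A.2.col x) = d x • B.2.col x

theorem ColumnMap.trans {E : Type u} {A B C : LabelledMatrix E F} (h : ColumnMap A B)
    (h' : ColumnMap B C) : ColumnMap A C := by
  obtain ⟨P, d, hP⟩ := h
  obtain ⟨Q, d', hQ⟩ := h'
  refine ⟨Q ∘ₗ P, fun x => d x * d' x, fun x => ⟨mul_ne_zero (hP x).1 (hQ x).1, ?_⟩⟩
  rw [LinearMap.comp_apply, (hP x).2, map_smul, (hQ x).2, smul_smul]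

theorem columnMap_of_forall {E : Type u} {A B : LabelledMatrix E F}
    (P : (Fin A.1 → F) →ₗ[F] (Fin B.1 → F)) (h : ∀ x, P (A.2.col x) = B.2.col x) :
    ColumnMap A B :=
  ⟨P, fun _ => 1, fun x => ⟨one_ne_zero, by rw [h, one_smul]⟩⟩

/-- Both directions are recorded because equivalence also uses reversed steps, in particular
deletion of zero rows. -/
theorem ElementaryStep.columnMap {E : Type u} {A B : LabelledMatrix E F}
    (h : ElementaryStep A B) : ColumnMap A B ∧ ColumnMap B A := by
  cases h with
  | addRow m A i j hij =>
    let P (t : F) : (Fin m → F) →ₗ[F] (Fin m → F) :=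
      LinearMap.pi fun k => if k = j then LinearMap.proj j + t • LinearMap.proj i
        else LinearMap.proj k
    constructor
    · refine columnMap_of_forall (P 1) fun x => funext fun k => ?_
      by_cases hk : k = j
      · simp [P, hk, Matrix.col]
      · simp [P, hk, Matrix.col, Matrix.updateRow_apply]
    · refine columnMap_of_forall (P (-1)) fun x => funext fun k => ?_
      by_cases hk : k = j
      · simp [P, hk, Matrix.col, Matrix.updateRow_apply, hij]
      · simp [P, hk, Matrix.col, Matrix.updateRow_apply]
  | scaleRow m A i c hc =>
    constructor
    · refine columnMap_of_forall (LinearMap.pi (φ := fun _ : Fin m => F) fun k => (if k = i then c • LinearMap.proj i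
        else LinearMap.proj k : (Fin m → F) →ₗ[F] F)) fun x => funext fun k => ?_
      by_cases hk : k = i
      · simp [hk, Matrix.col]
      · simp [hk, Matrix.col, Matrix.updateRow_apply]
    · refine columnMap_of_forall (LinearMap.pi (φ := fun _ : Fin m => F) fun k => (if k = i then c⁻¹ • LinearMap.proj i
        else LinearMap.proj k : (Fin m → F) →ₗ[F] F)) fun x => funext fun k => ?_
      by_cases hk : k = i
      · simp [hk, Matrix.col, hc]
      · simp [hk, Matrix.col, Matrix.updateRow_apply]
  | adjoinZeroRow m A k =>
    constructor
    · refine columnMap_of_forall (LinearMap.pi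
        (k.insertNth (0 : (Fin m → F) →ₗ[F] F) fun l => LinearMap.proj l))
        fun x => funext fun l => ?_
      refine Fin.succAboveCases k ?_ (fun l => ?_) l
      · simpa [Matrix.col, Matrix.row] using
          (congrFun (Fin.insertNth_apply_same (α := fun _ => E → F) k 0 A) x).symm
      · simpa [Matrix.col, Matrix.row] using
          (congrFun (Fin.insertNth_apply_succAbove (α := fun _ => E → F) k 0 A l) x).symm
    · refine columnMap_of_forall (LinearMap.pi fun l => LinearMap.proj (k.succAbove l))
        fun x => funext fun l => ?_
      simpa [Matrix.col, Matrix.row] using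
        congrFun (Fin.insertNth_apply_succAbove (α := fun _ => E → F) k 0 A l) x
  | scaleCols m A d hd =>
    refine ⟨⟨LinearMap.id, fun x => (d x)⁻¹, fun x => ⟨inv_ne_zero (hd x), funext fun k => ?_⟩⟩,
      ⟨LinearMap.id, d, fun x => ⟨hd x, funext fun k => ?_⟩⟩⟩
    · simp [Matrix.col, hd x]
    · simp [Matrix.col]

theorem Equivalent.columnMap {E : Type u} {A B : LabelledMatrix E F} (h : Equivalent A B) :
    ColumnMap A B := by
  suffices ColumnMap A B ∧ ColumnMap B A from this.1
  induction h with
  | rel A B h => exact h.columnMap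
  | refl A => exact ⟨columnMap_of_forall LinearMap.id fun _ => rfl,
      columnMap_of_forall LinearMap.id fun _ => rfl⟩
  | symm A B _ ih => exact ih.symm
  | trans A B C _ _ ih ih' => exact ⟨ih.1.trans ih'.1, ih'.2.trans ih.2⟩

/-- A finite list of representations, up to linear maps and column scaling. -/
theorem HasAtMostInequivReps.exists_finset [M.Finite] {s : ℕ} (h : HasAtMostInequivReps F M s) :
    ∃ R : Finset (Σ m : ℕ, α → Fin m → F), R.card ≤ s ∧ (∀ r ∈ R, RankRep F M r.2) ∧
      ∀ {W : Type v} [AddCommGroup W] [Module F W] [FiniteDimensional F W] (b : α → W),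
        RankRep F M b → ∃ r ∈ R, ∃ (P : W →ₗ[F] (Fin r.1 → F)) (d : α → F),
          ∀ x ∈ M.E, d x ≠ 0 ∧ P (b x) = d x • r.2 x := by
  classical
  let st : Setoid {A : LabelledMatrix M.E F // Represents F M A} :=
    ⟨fun A B => Equivalent A.1 B.1, fun A => Relation.EqvGen.refl _,
      fun h => Relation.EqvGen.symm _ _ h, fun h h' => Relation.EqvGen.trans _ _ _ h h'⟩
  -- One representative per equivalence class; these are pairwise inequivalent, so there are at most
  -- `s`.
  let S : Set (LabelledMatrix M.E F) := Set.range fun c : Quotient st => c.out.1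
  have hS : S.encard ≤ s := by
    refine h S ?_ ?_
    · rintro _ ⟨c, rfl⟩; exact c.out.2
    · rintro _ ⟨c, rfl⟩ _ ⟨c', rfl⟩ hne heq
      apply hne
      have : c = c' := by
        rw [← c.out_eq, ← c'.out_eq]; exact Quotient.sound heq
      rw [this]
  have hfin : S.Finite := Set.finite_of_encard_le_coe hS
  refine ⟨hfin.toFinset.image fun A => ⟨A.1, columns A⟩, ?_, ?_, ?_⟩
  · refine Finset.card_image_le.trans ?_
    rw [hfin.encard_eq_coe_toFinset_card] at hS
    exact_mod_cast hS
  · intro r hr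
    obtain ⟨A, hA, rfl⟩ := Finset.mem_image.1 hr
    obtain ⟨c, rfl⟩ := hfin.mem_toFinset.1 hA
    exact (represents_iff_rankRep _).1 c.out.2
  · intro W _ _ _ b hb
    let c : Quotient st := Quotient.mk st ⟨_, hb.represents_toMatrix⟩
    have hc : Equivalent (toMatrix F M.E b) c.out.1 := Quotient.exact c.out_eq.symm
    obtain ⟨P, d, hP⟩ := hc.columnMap
    obtain ⟨d', hd'⟩ : ∃ d' : α → F, ∀ x (hx : x ∈ M.E), d' x = d ⟨x, hx⟩ :=
      ⟨fun x => if hx : x ∈ M.E then d ⟨x, hx⟩ else 0, fun x hx => dif_pos hx⟩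
    refine ⟨⟨c.out.1.1, columns c.out.1⟩, Finset.mem_image.2 ⟨c.out.1,
      hfin.mem_toFinset.2 ⟨c, rfl⟩, rfl⟩, P ∘ₗ (finBasis F W).equivFun.toLinearMap,
      d', fun x hx => ⟨(hd' x hx).symm ▸ (hP ⟨x, hx⟩).1, ?_⟩⟩
    dsimp only
    rw [columns_of_mem _ hx, hd' x hx]
    exact (hP ⟨x, hx⟩).2

end Columns
end MatroidCert

namespace MatroidCert
open Module Submodule
open scoped Matroid
set_option linter.unusedSectionVars false

/-! ### Certificates and the deletion step -/

section Certificates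

variable {α : Type u} {F : Type v} [Field F] {M : Matroid α}

/-- At most `k` rank evaluations distinguish `M` from all other representable matroids. -/
def HasCertificate (F : Type v) [Field F] (M : Matroid α) (k : ℕ) : Prop :=
  ∃ S : Finset (Set α), S.card ≤ k ∧ (∀ X ∈ S, X ⊆ M.E) ∧ ∀ N : Matroid α, N.E = M.E →
    Representable F N → (∀ X ∈ S, rk N X = rk M X) → N = M

theorem HasCertificate.mono {k l : ℕ} (h : HasCertificate F M k) (hkl : k ≤ l) :
    HasCertificate F M l := by
  obtain ⟨S, hS, h'⟩ := h
  exact ⟨S, hS.trans hkl, h'⟩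

theorem finite_of_ground_eq [hM : M.Finite] {N : Matroid α} (h : N.E = M.E) : N.Finite :=
  ⟨h ▸ hM.ground_finite⟩

/-- Matroids coming from a finite list are excluded by one rank evaluation each. -/
theorem exists_separating [M.Finite] {ι : Type*} [Finite ι] (cand : ι → Matroid α → Prop)
    (h : ∀ i N N', N.E = M.E → N'.E = M.E → cand i N → cand i N' → N = N') :
    ∃ S : Finset (Set α), S.card ≤ Nat.card ι ∧ (∀ X ∈ S, X ⊆ M.E) ∧
      ∀ N : Matroid α, N.E = M.E → (∃ i, cand i N) → (∀ X ∈ S, rk N X = rk M X) → N = M := by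
  classical
  have := Fintype.ofFinite ι
  have hX : ∀ i, ∃ X ⊆ M.E, ∀ N : Matroid α, N.E = M.E → cand i N → rk N X = rk M X → N = M := by
    intro i
    by_cases hi : ∃ N : Matroid α, N.E = M.E ∧ cand i N ∧ N ≠ M
    · obtain ⟨N, hN, hc, hne⟩ := hi
      have := finite_of_ground_eq hN
      have hex : ∃ X ⊆ M.E, rk N X ≠ rk M X := by
        by_contra! hall
        exact hne (ext_rk hN hall)
      obtain ⟨X, hXE, hX⟩ := hex
      refine ⟨X, hXE, fun N' hN' hc' hr => absurd ?_ hX⟩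
      rwa [h i N N' hN hN' hc hc']
    · push Not at hi
      -- No competitor has this index, so the query is a dummy.
      exact ⟨∅, Set.empty_subset _, fun N hN hc _ => hi N hN hc⟩
  choose X hXE hX using hX
  refine ⟨Finset.univ.image X, ?_, ?_, ?_⟩
  · rw [Nat.card_eq_fintype_card]
    exact Finset.card_image_le
  · intro Y hY
    obtain ⟨i, -, rfl⟩ := Finset.mem_image.1 hY
    exact hXE i
  · rintro N hN ⟨i, hi⟩ hr
    exact hX i N hN hi (hr _ (Finset.mem_image_of_mem _ (Finset.mem_univ i)))

/-- Each member that is needed strictly lowers the dimension of the intersection with `S`. This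
gives the linear number of queries per deletion. -/
theorem exists_finset_inf {ι W : Type*} [AddCommGroup W] [Module F W] [FiniteDimensional F W]
    (f : ι → Submodule F W) (G : Set ι) (S : Submodule F W) :
    ∃ T : Finset ι, (∀ i ∈ T, i ∈ G) ∧ T.card ≤ finrank F S ∧
      ∀ v ∈ S, (∀ i ∈ T, v ∈ f i) → ∀ i ∈ G, v ∈ f i := by
  classical
  induction hn : finrank F S using Nat.strong_induction_on generalizing S with
  | _ n ih =>
  subst hn
  by_cases hS : ∀ i ∈ G, S ≤ f i
  · exact ⟨∅, by simp, Nat.zero_le _, fun v hv _ i hi => hS i hi hv⟩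
  · push Not at hS
    obtain ⟨i, hi, hSi⟩ := hS
    have hlt : finrank F (S ⊓ f i : Submodule F W) < finrank F S :=
      finrank_lt_finrank_of_lt (lt_of_le_of_ne inf_le_left fun h => hSi (inf_eq_left.1 h))
    obtain ⟨T, hT, hTc, hTv⟩ := ih _ hlt _ rfl
    refine ⟨insert i T, ?_, (Finset.card_insert_le _ _).trans (by omega), ?_⟩
    · intro j hj
      rcases Finset.mem_insert.1 hj with rfl | hj
      exacts [hi, hT j hj]
    · intro v hv hvT
      exact hTv v ⟨hv, hvT i (Finset.mem_insert_self _ _)⟩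
        fun j hj => hvT j (Finset.mem_insert_of_mem hj)

theorem insert_ground_diff {e : α} (he : e ∈ M.E) : insert e (M.E \ {e}) = M.E := by
  rw [Set.insert_sdiff_singleton, Set.insert_eq_of_mem he]

/-- The vectors in the span of every set whose closure in `M` contains `e`. -/
noncomputable def spanGuts (F : Type*) [Field F] {W : Type*} [AddCommGroup W] [Module F W]
    (M : Matroid α) (a : α → W) (e : α) : Submodule F W :=
  ⨅ X ∈ {X : Set α | X ⊆ M.E \ {e} ∧ e ∈ M.closure X}, span F (a '' X)

theorem mem_spanGuts {W : Type*} [AddCommGroup W] [Module F W] {a : α → W} {e : α} {v : W} :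
    v ∈ spanGuts F M a e ↔ ∀ X ⊆ M.E \ {e}, e ∈ M.closure X → v ∈ span F (a '' X) := by
  simp [spanGuts, Submodule.mem_iInf]

theorem spanGuts_le {W : Type*} [AddCommGroup W] [Module F W] {a : α → W} {e : α} {X : Set α}
    (hX : X ⊆ M.E \ {e}) (he : e ∈ M.closure X) : spanGuts F M a e ≤ span F (a '' X) :=
  fun _ hv => mem_spanGuts.1 hv X hX he

open Classical in
/-- Rank evaluations excluding all extensions of a representation of `M ＼ {e}` by a vector of
`spanGuts`. -/
theorem exists_queries_of_delete [M.Finite] [Fintype F] {W : Type*} [AddCommGroup W] [Module F W]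
    [FiniteDimensional F W] {e : α} (he : e ∈ M.E) {a : α → W}
    {E' : Finset α} (hE' : (E' : Set α) = M.E \ {e}) {T Q : ℕ}
    (h : finrank F (spanGuts F M a e) ≤ T ∨ CoveredBySpans a E' (spanGuts F M a e) Q) :
    ∃ S : Finset (Set α), S.card ≤ Fintype.card F ^ T + Q ∧ (∀ X ∈ S, X ⊆ M.E) ∧
      ∀ N : Matroid α, N.E = M.E → (∀ X ⊆ M.E \ {e}, rk N X = rk M X) →
        (∃ v ∈ spanGuts F M a e, RankRep F N (Function.update a e v)) →
        (∀ X ∈ S, rk N X = rk M X) → N = M := by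
  rcases h with h | ⟨𝓧, h𝓧, hsub, hcov⟩
  · have : Finite (spanGuts F M a e) := Module.finite_of_finite F
    obtain ⟨S, hS, hSE, hSN⟩ := exists_separating (M := M) (ι := spanGuts F M a e)
      (fun v N => RankRep F N (Function.update a e v.1)) (fun v N N' hN hN' h h' => by
        have := finite_of_ground_eq hN
        have := finite_of_ground_eq hN'
        refine ext_rk (hN.trans hN'.symm) fun X hX => ?_
        rw [h X (by rwa [hN, ← hN']), h' X hX])
    refine ⟨S, ?_, hSE, fun N hN _ ⟨v, hv, hv'⟩ hr => hSN N hN ⟨⟨v, hv⟩, hv'⟩ hr⟩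
    have hc : Nat.card (spanGuts F M a e) = Fintype.card F ^ finrank F (spanGuts F M a e) := by
      rw [Module.natCard_eq_pow_finrank (K := F), Nat.card_eq_fintype_card]
    have := Nat.pow_le_pow_right Fintype.card_pos h (n := Fintype.card F)
    omega
  -- A covering set `X` does not span `U`, so `e` is outside its closure in `M`; the rank of `X + e`
  -- contradicts any `v` in its span.
  · refine ⟨𝓧.image fun X : Finset α => insert e (X : Set α), ?_, ?_, ?_⟩
    · exact (Finset.card_image_le.trans h𝓧).trans (Nat.le_add_left _ _)
    · intro Y hY
      obtain ⟨X, hX, rfl⟩ := Finset.mem_image.1 hY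
      refine Set.insert_subset he ((Finset.coe_subset.2 (hsub X hX).1).trans ?_)
      rw [hE']; exact Set.sdiff_subset
    · rintro N hN hNr ⟨v, hv, hrep⟩ hr
      exfalso
      obtain ⟨X, hX, hvX⟩ := hcov v hv
      have hXE : (X : Set α) ⊆ M.E \ {e} := hE' ▸ Finset.coe_subset.2 (hsub X hX).1
      have hXM : (X : Set α) ⊆ M.E := hXE.trans Set.sdiff_subset
      have h₁ : e ∉ M.closure X := fun hcl => (hsub X hX).2 (spanGuts_le hXE hcl)
      have h₂ := rk_insert_of_notMem_closure he h₁
      have h₃ := hr _ (Finset.mem_image_of_mem _ hX)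
      have := finite_of_ground_eq hN
      have h₄ : e ∈ N.closure X := by
        rw [hrep.mem_closure_iff (hN ▸ he) (hN ▸ hXM), Function.update_self]
        have : Function.update a e v '' X = a '' X := Set.image_congr fun x hx =>
          Function.update_of_ne (fun h => (hXE hx).2 h) _ _
        rw [this]
        exact hvX
      have h₅ := rk_insert_of_mem_closure h₄
      have h₆ := hNr X hXE
      omega

theorem rk_le_ncard (M : Matroid α) [M.Finite] {X : Set α} (hX : X ⊆ M.E) : rk M X ≤ X.ncard := by
  have := M.eRk_le_encard X
  rw [← cast_rk, ← (M.ground_finite.subset hX).cast_ncard_eq] at this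
  exact_mod_cast this

theorem HasCertificate.eq_of_delete {e : α} {S : Finset (Set α)} [M.Finite]
    (hS : ∀ X ∈ S, X ⊆ (M ＼ {e}).E)
    (h : ∀ N : Matroid α, N.E = (M ＼ {e}).E → Representable F N →
      (∀ X ∈ S, rk N X = rk (M ＼ {e}) X) → N = M ＼ {e})
    {N : Matroid α} (hN : N.E = M.E) (hrep : Representable F N)
    (hr : ∀ X ∈ S, rk N X = rk M X) : N ＼ {e} = M ＼ {e} := by
  have := finite_of_ground_eq hN
  have hd : Representable F (N ＼ {e}) := by
    have := hrep.minor (C := ∅) (D := {e}) (Set.empty_subset _)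
    rwa [Matroid.contract_empty] at this
  refine h _ (by simp [hN]) hd fun X hX => ?_
  rw [rk_delete (hS X hX), rk_delete (by rw [hN]; exact hS X hX), hr X hX]

/-- The rank of the ground set is the one additional query: it makes `e` a coloop of the competitor,
which determines every rank. -/
theorem hasCertificate_of_coloop [M.Finite] {e : α} {k : ℕ} (he : e ∈ M.E)
    (hcl : e ∉ M.closure (M.E \ {e})) (h : HasCertificate F (M ＼ {e}) k) :
    HasCertificate F M (k + 1) := by
  classical
  obtain ⟨S, hS, hSE, hSN⟩ := h
  refine ⟨insert M.E S, (Finset.card_insert_le _ _).trans (by omega), ?_, ?_⟩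
  · intro X hX
    rcases Finset.mem_insert.1 hX with rfl | hX
    exacts [subset_rfl, (hSE X hX).trans Set.sdiff_subset]
  · intro N hN hrep hr
    have := finite_of_ground_eq hN
    have hdel := HasCertificate.eq_of_delete hSE hSN hN hrep
      fun X hX => hr X (Finset.mem_insert_of_mem hX)
    have hrk : ∀ X ⊆ M.E \ {e}, rk N X = rk M X := by
      intro X hX
      rw [← rk_delete hX, ← rk_delete (M := N) (D := {e}) (by rwa [hN]), hdel]
    have hclN : e ∉ N.closure (M.E \ {e}) := by
      rw [mem_closure_iff_rk_insert (hN ▸ he), insert_ground_diff he,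
        hr _ (Finset.mem_insert_self _ _), hrk _ subset_rfl, ← insert_ground_diff he]
      rw [rk_insert_of_notMem_closure he hcl, Set.insert_sdiff_self_of_notMem (by simp)]
      omega
    refine ext_rk hN fun X hX => ?_
    by_cases heX : e ∈ X
    · have hXe : X \ {e} ⊆ M.E \ {e} := Set.sdiff_subset_sdiff_left hX
      rw [← Set.insert_eq_of_mem heX, ← Set.insert_sdiff_singleton,
        rk_insert_of_notMem_closure he fun h => hcl (M.closure_subset_closure hXe h),
        rk_insert_of_notMem_closure (hN ▸ he) fun h => hclN (N.closure_subset_closure hXe h),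
        hrk _ hXe]
    · exact hrk X (Set.subset_sdiff_singleton hX heX)

/-- A competitor's representation is carried by a linear map to one on the list, with `e` going to
some vector. For each listed representation, n queries confine that vector to `spanGuts`, and
boundedly many more finish. -/
theorem hasCertificate_of_delete [M.Finite] [Fintype F] {e : α} {k s T Q : ℕ} (he : e ∈ M.E)
    (hcl : e ∈ M.closure (M.E \ {e})) (h : HasCertificate F (M ＼ {e}) k)
    (hs : HasAtMostInequivReps F (M ＼ {e}) s) {E' : Finset α} (hE' : (E' : Set α) = M.E \ {e})
    (hcov : ∀ (m : ℕ) (a : α → Fin m → F), RankRep F (M ＼ {e}) a →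
      finrank F (spanGuts F M a e) ≤ T ∨ CoveredBySpans a E' (spanGuts F M a e) Q) :
    HasCertificate F M (k + 1 + s * (M.E.ncard + (Fintype.card F ^ T + Q))) := by
  classical
  have hMe : (M ＼ {e}).Finite := ⟨M.ground_finite.subset Set.sdiff_subset⟩
  obtain ⟨S, hS, hSE, hSN⟩ := h
  obtain ⟨R, hR, hRrep, hRall⟩ := hs.exists_finset
  have hT : ∀ r : Σ m : ℕ, α → Fin m → F, ∃ Tr : Finset (Set α), (r ∈ R → Tr.card ≤ M.E.ncard) ∧
      (∀ X ∈ Tr, X ⊆ M.E \ {e} ∧ e ∈ M.closure X) ∧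
      ∀ v ∈ span F (r.2 '' (M.E \ {e})), (∀ X ∈ Tr, v ∈ span F (r.2 '' X)) →
        v ∈ spanGuts F M r.2 e := by
    intro r
    obtain ⟨Tr, h₁, h₂, h₃⟩ := exists_finset_inf (fun X => span F (r.2 '' X))
      {X : Set α | X ⊆ M.E \ {e} ∧ e ∈ M.closure X} (span F (r.2 '' (M.E \ {e})))
    refine ⟨Tr, fun hr => h₂.trans ?_, h₁, fun v hv hv' => mem_spanGuts.2 fun X hX hXe =>
      h₃ v hv hv' X ⟨hX, hXe⟩⟩
    rw [← hRrep r hr (M.E \ {e}) subset_rfl]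
    exact (rk_le_ncard _ subset_rfl).trans
      (Set.ncard_le_ncard Set.sdiff_subset M.ground_finite)
  choose Tr hTc hTE hTv using hT
  have hQ : ∀ r : Σ m : ℕ, α → Fin m → F, ∃ Sr : Finset (Set α), r ∈ R →
      Sr.card ≤ Fintype.card F ^ T + Q ∧ (∀ X ∈ Sr, X ⊆ M.E) ∧
      ∀ N : Matroid α, N.E = M.E → (∀ X ⊆ M.E \ {e}, rk N X = rk M X) →
        (∃ v ∈ spanGuts F M r.2 e, RankRep F N (Function.update r.2 e v)) →
        (∀ X ∈ Sr, rk N X = rk M X) → N = M := by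
    intro r
    by_cases hr : r ∈ R
    · obtain ⟨Sr, hSr⟩ := exists_queries_of_delete he hE' (hcov _ _ (hRrep r hr))
      exact ⟨Sr, fun _ => hSr⟩
    · exact ⟨∅, fun h => absurd h hr⟩
  choose Sr hSr using hQ
  refine ⟨(insert M.E S) ∪ R.biUnion fun r => (Tr r).image (insert e) ∪ Sr r, ?_, ?_, ?_⟩
  · refine (Finset.card_union_le _ _).trans (Nat.add_le_add
      ((Finset.card_insert_le _ _).trans (Nat.add_le_add_right hS 1)) ?_)
    refine (Finset.card_biUnion_le_card_mul _ _ _ fun r hr => ?_).trans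
      (Nat.mul_le_mul_right _ hR)
    exact (Finset.card_union_le _ _).trans (Nat.add_le_add (Finset.card_image_le.trans (hTc r hr))
      (hSr r hr).1)
  · intro X hX
    rcases Finset.mem_union.1 hX with hX | hX
    · rcases Finset.mem_insert.1 hX with rfl | hX
      exacts [subset_rfl, (hSE X hX).trans Set.sdiff_subset]
    · obtain ⟨r, hr, hX⟩ := Finset.mem_biUnion.1 hX
      rcases Finset.mem_union.1 hX with hX | hX
      · obtain ⟨Y, hY, rfl⟩ := Finset.mem_image.1 hX
        exact Set.insert_subset he ((hTE r Y hY).1.trans Set.sdiff_subset)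
      · exact (hSr r hr).2.1 X hX
  · intro N hN hrep hr
    have hNfin := finite_of_ground_eq hN
    have hdel := HasCertificate.eq_of_delete hSE hSN hN hrep
      fun X hX => hr X (Finset.mem_union_left _ (Finset.mem_insert_of_mem hX))
    have hrk : ∀ X ⊆ M.E \ {e}, rk N X = rk M X := by
      intro X hX
      rw [← rk_delete hX, ← rk_delete (M := N) (D := {e}) (by rwa [hN]), hdel]
    have hclX : ∀ X ⊆ M.E \ {e}, e ∈ M.closure X → rk N (insert e X) = rk M (insert e X) →
        e ∈ N.closure X := by
      intro X hX heX hrX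
      rw [mem_closure_iff_rk_insert (hN ▸ he), hrX, hrk X hX, rk_insert_of_mem_closure heX]
    have hclN : e ∈ N.closure (M.E \ {e}) := by
      refine hclX _ subset_rfl hcl ?_
      rw [insert_ground_diff he]
      exact hr _ (Finset.mem_union_left _ (Finset.mem_insert_self _ _))
    obtain ⟨m, b, hb⟩ := hrep.exists_rankRep
    have hbd : RankRep F (M ＼ {e}) b := hdel ▸ hb.delete {e}
    obtain ⟨r, hrR, P, d, hP⟩ := hRall b hbd
    have hmap : ∀ X ⊆ M.E \ {e}, e ∈ N.closure X → P (b e) ∈ span F (r.2 '' X) := by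
      intro X hX heX
      rw [hb.mem_closure_iff (hN ▸ he) (hN ▸ hX.trans Set.sdiff_subset)] at heX
      rw [← map_span_image_of_smul (P := P) (a := b) (fun x hx => (hP x (hX hx)).1)
        (fun x hx => (hP x (hX hx)).2)]
      exact mem_map_of_mem heX
    refine (hSr r hrR).2.2 N hN hrk ⟨P (b e), ?_, ?_⟩ fun X hX => hr X
      (Finset.mem_union_right _ (Finset.mem_biUnion.2 ⟨r, hrR, Finset.mem_union_right _ hX⟩))
    · refine hTv r _ (hmap _ subset_rfl hclN) fun X hX => hmap X (hTE r X hX).1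
        (hclX X (hTE r X hX).1 (hTE r X hX).2 (hr _ (Finset.mem_union_right _
          (Finset.mem_biUnion.2 ⟨r, hrR, Finset.mem_union_left _
            (Finset.mem_image_of_mem _ hX)⟩))))
    · refine hb.of_map (P := P) (d := Function.update d e 1) ?_ ?_ ?_
      · intro x hx
        by_cases hxe : x = e
        · subst hxe; simp
        · rw [Function.update_of_ne hxe]; exact (hP x ⟨hN ▸ hx, hxe⟩).1
      · intro x hx
        by_cases hxe : x = e
        · subst hxe; simp
        · rw [Function.update_of_ne hxe, Function.update_of_ne hxe]; exact (hP x ⟨hN ▸ hx, hxe⟩).2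
      -- The map is injective on the span of `E - e`, which also contains the vector of `e`.
      · have hinj := hbd.inj_of_map (hRrep r hrR) (fun x hx => (hP x hx).1) fun x hx => (hP x hx).2
        rw [hb.mem_closure_iff (hN ▸ he) (hN ▸ Set.sdiff_subset)] at hclN
        have : span F (b '' N.E) = span F (b '' (M.E \ {e})) := by
          rw [hN, ← insert_ground_diff he, Set.image_insert_eq, span_insert,
            insert_ground_diff he]
          exact sup_eq_right.2 ((span_singleton_le_iff_mem _ _).2 hclN)
        rw [this]
        exact hinj

end Certificates
end MatroidCert

namespace MatroidCert
open Module Submodule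
open scoped Matroid
set_option linter.unusedSectionVars false

/-! ### The contraction step -/

section Contraction

variable {α : Type u} {F : Type v} [Field F] {M : Matroid α}

theorem exists_factor {V W U : Type*} [AddCommGroup V] [Module F V] [AddCommGroup W] [Module F W]
    [AddCommGroup U] [Module F U] (S : Submodule F V) (f : V →ₗ[F] W) (g : V →ₗ[F] U)
    (h : ∀ x ∈ S, f x = 0 → g x = 0) : ∃ ψ : W →ₗ[F] U, ∀ x ∈ S, ψ (f x) = g x := by
  let f' := f.domRestrict S
  obtain ⟨k, hk⟩ := LinearMap.exists_leftInverse_of_injective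
    ((LinearMap.ker f').liftQ f' le_rfl) (Submodule.ker_liftQ_eq_bot _ _ _ le_rfl)
  refine ⟨(LinearMap.ker f').liftQ (g.domRestrict S) (fun x hx => h x x.2 hx) ∘ₗ k,
    fun x hx => ?_⟩
  have h₁ : f x = (LinearMap.ker f').liftQ f' le_rfl (Submodule.Quotient.mk ⟨x, hx⟩) := rfl
  have h₂ := LinearMap.congr_fun hk (Submodule.Quotient.mk ⟨x, hx⟩)
  rw [LinearMap.comp_apply, h₁]
  rw [LinearMap.comp_apply, LinearMap.id_apply] at h₂
  rw [h₂]
  rfl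

open Classical in
/-- The representation obtained from a representation `a` of a contraction of `e` by a functional
`ψ` on one side of a partition. -/
noncomputable def coextend {W : Type*} [AddCommGroup W] [Module F W] (a : α → W) (A : Set α)
    (e : α) (ψ : W →ₗ[F] F) (x : α) : W × F :=
  if x = e then (0, 1) else if x ∈ A then (a x, ψ (a x)) else (a x, 0)

/-- The coextended matroid depends only on the restriction of `ψ` to `span A ∩ span B`, leaving at
most q^T candidates. -/
theorem exists_queries_of_contract [M.Finite] [Fintype F] {W : Type*} [AddCommGroup W]
    [Module F W] [FiniteDimensional F W] (e : α) {A B : Set α} (hAB : M.E \ {e} ⊆ A ∪ B)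
    (a : α → W) {T : ℕ}
    (hT : finrank F (span F (a '' A) ⊓ span F (a '' B) : Submodule F W) ≤ T) :
    ∃ S : Finset (Set α), S.card ≤ Fintype.card F ^ T ∧ (∀ X ∈ S, X ⊆ M.E) ∧
      ∀ N : Matroid α, N.E = M.E → (∃ ψ : W →ₗ[F] F, RankRep F N (coextend a A e ψ)) →
        (∀ X ∈ S, rk N X = rk M X) → N = M := by
  set O := span F (a '' A) ⊓ span F (a '' B)
  have hfinW : Finite (Module.Dual F O) := Module.finite_of_finite F
  obtain ⟨S, hS, hSE, hSN⟩ := exists_separating (M := M) (ι := Module.Dual F O)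
    (fun θ N => ∃ ψ : W →ₗ[F] F, ψ ∘ₗ O.subtype = θ ∧ RankRep F N (coextend a A e ψ)) (by
      rintro θ N N' hN hN' ⟨ψ, hψ, h⟩ ⟨ψ', hψ', h'⟩
      have := finite_of_ground_eq hN
      have := finite_of_ground_eq hN'
      -- Functionals agreeing on the overlap differ on `span A` by a functional `χ` that kills `span
      -- B`; the shear it defines carries one coextension to the other.
      obtain ⟨χ, hχ⟩ := exists_factor (span F (a '' A)) (span F (a '' B)).mkQ (ψ' - ψ) (by
        intro x hx hx'
        rw [mkQ_apply, Quotient.mk_eq_zero] at hx'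
        have : (ψ' ∘ₗ O.subtype) ⟨x, hx, hx'⟩ = (ψ ∘ₗ O.subtype) ⟨x, hx, hx'⟩ := by
          rw [hψ, hψ']
        exact sub_eq_zero.2 this)
      have h₁ : RankRep F N (coextend a A e ψ') := by
        refine h.of_map (P := (LinearMap.fst F W F).prod
          (LinearMap.snd F W F + χ ∘ₗ (span F (a '' B)).mkQ ∘ₗ LinearMap.fst F W F))
          (d := fun _ => 1) (by simp) ?_ ?_
        · intro x hx
          rw [one_smul]
          unfold coextend
          by_cases hxe : x = e
          · simp [hxe]
          · by_cases hxA : x ∈ A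
            · have := hχ (a x) (subset_span ⟨x, hxA, rfl⟩)
              rw [mkQ_apply] at this
              simp [hxe, hxA, this]
            · have hxB : x ∈ B := (hAB ⟨hN ▸ hx, hxe⟩).resolve_left hxA
              have : (Submodule.Quotient.mk (a x) : W ⧸ span F (a '' B)) = 0 :=
                (Quotient.mk_eq_zero _).2 (subset_span ⟨x, hxB, rfl⟩)
              simp [hxe, hxA, this]
        · rintro ⟨w, c⟩ - hw
          have h₂ : w = 0 := congrArg Prod.fst hw
          have h₃ := congrArg Prod.snd hw
          subst h₂
          simpa using h₃
      refine ext_rk (hN.trans hN'.symm) fun X hX => ?_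
      rw [h₁ X (by rwa [hN, ← hN']), h' X hX])
  refine ⟨S, ?_, hSE, fun N hN ⟨ψ, hψ⟩ hr => hSN N hN ⟨_, ψ, rfl, hψ⟩ hr⟩
  have hc : Nat.card (Module.Dual F O) = Fintype.card F ^ finrank F O := by
    rw [Module.natCard_eq_pow_finrank (K := F), Nat.card_eq_fintype_card,
      Subspace.dual_finrank_eq]
  exact (hS.trans_eq hc).trans (Nat.pow_le_pow_right Fintype.card_pos hT)

theorem exists_functional {V : Type*} [AddCommGroup V] [Module F V] {p : Submodule F V} {v : V}
    (hv : v ∉ p) : ∃ φ : V →ₗ[F] F, φ v = 1 ∧ ∀ x ∈ p, φ x = 0 := by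
  obtain ⟨f, hf, hp⟩ := Submodule.exists_le_ker_of_notMem hv
  refine ⟨(f v)⁻¹ • f, by simp [hf], fun x hx => ?_⟩
  have : f x = 0 := hp hx
  simp [this]

/-- A representable matroid is a coextension of any representation of a contraction, up to
equivalence. -/
theorem RankRep.exists_coextend {N : Matroid α} [N.Finite] {V W : Type*} [AddCommGroup V]
    [Module F V] [FiniteDimensional F V] [AddCommGroup W] [Module F W] [FiniteDimensional F W]
    {b : α → V} (hb : RankRep F N b) {e : α} (he : e ∈ N.E) {A B : Set α}
    (hAB : A ∪ B = N.E \ {e}) (hA : e ∉ N.closure A) (hB : e ∉ N.closure B) {a : α → W}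
    (ha : RankRep F (N ／ {e}) a) {P : (V ⧸ span F (b '' {e})) →ₗ[F] W} {d : α → F}
    (hP : ∀ x ∈ N.E \ {e}, d x ≠ 0 ∧ P ((span F (b '' {e})).mkQ (b x)) = d x • a x) :
    ∃ ψ : W →ₗ[F] F, RankRep F N (coextend a A e ψ) := by
  have hAE : A ⊆ N.E \ {e} := hAB ▸ Set.subset_union_left
  have hBE : B ⊆ N.E \ {e} := hAB ▸ Set.subset_union_right
  rw [hb.mem_closure_iff he (hAE.trans Set.sdiff_subset)] at hA
  rw [hb.mem_closure_iff he (hBE.trans Set.sdiff_subset)] at hB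
  have hinj := (hb.contract (Set.singleton_subset_iff.2 he)).inj_of_map ha
    (fun x hx => (hP x hx).1) (fun x hx => (hP x hx).2)
  set P' := P ∘ₗ (span F (b '' {e})).mkQ with hP'
  have hP'e : P' (b e) = 0 := by
    rw [hP', LinearMap.comp_apply, mkQ_apply,
      (Quotient.mk_eq_zero _).2 (subset_span (Set.mem_image_of_mem b (Set.mem_singleton e))),
      map_zero]
  have hker : ∀ w ∈ span F (b '' N.E), P' w = 0 → ∃ c : F, c • b e = w := by
    intro w hw hPw
    have h₁ : (span F (b '' {e})).mkQ w ∈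
        span F ((fun x => (span F (b '' {e})).mkQ (b x)) '' (N ／ {e}).E) := by
      have h₂ := mem_map_of_mem (f := (span F (b '' {e})).mkQ) hw
      rw [map_span, ← Set.image_comp, ← insert_ground_diff he, Set.image_insert_eq,
        span_insert] at h₂
      have h₃ : ((span F (b '' {e})).mkQ ∘ b) e = 0 :=
        (Quotient.mk_eq_zero _).2 (subset_span (Set.mem_image_of_mem b (Set.mem_singleton e)))
      rw [h₃, span_singleton_eq_bot.2 rfl, bot_sup_eq] at h₂
      exact h₂
    have h₄ := hinj _ h₁ hPw
    rw [mkQ_apply, Quotient.mk_eq_zero, Set.image_singleton] at h₄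
    exact mem_span_singleton.1 h₄
  have hle : ∀ {X : Set α}, X ⊆ N.E \ {e} → span F (b '' X) ≤ span F (b '' N.E) :=
    fun hX => span_mono (Set.image_mono (hX.trans Set.sdiff_subset))
  -- The extra coordinate `φ` is normalised to vanish on `B`, possible as `e` is not in its span. On
  -- `span A`, which also avoids the kernel generated by `e`, it factors through the contraction and
  -- yields `ψ`.
  obtain ⟨φ, hφe, hφB⟩ := exists_functional hB
  obtain ⟨ψ, hψ⟩ := exists_factor (span F (b '' A)) P' φ (by
    intro x hx hx0
    obtain ⟨c, rfl⟩ := hker x (hle hAE hx) hx0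
    by_cases hc : c = 0
    · simp [hc]
    · exact absurd (((span F (b '' A)).smul_mem_iff hc).1 hx) hA)
  refine ⟨ψ, hb.of_map (P := P'.prod φ) (d := fun x => open Classical in if x = e then 1 else d x)
    ?_ ?_ ?_⟩
  · intro x hx
    by_cases hxe : x = e
    · simp [hxe]
    · simpa [hxe] using (hP x ⟨hx, hxe⟩).1
  · intro x hx
    unfold coextend
    by_cases hxe : x = e
    · subst hxe; simp [hP'e, hφe]
    · have h₁ : P' (b x) = d x • a x := (hP x ⟨hx, hxe⟩).2
      by_cases hxA : x ∈ A
      · have h₂ := hψ (b x) (subset_span ⟨x, hxA, rfl⟩)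
        rw [h₁, map_smul, smul_eq_mul] at h₂
        simp [hxe, hxA, h₁, h₂]
      · have hxB : x ∈ B := by
          have : x ∈ A ∪ B := hAB ▸ ⟨hx, hxe⟩
          exact this.resolve_left hxA
        have h₂ := hφB (b x) (subset_span ⟨x, hxB, rfl⟩)
        simp [hxe, hxA, h₁, h₂]
  · intro w hw hw0
    obtain ⟨c, rfl⟩ := hker w hw (congrArg Prod.fst hw0)
    have : φ (c • b e) = 0 := congrArg Prod.snd hw0
    rw [map_smul, hφe, smul_eq_mul, mul_one] at this
    rw [this, zero_smul]

/-- Adding `e` to the inherited queries and querying `{e}` fixes the contraction; four further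
queries keep `e` out of the closures of `A` and `B` in the competitor. Only boundedly many
coextensions of each listed representation then remain. -/
theorem hasCertificate_of_contract [M.Finite] [Fintype F] {e : α} {k s T : ℕ} (he : e ∈ M.E)
    {A B : Set α} (hAB : A ∪ B = M.E \ {e})
    (hA : e ∉ M.closure A) (hB : e ∉ M.closure B) (hT : rk M A + rk M B + 1 ≤ rk M M.E + T)
    (h : HasCertificate F (M ／ {e}) k) (hs : HasAtMostInequivReps F (M ／ {e}) s) :
    HasCertificate F M (k + 5 + s * Fintype.card F ^ T) := by
  classical
  have hMe : (M ／ {e}).Finite := ⟨M.ground_finite.subset Set.sdiff_subset⟩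
  obtain ⟨S, hS, hSE, hSN⟩ := h
  obtain ⟨R, hR, hRrep, hRall⟩ := hs.exists_finset
  have hAE : A ⊆ M.E \ {e} := hAB ▸ Set.subset_union_left
  have hBE : B ⊆ M.E \ {e} := hAB ▸ Set.subset_union_right
  have heE : {e} ⊆ M.E := Set.singleton_subset_iff.2 he
  have hdis : ∀ {X : Set α}, X ⊆ M.E \ {e} → Disjoint X {e} :=
    fun hX => Set.disjoint_left.2 fun x hx => (hX hx).2
  have hrke : rk M {e} = 1 := by
    have := rk_insert_of_notMem_closure he
      (fun h => hA (M.closure_subset_closure (Set.empty_subset A) h))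
    rwa [rk_empty, insert_empty_eq] at this
  have hoverlap : ∀ r ∈ R, finrank F (span F (r.2 '' A) ⊓ span F (r.2 '' B) :
      Submodule F (Fin r.1 → F)) ≤ T := by
    intro r hr
    have e₁ := finrank_sup_add_finrank_inf_eq (span F (r.2 '' A)) (span F (r.2 '' B))
    rw [← span_union, ← Set.image_union, ← hRrep r hr A hAE, ← hRrep r hr B hBE, hAB,
      ← hRrep r hr (M.E \ {e}) subset_rfl] at e₁
    have e₂ := rk_contract_add (M := M) (hAE.trans Set.sdiff_subset) heE (hdis hAE)
    have e₃ := rk_contract_add (M := M) (hBE.trans Set.sdiff_subset) heE (hdis hBE)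
    have e₄ := rk_contract_add (M := M) (X := M.E \ {e}) Set.sdiff_subset heE (hdis subset_rfl)
    rw [Set.union_singleton, rk_insert_of_notMem_closure he hA] at e₂
    rw [Set.union_singleton, rk_insert_of_notMem_closure he hB] at e₃
    rw [Set.union_singleton, insert_ground_diff he] at e₄
    omega
  have hQ : ∀ r : Σ m : ℕ, α → Fin m → F, ∃ Sr : Finset (Set α), r ∈ R →
      Sr.card ≤ Fintype.card F ^ T ∧ (∀ X ∈ Sr, X ⊆ M.E) ∧
      ∀ N : Matroid α, N.E = M.E → (∃ ψ : (Fin r.1 → F) →ₗ[F] F,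
        RankRep F N (coextend r.2 A e ψ)) → (∀ X ∈ Sr, rk N X = rk M X) → N = M := by
    intro r
    by_cases hr : r ∈ R
    · obtain ⟨Sr, hSr⟩ := exists_queries_of_contract (M := M) e hAB.ge r.2 (hoverlap r hr)
      exact ⟨Sr, fun _ => hSr⟩
    · exact ⟨∅, fun h => absurd h hr⟩
  choose Sr hSr using hQ
  refine ⟨(S.image (insert e) ∪ {{e}, A, insert e A, B, insert e B}) ∪ R.biUnion Sr, ?_, ?_, ?_⟩
  · refine (Finset.card_union_le _ _).trans (Nat.add_le_add
      ((Finset.card_union_le _ _).trans (Nat.add_le_add (Finset.card_image_le.trans hS)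
        Finset.card_le_five)) ?_)
    exact (Finset.card_biUnion_le_card_mul _ _ _ fun r hr => (hSr r hr).1).trans
      (Nat.mul_le_mul_right _ hR)
  · intro X hX
    rcases Finset.mem_union.1 hX with hX | hX
    · rcases Finset.mem_union.1 hX with hX | hX
      · obtain ⟨Y, hY, rfl⟩ := Finset.mem_image.1 hX
        exact Set.insert_subset he ((hSE Y hY).trans Set.sdiff_subset)
      · have hA' := hAE.trans Set.sdiff_subset
        have hB' := hBE.trans Set.sdiff_subset
        simp only [Finset.mem_insert, Finset.mem_singleton] at hX
        rcases hX with rfl | rfl | rfl | rfl | rfl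
        exacts [heE, hA', Set.insert_subset he hA', hB', Set.insert_subset he hB']
    · obtain ⟨r, hr, hX⟩ := Finset.mem_biUnion.1 hX
      exact (hSr r hr).2.1 X hX
  · intro N hN hrep hr
    have hNfin := finite_of_ground_eq hN
    have hr₁ : ∀ X ∈ ({{e}, A, insert e A, B, insert e B} : Finset (Set α)), rk N X = rk M X :=
      fun X hX => hr X (Finset.mem_union_left _ (Finset.mem_union_right _ hX))
    have hre := hr₁ {e} (by simp)
    have hcon : N ／ {e} = M ／ {e} := by
      refine hSN _ (by simp [hN]) ?_ fun X hX => ?_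
      · have := hrep.minor (C := {e}) (D := ∅) (hN ▸ heE)
        rwa [Matroid.delete_empty] at this
      · have hXE : X ⊆ M.E \ {e} := hSE X hX
        have e₁ := rk_contract_add (M := M) (hXE.trans Set.sdiff_subset) heE (hdis hXE)
        have e₂ := rk_contract_add (M := N) (hN ▸ hXE.trans Set.sdiff_subset) (hN ▸ heE) (hdis hXE)
        have e₃ := hr (insert e X) (Finset.mem_union_left _ (Finset.mem_union_left _
          (Finset.mem_image_of_mem _ hX)))
        rw [Set.union_singleton] at e₁ e₂
        omega
    have hNcl : ∀ {X : Set α}, e ∉ M.closure X → rk N X = rk M X →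
        rk N (insert e X) = rk M (insert e X) → e ∉ N.closure X := by
      intro X h₁ h₂ h₃
      rw [mem_closure_iff_rk_insert (hN ▸ he), h₂, h₃, rk_insert_of_notMem_closure he h₁]
      omega
    have hNA := hNcl hA (hr₁ _ (by simp)) (hr₁ _ (by simp))
    have hNB := hNcl hB (hr₁ _ (by simp)) (hr₁ _ (by simp))
    obtain ⟨m, b, hb⟩ := hrep.exists_rankRep
    have hbc := hb.contract (C := {e}) (hN ▸ heE)
    rw [hcon] at hbc
    obtain ⟨r, hrR, P, d, hP⟩ := hRall _ hbc
    refine (hSr r hrR).2.2 N hN (hb.exists_coextend (hN ▸ he) (hN ▸ hAB) hNA hNB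
      (hcon ▸ hRrep r hrR) (P := P) (d := d) (fun x hx => hP x (show x ∈ M.E \ {e} from hN ▸ hx))) fun X hX => hr X
      (Finset.mem_union_right _ (Finset.mem_biUnion.2 ⟨r, hrR, hX⟩))

end Contraction
end MatroidCert

namespace MatroidCert
open Module Submodule
open scoped Matroid
set_option linter.unusedSectionVars false

/-! ### Choosing deletion or contraction, and the induction -/

section Main

variable {α : Type u} {F : Type v} [Field F] {M : Matroid α}

theorem RankRep.finrank_inf_of_delete {W : Type*} [AddCommGroup W] [Module F W]
    [FiniteDimensional F W] {a : α → W} {e : α} (ha : RankRep F (M ＼ {e}) a) {X Y : Set α}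
    (h : X ∪ Y = M.E \ {e}) :
    finrank F (span F (a '' X) ⊓ span F (a '' Y) : Submodule F W) + rk M (M.E \ {e}) =
      rk M X + rk M Y := by
  have hX : X ⊆ M.E \ {e} := h ▸ Set.subset_union_left
  have hY : Y ⊆ M.E \ {e} := h ▸ Set.subset_union_right
  have e₁ := finrank_sup_add_finrank_inf_eq (span F (a '' X)) (span F (a '' Y))
  rw [← span_union, ← Set.image_union, h, ← ha X hX, ← ha Y hY,
    ← ha (M.E \ {e}) subset_rfl, rk_delete hX, rk_delete hY, rk_delete subset_rfl] at e₁
  omega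

theorem IsSeparation.rk_add_rk_lt {t : ℤ} {A B : Set α} (h : IsSeparation M t A B) :
    (rk M A : ℤ) + rk M B < rk M M.E + t := by
  obtain ⟨hAB, hd, hc⟩ := h
  have : M.E \ A = B := by rw [← hAB, Set.union_sdiff_left, hd.sdiff_eq_right]
  rw [conn, this] at hc
  omega

theorem IsSeparation.sdiff_union_sdiff {t : ℤ} {A B : Set α} (h : IsSeparation M t A B) (e : α) :
    (A \ {e}) ∪ (B \ {e}) = M.E \ {e} := by
  rw [← h.1, Set.union_sdiff_distrib]

theorem IsSeparation.rk_sdiff_add_le [M.Finite] {t : ℤ} {A B : Set α} (h : IsSeparation M t A B)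
    (e : α) : rk M (A \ {e}) + rk M (B \ {e}) + 1 ≤ rk M M.E + t.toNat := by
  have := h.rk_add_rk_lt
  have := rk_mono M (X := A \ {e}) (Y := A) Set.sdiff_subset
  have := rk_mono M (X := B \ {e}) (Y := B) Set.sdiff_subset
  omega

/-- `spanGuts` lies in the spans of both sides, whose intersection has dimension bounded by the
order of the separation. -/
theorem InGuts.finrank_spanGuts_le [M.Finite] {W : Type*} [AddCommGroup W] [Module F W]
    [FiniteDimensional F W] {a : α → W} {e : α} (ha : RankRep F (M ＼ {e}) a) {t : ℤ}
    (he : e ∈ M.E) (h : InGuts M t e) : finrank F (spanGuts F M a e) ≤ t.toNat := by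
  obtain ⟨A, B, hsep, hA, hB⟩ := h
  have hu := hsep.sdiff_union_sdiff e
  have hAE : A \ {e} ⊆ M.E \ {e} := hu ▸ Set.subset_union_left
  have hBE : B \ {e} ⊆ M.E \ {e} := hu ▸ Set.subset_union_right
  have e₁ := finrank_mono (le_inf (spanGuts_le (F := F) (a := a) hAE hA) (spanGuts_le hBE hB))
  have e₂ := ha.finrank_inf_of_delete hu
  have e₃ := hsep.rk_sdiff_add_le e
  have e₄ := rk_insert_of_mem_closure (M.closure_subset_closure hAE hA)
  rw [insert_ground_diff he] at e₄
  omega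

/-- The cost of one step of the induction on the number of elements. -/
def stepCost (q s t : ℕ) : ℕ :=
  6 + s + s * (q ^ (max (q ^ 2) t) + (q + 1) * (q + 1)) + s * q ^ (q ^ 2 + 1 + t)

theorem HasCertificate.step [M.Finite] [Fintype F] {C : Matroid α → Prop} {s k : ℕ} {t : ℤ}
    {e : α} (he : e ∈ M.E)
    (h₂ : (¬ C (M ／ {e}) → InGuts M t e) ∧ (¬ C (M ＼ {e}) → InCoguts M t e))
    (h₃ : ∀ N, N.Finite → C N → HasAtMostInequivReps F N s)
    (hk : ∀ N, N.Finite → C N → N.E = M.E \ {e} → HasCertificate F N k)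
    (h₁ : C (M ＼ {e}) ∨ C (M ／ {e})) :
    HasCertificate F M (k + stepCost (Fintype.card F) s t.toNat * (M.E.ncard + 1)) := by
  classical
  set q := Fintype.card F with hq
  have hd : (M ＼ {e}).Finite := ⟨M.ground_finite.subset Set.sdiff_subset⟩
  have hc : (M ／ {e}).Finite := ⟨M.ground_finite.subset Set.sdiff_subset⟩
  have hcontract : C (M ／ {e}) → (∃ A B, A ∪ B = M.E \ {e} ∧ e ∉ M.closure A ∧ e ∉ M.closure B ∧
      rk M A + rk M B + 1 ≤ rk M M.E + (q ^ 2 + 1 + t.toNat)) →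
      HasCertificate F M (k + stepCost q s t.toNat * (M.E.ncard + 1)) := by
    rintro hC ⟨A, B, hAB, hA, hB, hr⟩
    refine (hasCertificate_of_contract he hAB hA hB hr (hk _ hc hC rfl) (h₃ _ hc hC)).mono ?_
    have h₅ : stepCost q s t.toNat ≤ stepCost q s t.toNat * (M.E.ncard + 1) :=
      Nat.le_mul_of_pos_right _ (Nat.succ_pos _)
    have h₆ : 5 + s * q ^ (q ^ 2 + 1 + t.toNat) ≤ stepCost q s t.toNat := by
      unfold stepCost; omega
    rw [← hq]
    omega
  by_cases hD : C (M ＼ {e})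
  · by_cases hcl : e ∈ M.closure (M.E \ {e})
    · set E' := (M.ground_finite.subset (Set.sdiff_subset (t := {e}))).toFinset
      have hE' : (E' : Set α) = M.E \ {e} := Set.Finite.coe_toFinset _
      by_cases hcov : ∀ (m : ℕ) (a : α → Fin m → F), RankRep F (M ＼ {e}) a →
          finrank F (spanGuts F M a e) ≤ max (q ^ 2) t.toNat ∨
          CoveredBySpans a E' (spanGuts F M a e) ((q + 1) * (q + 1))
      · refine (hasCertificate_of_delete he hcl (hk _ hd hD rfl) (h₃ _ hd hD) hE' hcov).mono ?_
        have h₅ : s * (M.E.ncard + (q ^ max (q ^ 2) t.toNat + (q + 1) * (q + 1))) =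
          s * M.E.ncard + s * (q ^ max (q ^ 2) t.toNat + (q + 1) * (q + 1)) := Nat.mul_add _ _ _
        have h₆ : s * M.E.ncard ≤ stepCost q s t.toNat * M.E.ncard :=
          Nat.mul_le_mul_right _ (by unfold stepCost; omega)
        have h₇ : 1 + s * (q ^ max (q ^ 2) t.toNat + (q + 1) * (q + 1)) ≤ stepCost q s t.toNat := by
          unfold stepCost; omega
        have h₈ := Nat.mul_succ (stepCost q s t.toNat) M.E.ncard
        rw [← hq, h₅, h₈]
        omega
      · push Not at hcov
        obtain ⟨m, a, ha, hbig, hncov⟩ := hcov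
        -- Otherwise hypothesis (a) would bound the dimension of `spanGuts` by `t`.
        have hC : C (M ／ {e}) := by
          by_contra hC
          have := (h₂.1 hC).finrank_spanGuts_le ha he
          have := le_max_right (q ^ 2) t.toNat
          omega
        refine hcontract hC ?_
        -- If no thin cut has `e` outside both closures, then `spanGuts` lies in one side of every
        -- thin cut, and the covering theorem applies. The `+ 1` in the exponent q² + 1 + t comes
        -- from passing between the order of a cut of `M ＼ {e}` and the overlap bound for
        -- contraction.
        by_contra! hno
        refine hncov (coveredBySpans_of_finrank a ((le_max_left _ _).trans_lt hbig) ?_)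
        intro Y hY hle
        have hu : ((E' \ Y : Finset α) : Set α) ∪ (Y : Set α) = M.E \ {e} := by
          rw [← Finset.coe_union, Finset.sdiff_union_of_subset hY, hE']
        have hYE : (Y : Set α) ⊆ M.E \ {e} := hu ▸ Set.subset_union_right
        have hY'E : ((E' \ Y : Finset α) : Set α) ⊆ M.E \ {e} := hu ▸ Set.subset_union_left
        have e₁ := ha.finrank_inf_of_delete hu
        have e₂ := rk_mono M (X := M.E \ {e}) (Y := M.E) Set.sdiff_subset
        by_cases hcY : e ∈ M.closure ((E' \ Y : Finset α) : Set α)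
        · exact Or.inl (spanGuts_le hY'E hcY)
        · by_cases hcY' : e ∈ M.closure (Y : Set α)
          · exact Or.inr (spanGuts_le hYE hcY')
          · have e₃ := hno _ _ hu hcY hcY'
            have e₄ : finrank F (span F (a '' ((E' \ Y : Finset α) : Set α)) ⊓
              span F (a '' (Y : Set α)) : Submodule F (Fin m → F)) ≤ q ^ 2 := hle
            omega
    · refine (hasCertificate_of_coloop he hcl (hk _ hd hD rfl)).mono ?_
      have h₅ : stepCost q s t.toNat ≤ stepCost q s t.toNat * (M.E.ncard + 1) :=
        Nat.le_mul_of_pos_right _ (Nat.succ_pos _)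
      have h₆ : 1 ≤ stepCost q s t.toNat := by unfold stepCost; omega
      omega
  · refine hcontract (h₁.resolve_left hD) ?_
    obtain ⟨A, B, hsep, hA, hB⟩ := h₂.2 hD
    have hu := hsep.sdiff_union_sdiff e
    have hdis : Disjoint (A \ {e}) (B \ {e}) :=
      hsep.2.1.mono Set.sdiff_subset Set.sdiff_subset
    have h₅ : (M.E \ (B \ {e})) \ {e} = A \ {e} := by
      rw [Set.sdiff_sdiff_comm, ← hu, Set.union_sdiff_right, hdis.sdiff_eq_left]
    have h₆ : (M.E \ (A \ {e})) \ {e} = B \ {e} := by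
      rw [Set.sdiff_sdiff_comm, ← hu, Set.union_sdiff_left, hdis.sdiff_eq_right]
    have h₇ := notMem_closure_of_mem_dual_closure hB (by simp)
    have h₈ := notMem_closure_of_mem_dual_closure hA (by simp)
    rw [h₅] at h₇
    rw [h₆] at h₈
    have := hsep.rk_sdiff_add_le e
    exact ⟨A \ {e}, B \ {e}, hu, h₇, h₈, by omega⟩

theorem hasCertificate_of_class [Fintype F] {C : Matroid α → Prop} {s : ℕ} {t : ℤ}
    (h₁ : ∀ M, M.Finite → C M → M.E.Nonempty → ∃ e ∈ M.E, C (M ＼ {e}) ∨ C (M ／ {e}))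
    (h₂ : ∀ M, M.Finite → C M → ∀ e ∈ M.E,
      (¬ C (M ／ {e}) → InGuts M t e) ∧ (¬ C (M ＼ {e}) → InCoguts M t e))
    (h₃ : ∀ M, M.Finite → C M → HasAtMostInequivReps F M s) (n : ℕ) :
    ∀ M, M.Finite → C M → M.E.ncard = n →
      HasCertificate F M (2 * stepCost (Fintype.card F) s t.toNat * n ^ 2) := by
  induction n with
  | zero =>
    intro M hM _ hn
    rw [Set.ncard_eq_zero hM.ground_finite] at hn
    refine ⟨∅, by simp, by simp, fun N hN _ _ => ?_⟩
    have := finite_of_ground_eq hN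
    refine ext_rk hN fun X hX => ?_
    rw [hn, Set.subset_empty_iff] at hX
    rw [hX, rk_empty, rk_empty]
  | succ m ih =>
    intro M hM hC hn
    obtain ⟨e, he, hCe⟩ := h₁ M hM hC (Set.nonempty_of_ncard_ne_zero (by omega))
    have hm : (M.E \ {e}).ncard = m := by
      rw [Set.ncard_sdiff_singleton_of_mem he]; omega
    refine (HasCertificate.step he (h₂ M hM hC e he) h₃
      (fun N hN hCN hNE => ih N hN hCN (hNE ▸ hm)) hCe).mono ?_
    rw [hn]
    set K := stepCost (Fintype.card F) s t.toNat
    -- The factor 2 absorbs the additive constant in the cost K(m + 2) of a step.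
    have : 2 * K * m ^ 2 + K * (m + 1 + 1) + 3 * (K * m) = 2 * K * (m + 1) ^ 2 := by ring
    omega

theorem exists_excludedMinor (n : ℕ) : ∀ M : Matroid α, M.Finite → ¬ Representable F M →
    M.E.ncard = n → ∃ N, N ≤m M ∧ IsExcludedMinor F N := by
  induction n using Nat.strong_induction_on with
  | _ n ih =>
  intro M hM hrep hn
  by_cases h : ∀ N : Matroid α, N <m M → Representable F N
  · exact ⟨M, Matroid.IsMinor.refl, hM, hrep, h⟩
  · push Not at h
    obtain ⟨N, hNM, hN⟩ := h
    have hss := hNM.ssubset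
    obtain ⟨N', hN'N, hN'⟩ := ih _ (hn ▸ Set.ncard_lt_ncard hss hM.ground_finite) N
      ⟨hM.ground_finite.subset hss.subset⟩ hN rfl
    exact ⟨N', hN'N.trans hNM.isMinor, hN'⟩

/-- A certificate for a nonrepresentable minor lifts to the matroid. -/
theorem exists_certifiesNonrep_of_minor [M.Finite] {C D : Set α} (hC : C ⊆ M.E)
    {k : ℕ} (hrep : ¬ Representable F (M ／ C ＼ D)) (h : HasCertificate F (M ／ C ＼ D) k) :
    ∃ S : Finset (Set α), S.card ≤ k + 1 ∧ CertifiesNonrep F M S := by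
  classical
  obtain ⟨S, hS, hSE, hSN⟩ := h
  -- Ranks in the minor are differences of the ranks of `X ∪ C` and `C`.
  refine ⟨insert C (S.image (· ∪ C)), (Finset.card_insert_le _ _).trans
    (Nat.add_le_add_right (Finset.card_image_le.trans hS) 1), ?_, ?_⟩
  · intro X hX
    rcases Finset.mem_insert.1 hX with rfl | hX
    · exact hC
    · obtain ⟨Y, hY, rfl⟩ := Finset.mem_image.1 hX
      exact Set.union_subset ((hSE Y hY).trans (Set.sdiff_subset.trans Set.sdiff_subset)) hC
  · intro N hN hr hNrep
    have := finite_of_ground_eq hN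
    apply hrep
    have hNC : C ⊆ N.E := hN ▸ hC
    rw [← hSN (N ／ C ＼ D) (by simp [hN]) (hNrep.minor hNC) ?_]
    · exact hNrep.minor hNC
    · intro X hX
      have hXE : X ⊆ (M.E \ C) \ D := hSE X hX
      have hXC : X ⊆ M.E \ C := hXE.trans Set.sdiff_subset
      have hXM : X ⊆ M.E := hXC.trans Set.sdiff_subset
      have hd : Disjoint X C := Set.disjoint_left.2 fun x hx => (hXC hx).2
      rw [rk_delete (M := M ／ C) hXE, rk_delete (M := N ／ C) (by simpa [hN] using hXE)]
      have e₁ := rk_contract_add hXM hC hd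
      have e₂ := rk_contract_add (M := N) (hN ▸ hXM) hNC hd
      have e₃ := hr C (Finset.mem_insert_self _ _)
      have e₄ := hr (X ∪ C) (Finset.mem_insert_of_mem (Finset.mem_image_of_mem _ hX))
      omega

theorem representable_of_ground_eq_empty [M.Finite] (h : M.E = ∅) : Representable F M := by
  refine RankRep.representable (a := fun _ => (0 : F)) fun X hX => ?_
  rw [h, Set.subset_empty_iff] at hX
  rw [hX, rk_empty, Set.image_empty, span_empty, finrank_bot]

end Main
end MatroidCert

theorem mainTheorem2 (q : ℕ) (hq : IsPrimePow q)
    (F : Type v) [Field F] [Fintype F] (hF : Fintype.card F = q)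
    (C : ∀ ⦃α : Type u⦄, Matroid α → Prop)
    (h1 : ∀ ⦃α : Type u⦄ (M : Matroid α), M.Finite → C M → M.E.Nonempty →
      ∃ e ∈ M.E, C (M ＼ {e}) ∨ C (M ／ {e}))
    (h2 : ∃ t : ℤ, ∀ ⦃α : Type u⦄ (M : Matroid α), M.Finite → C M → ∀ e ∈ M.E,
      (¬ C (M ／ {e}) → InGuts M t e) ∧ (¬ C (M ＼ {e}) → InCoguts M t e))
    (h3 : ∃ s : ℕ, ∀ ⦃α : Type u⦄ (M : Matroid α), M.Finite → C M →
      HasAtMostInequivReps F M s)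
    (h4 : ∀ ⦃α : Type u⦄ (M : Matroid α), IsExcludedMinor F M → C M) :
    ∃ c : ℕ, ∀ ⦃α : Type u⦄ (M : Matroid α), M.Finite → ¬ Representable F M →
      ∃ S : Finset (Set α), S.card ≤ c * M.E.ncard ^ 2 ∧ CertifiesNonrep F M S := by
  classical
  obtain ⟨t, ht⟩ := h2
  obtain ⟨s, hs⟩ := h3
  -- The final `+ 1` pays for the query of the contracted set; it fits in n² because a matroid on
  -- the empty set is representable.
  refine ⟨2 * stepCost (Fintype.card F) s t.toNat + 1, fun α M hM hrep => ?_⟩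
  obtain ⟨N, hNM, hN⟩ := exists_excludedMinor M.E.ncard M hM hrep rfl
  obtain ⟨X, Y, hX, -, -, rfl⟩ := hNM.exists_eq_contract_delete_disjoint
  have hcert := hasCertificate_of_class (F := F) (C := @C α) (fun M => h1 M) (fun M => ht M)
    (fun M => hs M) _ _ hN.1 (h4 _ hN) rfl
  obtain ⟨S, hS, hS'⟩ := exists_certifiesNonrep_of_minor hX hN.2.1 hcert
  refine ⟨S, hS.trans ?_, hS'⟩
  have hpos : 1 ≤ M.E.ncard := by
    rw [Nat.one_le_iff_ne_zero, Ne, Set.ncard_eq_zero hM.ground_finite]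
    exact fun h => hrep (representable_of_ground_eq_empty h)
  have hle : (M ／ X ＼ Y).E.ncard ≤ M.E.ncard :=
    Set.ncard_le_ncard (Set.sdiff_subset.trans Set.sdiff_subset) hM.ground_finite
  rw [Nat.add_mul, one_mul]
  exact Nat.add_le_add (Nat.mul_le_mul_left _ (Nat.pow_le_pow_left hle 2))
    (Nat.one_le_pow _ _ hpos)
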